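/- Let $m, n, i \ge 0$ be integers with $i \le n$, let $V = \mathbb{C}^m$, let $L$ be the free Lie algebra on $V$, and let $\mathfrak{g} = L^{\oplus n}$. The group $GL(V)$ acts on $\mathfrak{g}$ by Lie algebra automorphisms (extending its action on $V$ to each summand $L$), $S_n$ acts on $\mathfrak{g}$ by permuting the $n$ summands, and hence $GL(V) \times S_n$ acts on the Lie algebra cohomology $H^i(\mathfrak{g}, \mathbb{C}) = \mathrm{Ext}^i_{U(\mathfrak{g})}(\mathbb{C}, \mathbb{C})$. Let $\mu$ be a partition of $i$ with conjugate partition $\mu'$, and assume that $\mu'$ has at most $m$ parts. Let $S^\mu$ be the Specht module of $S_i$ attached to $\mu$, and let $\mathbb{S}^{\mu'}$ be the Schur functor attached to $\mu'$. Then the representation $\mathbb{S}^{\mu'}(V^*)$ of $GL(V)$ is irreducible, and its multiplicity space in the cohomology is, as an $S_n$-module, $$\mathrm{Hom}_{GL(V)}\bigl(\mathbb{S}^{\mu'}(V^*),\, H^i(\mathfrak{g}, \mathbb{C})\bigr) \;\cong\; M_n^\mu = \mathrm{Ind}_{S_i \times S_{n-i}}^{S_n}\bigl(S^\mu \boxtimes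 \mathbf{1}\bigr).$$ -/

import Mathlib

namespace ExtFunctoriality

open CategoryTheory CategoryTheory.Abelian CategoryTheory.Limits

/-! Functoriality of `Ext` along exact functors: naturality in the functor, composition, identity. -/

lemma natTrans {C D : Type*} [Category* C] [Abelian C]
    [Category* D] [Abelian D] [HasExt.{0} C] [HasExt.{0} D] [EnoughProjectives C]
    (F F' : C ⥤ D) [F.Additive] [PreservesFiniteLimits F] [PreservesFiniteColimits F]
    [F'.Additive] [PreservesFiniteLimits F'] [PreservesFiniteColimits F']
    (τ : F ⟶ F') {n : ℕ} {X Y : C} (e : Ext X Y n) :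
    (e.mapExactFunctor F).comp (Ext.mk₀ (τ.app Y)) (add_zero n) =
      (Ext.mk₀ (τ.app X)).comp (e.mapExactFunctor F') (zero_add n) := by
  induction n generalizing X with
  | zero =>
    obtain ⟨f, rfl⟩ := (Ext.mk₀_bijective X Y).2 e
    simp [Ext.mapExactFunctor_mk₀]
  | succ n hn =>
    let P : ProjectivePresentation X := Classical.arbitrary _
    have := P.projective
    let S := ShortComplex.mk _ _ (kernel.condition P.f)
    have hS : S.ShortExact := { exact := ShortComplex.exact_kernel P.f }
    have : Subsingleton (Ext S.X₂ Y (n + 1)) := Ext.subsingleton_of_projective _ _ _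
    obtain ⟨e', rfl⟩ := Ext.contravariant_sequence_exact₃ hS Y e (by subsingleton) (add_comm 1 n)
    have key : (hS.extClass.mapExactFunctor F).comp (Ext.mk₀ (τ.app S.X₁)) (add_zero 1) =
        (Ext.mk₀ (τ.app S.X₃)).comp (hS.extClass.mapExactFunctor F') (zero_add 1) := by
      rw [Ext.mapExactFunctor_extClass, Ext.mapExactFunctor_extClass]
      exact ShortComplex.ShortExact.extClass_naturality (hS.map_of_exact F) (hS.map_of_exact F')
        (S.mapNatTrans τ)
    rw [Ext.mapExactFunctor_comp, Ext.mapExactFunctor_comp,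
      Ext.comp_assoc _ _ _ _ (add_zero n) (by lia), hn,
      ← Ext.comp_assoc _ _ _ (add_zero 1) _ (by lia), key,
      Ext.comp_assoc _ _ _ _ (add_comm 1 n) (by lia)]

lemma mapComp {C D E : Type*} [Category* C] [Abelian C]
    [Category* D] [Abelian D] [Category* E] [Abelian E] [HasExt.{0} C] [HasExt.{0} D]
    [HasExt.{0} E] [EnoughProjectives C]
    (F : C ⥤ D) (G : D ⥤ E) [F.Additive] [PreservesFiniteLimits F] [PreservesFiniteColimits F]
    [G.Additive] [PreservesFiniteLimits G] [PreservesFiniteColimits G]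
    [PreservesFiniteLimits (F ⋙ G)] [PreservesFiniteColimits (F ⋙ G)]
    {n : ℕ} {X Y : C} (e : Ext X Y n) :
    e.mapExactFunctor (F ⋙ G) = (e.mapExactFunctor F).mapExactFunctor G := by
  induction n generalizing X with
  | zero =>
    obtain ⟨f, rfl⟩ := (Ext.mk₀_bijective X Y).2 e
    simp [Ext.mapExactFunctor_mk₀]
  | succ n hn =>
    let P : ProjectivePresentation X := Classical.arbitrary _
    have := P.projective
    let S := ShortComplex.mk _ _ (kernel.condition P.f)
    have hS : S.ShortExact := { exact := ShortComplex.exact_kernel P.f }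
    have : Subsingleton (Ext S.X₂ Y (n + 1)) := Ext.subsingleton_of_projective _ _ _
    obtain ⟨e', rfl⟩ := Ext.contravariant_sequence_exact₃ hS Y e (by subsingleton) (add_comm 1 n)
    have key : hS.extClass.mapExactFunctor (F ⋙ G) =
        (hS.extClass.mapExactFunctor F).mapExactFunctor G := by
      rw [Ext.mapExactFunctor_extClass, Ext.mapExactFunctor_extClass]
      exact (Ext.mapExactFunctor_extClass G (hS.map_of_exact F)).symm
    rw [Ext.mapExactFunctor_comp, Ext.mapExactFunctor_comp, Ext.mapExactFunctor_comp, hn, key]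

lemma mapId {C : Type*} [Category* C] [Abelian C] [HasExt.{0} C] [EnoughProjectives C]
    {n : ℕ} {X Y : C} (e : Ext X Y n) :
    e.mapExactFunctor (𝟭 C) = e := by
  induction n generalizing X with
  | zero =>
    obtain ⟨f, rfl⟩ := (Ext.mk₀_bijective X Y).2 e
    simp [Ext.mapExactFunctor_mk₀]
  | succ n hn =>
    let P : ProjectivePresentation X := Classical.arbitrary _
    have := P.projective
    let S := ShortComplex.mk _ _ (kernel.condition P.f)
    have hS : S.ShortExact := { exact := ShortComplex.exact_kernel P.f }
    have : Subsingleton (Ext S.X₂ Y (n + 1)) := Ext.subsingleton_of_projective _ _ _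
    obtain ⟨e', rfl⟩ := Ext.contravariant_sequence_exact₃ hS Y e (by subsingleton) (add_comm 1 n)
    have key : hS.extClass.mapExactFunctor (𝟭 C) = hS.extClass :=
      Ext.mapExactFunctor_extClass (𝟭 C) hS
    rw [Ext.mapExactFunctor_comp, hn, key]

/-- The map `Ext^n(X, X) → Ext^n(Y, Y)` induced by an exact functor `F` and an
isomorphism `Y ≅ F X`. -/
noncomputable def conjMap {C D : Type*} [Category* C] [Abelian C]
    [Category* D] [Abelian D] [HasExt.{0} C] [HasExt.{0} D]
    (F : C ⥤ D) [F.Additive] [PreservesFiniteLimits F] [PreservesFiniteColimits F]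
    [Linear ℂ C] [Linear ℂ D] [F.Linear ℂ] {X : C} {Y : D} (α : Y ≅ F.obj X) (n : ℕ) :
    Ext X X n →ₗ[ℂ] Ext Y Y n :=
  (Ext.precompOfLinear (Ext.mk₀ α.hom) ℂ Y (zero_add n)) ∘ₗ
    (Ext.postcompOfLinear (Ext.mk₀ α.inv) ℂ (F.obj X) (add_zero n)) ∘ₗ
    F.mapExtLinearMap ℂ X X n

lemma conjMap_apply {C D : Type*} [Category* C] [Abelian C]
    [Category* D] [Abelian D] [HasExt.{0} C] [HasExt.{0} D]
    (F : C ⥤ D) [F.Additive] [PreservesFiniteLimits F] [PreservesFiniteColimits F]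
    [Linear ℂ C] [Linear ℂ D] [F.Linear ℂ] {X : C} {Y : D} (α : Y ≅ F.obj X) {n : ℕ}
    (e : Ext X X n) :
    conjMap F α n e = (Ext.mk₀ α.hom).comp
      ((e.mapExactFunctor F).comp (Ext.mk₀ α.inv) (add_zero n)) (zero_add n) := rfl

lemma conjMap_id {C : Type*} [Category* C] [Abelian C] [HasExt.{0} C] [EnoughProjectives C]
    [Linear ℂ C] (F : C ⥤ C) [F.Additive] [PreservesFiniteLimits F] [PreservesFiniteColimits F]
    [F.Linear ℂ] {X : C} (α : X ≅ F.obj X) (τ : F ⟶ 𝟭 C) (h : α.hom ≫ τ.app X = 𝟙 X)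
    {n : ℕ} (e : Ext X X n) : conjMap F α n e = e := by
  have h1 := natTrans F (𝟭 C) τ e
  have h2 : α.inv = τ.app X := ((Iso.hom_comp_eq_id α).1 h).symm
  rw [mapId] at h1
  change Ext.comp (e.mapExactFunctor F) (Ext.mk₀ (Y := X) (τ.app X)) _ =
    Ext.comp (Ext.mk₀ (Y := X) (τ.app X)) e _ at h1
  rw [conjMap_apply, h2, h1, ← Ext.comp_assoc _ _ _ (zero_add 0) _ (by lia),
    Ext.mk₀_comp_mk₀, h, Ext.mk₀_id_comp]

lemma conjMap_comp {C D E : Type*} [Category* C] [Abelian C]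
    [Category* D] [Abelian D] [Category* E] [Abelian E] [HasExt.{0} C] [HasExt.{0} D]
    [HasExt.{0} E] [EnoughProjectives C] [Linear ℂ C] [Linear ℂ D] [Linear ℂ E]
    (F : C ⥤ D) (G : D ⥤ E) (H : C ⥤ E)
    [F.Additive] [PreservesFiniteLimits F] [PreservesFiniteColimits F] [F.Linear ℂ]
    [G.Additive] [PreservesFiniteLimits G] [PreservesFiniteColimits G] [G.Linear ℂ]
    [H.Additive] [PreservesFiniteLimits H] [PreservesFiniteColimits H] [H.Linear ℂ]
    {X : C} {Y : D} {Z : E} (α : Y ≅ F.obj X) (β : Z ≅ G.obj Y) (γ : Z ≅ H.obj X)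
    (τ : H ⟶ F ⋙ G) (h : γ.hom ≫ τ.app X = β.hom ≫ G.map α.hom) {n : ℕ} (e : Ext X X n) :
    conjMap H γ n e = conjMap G β n (conjMap F α n e) := by
  have : PreservesFiniteLimits (F ⋙ G) := comp_preservesFiniteLimits F G
  have : PreservesFiniteColimits (F ⋙ G) := comp_preservesFiniteColimits F G
  have h1 := natTrans H (F ⋙ G) τ e
  rw [mapComp] at h1
  change Ext.comp (e.mapExactFunctor H) (Ext.mk₀ (Y := G.obj (F.obj X)) (τ.app X)) _ =
    Ext.comp (Ext.mk₀ (Y := G.obj (F.obj X)) (τ.app X)) _ _ at h1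
  have h' : γ.hom ≫ (show H.obj X ⟶ G.obj (F.obj X) from τ.app X) = β.hom ≫ G.map α.hom := h
  have h2 : γ.inv = (show H.obj X ⟶ G.obj (F.obj X) from τ.app X) ≫ G.map α.inv ≫ β.inv := by
    refine ((Iso.hom_comp_eq_id γ).1 ?_).symm
    rw [← Category.assoc, h', Category.assoc, ← Category.assoc (G.map α.hom), ← G.map_comp]
    simp
  rw [conjMap_apply, conjMap_apply, conjMap_apply, h2, ← Ext.mk₀_comp_mk₀,
    ← Ext.comp_assoc _ _ _ (add_zero n) _ (by lia), h1,
    Ext.comp_assoc _ _ _ _ (add_zero n) (by lia),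
    ← Ext.comp_assoc _ _ _ (zero_add 0) _ (by lia),
    Ext.mk₀_comp_mk₀, h', ← Ext.mk₀_comp_mk₀, ← Ext.mk₀_comp_mk₀]
  simp only [Ext.mapExactFunctor_comp, Ext.mapExactFunctor_mk₀,
    Ext.comp_assoc_of_third_deg_zero, Ext.comp_assoc_of_second_deg_zero]

lemma restrictScalars_exact {R S : Type} [Ring R] [Ring S] (f : R →+* S)
    (T : ShortComplex (ModuleCat.{0} S)) (hT : T.Exact) :
    (T.map (ModuleCat.restrictScalars.{0} f)).Exact := by
  rw [CategoryTheory.ShortComplex.ShortExact.moduleCat_exact_iff_function_exact] at hT ⊢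
  exact hT

instance {R S : Type} [Ring R] [Ring S] (f : R →+* S) :
    PreservesFiniteLimits (ModuleCat.restrictScalars.{0} f) := by
  have := ((Functor.exact_tfae (ModuleCat.restrictScalars.{0} f)).out 1 3).mp
    (restrictScalars_exact f)
  exact this.1

instance {R S : Type} [Ring R] [Ring S] (f : R →+* S) :
    PreservesFiniteColimits (ModuleCat.restrictScalars.{0} f) := by
  have := ((Functor.exact_tfae (ModuleCat.restrictScalars.{0} f)).out 1 3).mp
    (restrictScalars_exact f)
  exact this.2

end ExtFunctoriality

section LieCohomology

open CategoryTheory CategoryTheory.Abelian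

attribute [local instance 100] LieRing.ofAssociativeRing

variable (g h k : Type) [LieRing g] [LieAlgebra ℂ g] [LieRing h] [LieAlgebra ℂ h]
  [LieRing k] [LieAlgebra ℂ k]

/-- The augmentation `U(𝔤) → ℂ`, which kills `𝔤`. -/
noncomputable def enveloping.counit : UniversalEnvelopingAlgebra ℂ g →ₐ[ℂ] ℂ :=
  UniversalEnvelopingAlgebra.lift ℂ (0 : g →ₗ⁅ℂ⁆ ℂ)

/-- The trivial module `ℂ` over `U(𝔤)`. -/
noncomputable def trivialModule : ModuleCat.{0} (UniversalEnvelopingAlgebra ℂ g) :=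
  (ModuleCat.restrictScalars (enveloping.counit g).toRingHom).obj (ModuleCat.of ℂ ℂ)

/-- Lie algebra cohomology with trivial coefficients, `H^i(𝔤, ℂ) = Ext^i_{U(𝔤)}(ℂ, ℂ)`. -/
abbrev LieCohomology (i : ℕ) : Type := Ext.{0} (trivialModule g) (trivialModule g) i

variable {g h k}

/-- The map `U(𝔤) → U(𝔥)` induced by a Lie algebra homomorphism `𝔤 → 𝔥`. -/
noncomputable def enveloping.map (φ : g →ₗ⁅ℂ⁆ h) :
    UniversalEnvelopingAlgebra ℂ g →ₐ[ℂ] UniversalEnvelopingAlgebra ℂ h :=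
  UniversalEnvelopingAlgebra.lift ℂ ((UniversalEnvelopingAlgebra.ι ℂ).comp φ)

lemma enveloping.map_ι (φ : g →ₗ⁅ℂ⁆ h) (x : g) :
    enveloping.map φ (UniversalEnvelopingAlgebra.ι ℂ x) = UniversalEnvelopingAlgebra.ι ℂ (φ x) :=
  UniversalEnvelopingAlgebra.lift_ι_apply ℂ _ x

lemma enveloping.counit_ι (x : g) :
    enveloping.counit g (UniversalEnvelopingAlgebra.ι ℂ x) = 0 :=
  UniversalEnvelopingAlgebra.lift_ι_apply ℂ _ x

lemma enveloping.counit_comp_map (φ : g →ₗ⁅ℂ⁆ h) :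
    (enveloping.counit h).comp (enveloping.map φ) = enveloping.counit g := by
  apply UniversalEnvelopingAlgebra.hom_ext
  apply LieHom.ext
  intro x
  change enveloping.counit h (enveloping.map φ (UniversalEnvelopingAlgebra.ι ℂ x)) =
    enveloping.counit g (UniversalEnvelopingAlgebra.ι ℂ x)
  rw [enveloping.map_ι, enveloping.counit_ι, enveloping.counit_ι]

lemma enveloping.map_id : enveloping.map (LieHom.id : g →ₗ⁅ℂ⁆ g) = AlgHom.id ℂ _ := by
  apply UniversalEnvelopingAlgebra.hom_ext
  apply LieHom.ext
  intro x
  exact enveloping.map_ι LieHom.id x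

lemma enveloping.map_comp (ψ : h →ₗ⁅ℂ⁆ k) (φ : g →ₗ⁅ℂ⁆ h) :
    enveloping.map (ψ.comp φ) = (enveloping.map ψ).comp (enveloping.map φ) := by
  apply UniversalEnvelopingAlgebra.hom_ext
  apply LieHom.ext
  intro x
  change enveloping.map (ψ.comp φ) (UniversalEnvelopingAlgebra.ι ℂ x) =
    enveloping.map ψ (enveloping.map φ (UniversalEnvelopingAlgebra.ι ℂ x))
  rw [enveloping.map_ι, enveloping.map_ι, enveloping.map_ι, LieHom.comp_apply]

/-- Restriction of `U(𝔥)`-modules to `U(𝔤)` along a Lie algebra homomorphism `𝔤 → 𝔥`. -/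
noncomputable abbrev pullbackModule (φ : g →ₗ⁅ℂ⁆ h) :
    ModuleCat.{0} (UniversalEnvelopingAlgebra ℂ h) ⥤
      ModuleCat.{0} (UniversalEnvelopingAlgebra ℂ g) :=
  ModuleCat.restrictScalars (enveloping.map φ).toRingHom

/-- The restriction of the trivial module is the trivial module (the identity of `ℂ`). -/
noncomputable def pullbackTrivial (φ : g →ₗ⁅ℂ⁆ h) :
    trivialModule g ≅ (pullbackModule φ).obj (trivialModule h) :=
  ModuleCat.restrictScalarsComp'App _ _ _
    (congrArg AlgHom.toRingHom (enveloping.counit_comp_map φ).symm) _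

/-- The map `H^i(𝔥, ℂ) → H^i(𝔤, ℂ)` induced by a Lie algebra homomorphism `𝔤 → 𝔥`: restriction of
extensions from `U(𝔥)` to `U(𝔤)`. -/
noncomputable def LieCohomology.map (φ : g →ₗ⁅ℂ⁆ h) (i : ℕ) :
    LieCohomology h i →ₗ[ℂ] LieCohomology g i :=
  ExtFunctoriality.conjMap (pullbackModule φ) (pullbackTrivial φ) i

lemma LieCohomology.map_id (i : ℕ) (e : LieCohomology g i) :
    LieCohomology.map (LieHom.id : g →ₗ⁅ℂ⁆ g) i e = e :=
  ExtFunctoriality.conjMap_id (pullbackModule LieHom.id) _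
    (ModuleCat.restrictScalarsId' _ (congrArg AlgHom.toRingHom enveloping.map_id)).hom rfl e

lemma LieCohomology.map_comp (ψ : h →ₗ⁅ℂ⁆ k) (φ : g →ₗ⁅ℂ⁆ h) (i : ℕ) (e : LieCohomology k i) :
    LieCohomology.map (ψ.comp φ) i e = LieCohomology.map φ i (LieCohomology.map ψ i e) :=
  ExtFunctoriality.conjMap_comp (pullbackModule ψ) (pullbackModule φ) (pullbackModule (ψ.comp φ)) _ _ _
    (ModuleCat.restrictScalarsComp' _ _ _
      (congrArg AlgHom.toRingHom (enveloping.map_comp ψ φ))).hom rfl e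

end LieCohomology

section FreeLie

/-- The inclusion of `V = ℂ^m` into the free Lie algebra, `e_j ↦ x_j`. -/
noncomputable def freeLieGen (m : ℕ) : (Fin m → ℂ) →ₗ[ℂ] FreeLieAlgebra ℂ (Fin m) :=
  Fintype.linearCombination ℂ (FreeLieAlgebra.of ℂ)

/-- The Lie algebra endomorphism of the free Lie algebra on `V` extending a linear
endomorphism of `V`. -/
noncomputable def freeLieMap {m : ℕ} (f : (Fin m → ℂ) →ₗ[ℂ] (Fin m → ℂ)) :
    FreeLieAlgebra ℂ (Fin m) →ₗ⁅ℂ⁆ FreeLieAlgebra ℂ (Fin m) :=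
  FreeLieAlgebra.lift ℂ fun j => freeLieGen m (f (Pi.single j 1))

lemma freeLieMap_gen {m : ℕ} (f : (Fin m → ℂ) →ₗ[ℂ] (Fin m → ℂ)) (v : Fin m → ℂ) :
    freeLieMap f (freeLieGen m v) = freeLieGen m (f v) := by
  have : (freeLieMap f : FreeLieAlgebra ℂ (Fin m) →ₗ[ℂ] FreeLieAlgebra ℂ (Fin m)) ∘ₗ
      freeLieGen m = freeLieGen m ∘ₗ f := by
    ext j
    simp [freeLieMap, freeLieGen, Fintype.linearCombination_apply_single]
  exact LinearMap.congr_fun this v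

lemma freeLieMap_of {m : ℕ} (f : (Fin m → ℂ) →ₗ[ℂ] (Fin m → ℂ)) (j : Fin m) :
    freeLieMap f (FreeLieAlgebra.of ℂ j) = freeLieGen m (f (Pi.single j 1)) := by
  simp [freeLieMap]

lemma freeLieMap_one (m : ℕ) : freeLieMap (1 : (Fin m → ℂ) →ₗ[ℂ] (Fin m → ℂ)) = LieHom.id := by
  refine FreeLieAlgebra.hom_ext fun j => ?_
  simp [freeLieMap_of, freeLieGen, Fintype.linearCombination_apply_single]

lemma freeLieMap_mul {m : ℕ} (f f' : (Fin m → ℂ) →ₗ[ℂ] (Fin m → ℂ)) :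
    freeLieMap (f * f') = (freeLieMap f).comp (freeLieMap f') := by
  refine FreeLieAlgebra.hom_ext fun j => ?_
  rw [freeLieMap_of, LieHom.comp_apply, freeLieMap_of, freeLieMap_gen]
  rfl

/-- The Lie algebra `𝔤 = L^{⊕ n}`, where `L` is the free Lie algebra on `V = ℂ^m`. -/
abbrev FreeLieSum (m n : ℕ) : Type := DirectSum (Fin n) fun _ => FreeLieAlgebra ℂ (Fin m)

/-- The group `GL(V)` for `V = ℂ^m`. -/
abbrev GLV (m : ℕ) : Type := LinearMap.GeneralLinearGroup ℂ (Fin m → ℂ)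

/-- The action of `(A, σ) ∈ GL(V) × S_n` on `𝔤 = L^{⊕ n}` by Lie algebra endomorphisms:
`A` acts on each summand, and `σ` moves the `k`-th summand to the `σ k`-th one. -/
noncomputable def freeLieSumAct {m n : ℕ} (a : GLV m × Equiv.Perm (Fin n)) :
    FreeLieSum m n →ₗ⁅ℂ⁆ FreeLieSum m n where
  toFun x := (DirectSum.linearEquivFunOnFintype ℂ (Fin n) _).symm
    fun k => freeLieMap (a.1 : (Fin m → ℂ) →ₗ[ℂ] (Fin m → ℂ)) (x (a.2⁻¹ k))
  map_add' x y := by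
    ext k
    change freeLieMap _ ((x + y) (a.2⁻¹ k)) = freeLieMap _ (x (a.2⁻¹ k)) +
      freeLieMap _ (y (a.2⁻¹ k))
    rw [DirectSum.add_apply, map_add]
  map_smul' c x := by
    ext k
    change freeLieMap _ ((c • x) (a.2⁻¹ k)) = c • freeLieMap _ (x (a.2⁻¹ k))
    rw [DirectSum.smul_apply, map_smul]
  map_lie' {x y} := by
    ext k
    rw [DirectSum.bracket_apply]
    change freeLieMap _ (⁅x, y⁆ (a.2⁻¹ k)) = ⁅freeLieMap _ (x (a.2⁻¹ k)),
      freeLieMap _ (y (a.2⁻¹ k))⁆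
    rw [DirectSum.bracket_apply, LieHom.map_lie]

lemma freeLieSumAct_apply {m n : ℕ} (a : GLV m × Equiv.Perm (Fin n)) (x : FreeLieSum m n)
    (k : Fin n) : freeLieSumAct a x k =
      freeLieMap (a.1 : (Fin m → ℂ) →ₗ[ℂ] (Fin m → ℂ)) (x (a.2⁻¹ k)) := rfl

lemma freeLieSumAct_one (m n : ℕ) :
    freeLieSumAct (1 : GLV m × Equiv.Perm (Fin n)) = LieHom.id := by
  ext x k
  simp [freeLieSumAct_apply, freeLieMap_one]

lemma freeLieSumAct_mul {m n : ℕ} (a b : GLV m × Equiv.Perm (Fin n)) :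
    freeLieSumAct (a * b) = (freeLieSumAct a).comp (freeLieSumAct b) := by
  ext x k
  simp [freeLieSumAct_apply, freeLieMap_mul]

/-- The representation of `GL(V) × S_n` on `H^i(𝔤, ℂ)`, `𝔤 = L^{⊕ n}`: a group element acts by
functoriality through the inverse of the automorphism of `𝔤` that it defines. -/
noncomputable def cohomologyRep (m n i : ℕ) :
    Representation ℂ (GLV m × Equiv.Perm (Fin n)) (LieCohomology (FreeLieSum m n) i) where
  toFun a := LieCohomology.map (freeLieSumAct a⁻¹) i
  map_one' := by
    ext e : 1
    rw [inv_one, freeLieSumAct_one, LieCohomology.map_id]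
    rfl
  map_mul' a b := by
    ext e : 1
    rw [mul_inv_rev, freeLieSumAct_mul, LieCohomology.map_comp]
    rfl

end FreeLie

section SymmetricGroup

open scoped MonoidAlgebra

variable {d : ℕ} {lam : YoungDiagram}

open Classical in
/-- The row symmetrizer `a_T = ∑ σ` over all permutations preserving the rows of a filling `T`
of a Young diagram. -/
noncomputable def rowSymmetrizer (T : lam.cells ≃ Fin d) : ℂ[Equiv.Perm (Fin d)] :=
  ∑ σ : Equiv.Perm (Fin d) with ∀ x, (T.symm (σ x)).1.1 = (T.symm x).1.1,
    MonoidAlgebra.single σ 1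

open Classical in
/-- The column antisymmetrizer `b_T = ∑ sgn(σ) σ` over all permutations preserving the columns
of a filling `T` of a Young diagram. -/
noncomputable def colAntisymmetrizer (T : lam.cells ≃ Fin d) : ℂ[Equiv.Perm (Fin d)] :=
  ∑ σ : Equiv.Perm (Fin d) with ∀ x, (T.symm (σ x)).1.2 = (T.symm x).1.2,
    MonoidAlgebra.single σ ((Equiv.Perm.sign σ : ℤ) : ℂ)

/-- The Young symmetrizer `c_T = a_T b_T`. -/
noncomputable def youngSymmetrizer (T : lam.cells ≃ Fin d) : ℂ[Equiv.Perm (Fin d)] :=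
  rowSymmetrizer T * colAntisymmetrizer T

/-- The left ideal `ℂ[S_d] c_T`, as a subrepresentation of the left regular representation. -/
noncomputable def spechtSub (T : lam.cells ≃ Fin d) :
    Subrepresentation (Representation.leftRegular ℂ (Equiv.Perm (Fin d))) where
  toSubmodule := LinearMap.range (LinearMap.mulRight ℂ (youngSymmetrizer T))
  apply_mem_toSubmodule g := by
    have key (z : ℂ[Equiv.Perm (Fin d)]) : Representation.leftRegular ℂ (Equiv.Perm (Fin d)) g z =
        MonoidAlgebra.single g 1 * z := by
      induction z using MonoidAlgebra.induction_linear with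
      | zero => simp
      | add x y hx hy => rw [map_add, hx, hy, mul_add]
      | single x r => simp
    rintro _ ⟨y, rfl⟩
    refine ⟨MonoidAlgebra.single g 1 * y, ?_⟩
    simp [key, mul_assoc]

/-- The space of the Specht module `S^λ = ℂ[S_d] c_T`. -/
def SpechtModule (T : lam.cells ≃ Fin d) : Type := (spechtSub T).toSubmodule

noncomputable instance (T : lam.cells ≃ Fin d) : AddCommGroup (SpechtModule T) :=
  inferInstanceAs (AddCommGroup (spechtSub T).toSubmodule)

noncomputable instance (T : lam.cells ≃ Fin d) : Module ℂ (SpechtModule T) :=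
  inferInstanceAs (Module ℂ (spechtSub T).toSubmodule)

/-- The Specht module `S^λ = ℂ[S_d] c_T`, as a representation of `S_d`. -/
noncomputable def spechtRep (T : lam.cells ≃ Fin d) :
    Representation ℂ (Equiv.Perm (Fin d)) (SpechtModule T) :=
  (spechtSub T).toRepresentation

variable {G W : Type} [Group G] [AddCommGroup W] [Module ℂ W]

/-- The `d`-th tensor power of a representation. -/
noncomputable def tensorPowerRep (ρ : Representation ℂ G W) (d : ℕ) :
    Representation ℂ G (PiTensorProduct ℂ fun _ : Fin d => W) where
  toFun g := PiTensorProduct.map fun _ => ρ g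
  map_one' := by
    simp only [map_one]
    exact PiTensorProduct.map_one
  map_mul' g h := by
    simp only [map_mul]
    exact PiTensorProduct.map_mul _ _

variable (W) in
/-- The action of `S_d` on `W^{⊗ d}` by permuting the tensor factors: the factor in position `k`
is moved to position `σ k`. -/
noncomputable def tensorPermRep (d : ℕ) :
    Representation ℂ (Equiv.Perm (Fin d)) (PiTensorProduct ℂ fun _ : Fin d => W) where
  toFun σ := (PiTensorProduct.reindex ℂ (fun _ => W) σ).toLinearMap
  map_one' := by
    ext v
    simp only [LinearMap.compMultilinearMap_apply, LinearEquiv.coe_coe,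
      PiTensorProduct.reindex_tprod, Module.End.one_apply]
    rfl
  map_mul' σ τ := by
    ext v
    simp only [LinearMap.compMultilinearMap_apply, LinearEquiv.coe_coe,
      PiTensorProduct.reindex_tprod, Module.End.mul_apply]
    rfl

lemma tensorPermRep_comm (ρ : Representation ℂ G W) (d : ℕ) (g : G)
    (z : ℂ[Equiv.Perm (Fin d)]) (w : PiTensorProduct ℂ fun _ : Fin d => W) :
    tensorPowerRep ρ d g ((tensorPermRep W d).asAlgebraHom z w) =
      (tensorPermRep W d).asAlgebraHom z (tensorPowerRep ρ d g w) := by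
  induction z using MonoidAlgebra.induction_linear with
  | zero => simp
  | add x y hx hy => rw [map_add, LinearMap.add_apply, map_add, hx, hy, LinearMap.add_apply]
  | single x r =>
    rw [Representation.asAlgebraHom_single, LinearMap.smul_apply, map_smul, LinearMap.smul_apply]
    congr 1
    exact (PiTensorProduct.map_reindex (fun _ => ρ g) x w)

/-- The subrepresentation `c_T W^{⊗ d}` of `W^{⊗ d}`, for a filling `T` of a Young diagram. -/
noncomputable def schurSub (T : lam.cells ≃ Fin d) (ρ : Representation ℂ G W) :
    Subrepresentation (tensorPowerRep ρ d) where
  toSubmodule := LinearMap.range ((tensorPermRep W d).asAlgebraHom (youngSymmetrizer T))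
  apply_mem_toSubmodule g := by
    rintro _ ⟨w, rfl⟩
    exact ⟨tensorPowerRep ρ d g w, (tensorPermRep_comm ρ d g _ w).symm⟩

/-- The space of the Schur functor `𝕊^λ(W) = c_T W^{⊗ d}` applied to a representation `W`. -/
def SchurModule (T : lam.cells ≃ Fin d) (ρ : Representation ℂ G W) : Type :=
  (schurSub T ρ).toSubmodule

noncomputable instance (T : lam.cells ≃ Fin d) (ρ : Representation ℂ G W) :
    AddCommGroup (SchurModule T ρ) :=
  inferInstanceAs (AddCommGroup (schurSub T ρ).toSubmodule)

noncomputable instance (T : lam.cells ≃ Fin d) (ρ : Representation ℂ G W) :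
    Module ℂ (SchurModule T ρ) :=
  inferInstanceAs (Module ℂ (schurSub T ρ).toSubmodule)

/-- The Schur functor `𝕊^λ(W) = c_T W^{⊗ d}` applied to a representation `W` of a group `G`,
as a representation of `G`. -/
noncomputable def schurRep (T : lam.cells ≃ Fin d) (ρ : Representation ℂ G W) :
    Representation ℂ G (SchurModule T ρ) :=
  (schurSub T ρ).toRepresentation

/-- The inclusion `S_i × S_j → S_n` of the Young subgroup, for `i + j = n`: the first factor
permutes the first `i` elements, the second one the last `j` elements. -/
def youngSubgroupHom {i j n : ℕ} (h : i + j = n) :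
    Equiv.Perm (Fin i) × Equiv.Perm (Fin j) →* Equiv.Perm (Fin n) :=
  ((finSumFinEquiv.trans (finCongr h)).permCongrHom.toMonoidHom).comp
    (Equiv.Perm.sumCongrHom (Fin i) (Fin j))

/-- The external tensor product `A ⊠ 1` of a representation `A` of `G` with the trivial
one-dimensional representation of `K`, as a representation of `G × K`. -/
noncomputable def boxTrivialRep {G A : Type} [Group G] [AddCommGroup A] [Module ℂ A]
    (ρ : Representation ℂ G A) (K : Type) [Group K] :
    Representation ℂ (G × K) (TensorProduct ℂ A ℂ) :=
  Representation.tprod (ρ.comp (MonoidHom.fst G K))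
    ((Representation.trivial ℂ K ℂ).comp (MonoidHom.snd G K))

/-- The `S_n`-module `M_n^μ = Ind_{S_i × S_j}^{S_n} (S^μ ⊠ 1)`, for `μ` of size `i`, `i + j = n`. -/
noncomputable def inducedSpechtRep {i j n : ℕ} (h : i + j = n) {μ : YoungDiagram}
    (T : μ.cells ≃ Fin i) :
    Representation ℂ (Equiv.Perm (Fin n))
      (Representation.IndV (youngSubgroupHom h)
        (boxTrivialRep (spechtRep T) (Equiv.Perm (Fin j)))) :=
  Representation.ind (youngSubgroupHom h) (boxTrivialRep (spechtRep T) (Equiv.Perm (Fin j)))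

/-- The multiplicity space `Hom_G(W, H)` of a representation `W` of `G` in a representation `H`
of `G × S`, as a representation of `S`. -/
noncomputable def multiplicityRep {G S W H : Type} [Group G] [Group S]
    [AddCommMonoid W] [Module ℂ W] [AddCommMonoid H] [Module ℂ H]
    (σ : Representation ℂ G W) (ρ : Representation ℂ (G × S) H) :
    Representation ℂ S
      (Representation.IntertwiningMap σ (ρ.comp (MonoidHom.inl G S))) where
  toFun s :=
    { toFun f :=
        { toLinearMap := ρ (1, s) ∘ₗ f.toLinearMap
          isIntertwining' g := by
            have hc : ρ (1, s) ∘ₗ ρ (g, 1) = ρ (g, 1) ∘ₗ ρ (1, s) := by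
              rw [← Module.End.mul_eq_comp, ← Module.End.mul_eq_comp, ← map_mul, ← map_mul]
              simp
            rw [LinearMap.comp_assoc, f.isIntertwining', ← LinearMap.comp_assoc,
              ← LinearMap.comp_assoc]
            exact congrArg (· ∘ₗ f.toLinearMap) hc }
      map_add' _ _ := by ext; simp
      map_smul' _ _ := by ext; simp }
  map_one' := by
    ext f w
    change ρ 1 (f w) = f w
    simp
  map_mul' s t := by
    ext f w
    change ρ (1, s * t) (f w) = ρ (1, s) (ρ (1, t) (f w))
    rw [← Module.End.mul_apply, ← map_mul, Prod.mk_mul_mk, one_mul]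

/-- The standard representation of `GL(V)` on `V = ℂ^m`. -/
noncomputable def standardRep (m : ℕ) : Representation ℂ (GLV m) (Fin m → ℂ) :=
  Units.coeHom _

end SymmetricGroup

/-! Let `I` be the augmentation ideal of `U(L)`. Fox calculus shows that `I` is a free `U(L)`-module
on the generators `x_j`, so `H^0(L) = ℂ`, `H^1(L) = V^*` and all higher cohomology vanishes. For a
product `𝔤 = 𝔥 × L` this gives a Künneth splitting of `H^{d+1}(𝔤)` into `H^{d+1}(𝔥)` and `V^* ⊗
H^d(𝔥)` (`LieSplitting.exists_decomposition`, `LieSplitting.decomposition_unique`). It comes from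
the long exact sequence of `0 → I → U(L) → ℂ → 0` over `U(𝔤)`, together with Shapiro's lemma for the
middle term (`LieSplitting.exists_of_regular`). By induction on `n`, `H^i(L^{⊕ n})` is a direct sum
of copies of `(V^*)^{⊗ i}` indexed by the `i`-element sets of summands; the copy at a set consists
of products of degree one classes from its summands (`subsetClass_bijective`).

Squares of degree one classes vanish (`charClass_comp_self`), so these classes anticommute.
Permuting tensor factors is therefore, up to the sign, the same as relabelling summands
(`tensorClass_perm`), and `H^i` is induced from `S_i × S_{n-i}` acting on `(V^*)^{⊗ i}` twisted by
the sign. By Schur–Weyl duality, the equivariant maps from `𝕊^{μ'}(V^*)` to `(V^*)^{⊗ i}` form the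
left ideal generated by the Young symmetrizer of `μ'`, that is `S^{μ'}` (`exists_asAlgebraHom_eq`
and `IsPrimitiveMultiple.eq_zero_of_apply_eq_zero`). The sign turns `S^{μ'}` into `S^μ`
(`exists_spechtTwist`).

The part of Schur–Weyl duality that is needed rests on two facts: a Young symmetrizer is a nonzero
multiple of a primitive idempotent, and averages over the symmetric group of operators on `W^{⊗ d}`
lie in the span of the `g^{⊗ d}`. Applied to averages of rank one operators
(`IsPrimitiveMultiple.permConjSum_apply`), they yield both irreducibility and the description of
equivariant maps. The bound on the number of parts ensures that the Young symmetrizer does not act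
by zero. -/

/-! ### The augmentation ideal of an enveloping algebra, and classes of characters in degree one. -/

section AugmentationIdeal

open CategoryTheory CategoryTheory.Abelian

attribute [local instance 100] LieRing.ofAssociativeRing

variable {g h : Type} [LieRing g] [LieAlgebra ℂ g] [LieRing h] [LieAlgebra ℂ h]

/-- The induction principle for enveloping algebras: a property that defines a subalgebra need only
be checked on `𝔤`. By the universal property `ι` lifts to a map into `B`, and its composite with the
inclusion must be the identity. -/
lemma enveloping.subalgebra_eq_top (B : Subalgebra ℂ (UniversalEnvelopingAlgebra ℂ g))
    (hB : ∀ x, UniversalEnvelopingAlgebra.ι ℂ x ∈ B) : B = ⊤ := by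
  let f : g →ₗ⁅ℂ⁆ B :=
    { toFun x := ⟨UniversalEnvelopingAlgebra.ι ℂ x, hB x⟩
      map_add' x y := by ext; simp only [map_add, B.coe_add]
      map_smul' c x := by ext; simp only [map_smul, B.coe_smul, RingHom.id_apply]
      map_lie' {x y} := by
        ext
        simp only [LieHom.map_lie, LieRing.of_associative_ring_bracket, B.coe_sub, B.coe_mul] }
  have key : B.val.comp (UniversalEnvelopingAlgebra.lift ℂ f) = AlgHom.id ℂ _ := by
    apply UniversalEnvelopingAlgebra.hom_ext
    apply LieHom.ext
    intro x
    change B.val (UniversalEnvelopingAlgebra.lift ℂ f (UniversalEnvelopingAlgebra.ι ℂ x)) = _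
    rw [UniversalEnvelopingAlgebra.lift_ι_apply]
    rfl
  refine eq_top_iff.2 fun u _ => ?_
  have := AlgHom.congr_fun key u
  rw [AlgHom.id_apply] at this
  rw [← this]
  exact (UniversalEnvelopingAlgebra.lift ℂ f u).2

lemma enveloping.subalgebra_eq_top_of_free {X : Type}
    (B : Subalgebra ℂ (UniversalEnvelopingAlgebra ℂ (FreeLieAlgebra ℂ X)))
    (hB : ∀ j, UniversalEnvelopingAlgebra.ι ℂ (FreeLieAlgebra.of ℂ j) ∈ B) : B = ⊤ := by
  refine enveloping.subalgebra_eq_top B fun x => ?_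
  let f : FreeLieAlgebra ℂ X →ₗ⁅ℂ⁆ B := FreeLieAlgebra.lift ℂ fun j => ⟨_, hB j⟩
  have key : (B.val : B →ₗ⁅ℂ⁆ _).comp f = UniversalEnvelopingAlgebra.ι ℂ := by
    ext j
    change B.val (f (FreeLieAlgebra.of ℂ j)) = _
    simp only [f, FreeLieAlgebra.lift_of_apply]
    rfl
  rw [← key]
  exact (f x).2

variable (g) in
/-- The augmentation ideal of `U(𝔤)`. -/
noncomputable def augIdeal : Ideal (UniversalEnvelopingAlgebra ℂ g) :=
  RingHom.ker (enveloping.counit g)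

lemma mem_augIdeal {u : UniversalEnvelopingAlgebra ℂ g} :
    u ∈ augIdeal g ↔ enveloping.counit g u = 0 := Iff.rfl

/-- The elements `u` with `u - ε(u)` in the left ideal form a subalgebra, because `ab - ε(ab) = a (b
- ε(b)) + ε(b) (a - ε(a))`. Being a left ideal suffices since the scalar `ε(b)` is central. -/
lemma augIdeal_le_span {X : Set g}
    (hX : ∀ B : Subalgebra ℂ (UniversalEnvelopingAlgebra ℂ g),
      (∀ x ∈ X, UniversalEnvelopingAlgebra.ι ℂ x ∈ B) → B = ⊤) :
    augIdeal g ≤ Ideal.span (UniversalEnvelopingAlgebra.ι ℂ '' X) := by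
  set J := Ideal.span (UniversalEnvelopingAlgebra.ι ℂ '' X) with hJ
  let B : Subalgebra ℂ (UniversalEnvelopingAlgebra ℂ g) :=
    { carrier := {u | u - algebraMap ℂ _ (enveloping.counit g u) ∈ J}
      mul_mem' := by
        intro a b ha hb
        have : a * b - algebraMap ℂ _ (enveloping.counit g (a * b)) =
            a * (b - algebraMap ℂ _ (enveloping.counit g b)) +
            algebraMap ℂ _ (enveloping.counit g b) *
              (a - algebraMap ℂ _ (enveloping.counit g a)) := by
          rw [map_mul (enveloping.counit g), mul_comm (enveloping.counit g a), map_mul, mul_sub,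
            mul_sub, Algebra.commutes (enveloping.counit g b) a]
          abel
        change _ ∈ J
        rw [this]
        exact J.add_mem (J.mul_mem_left _ hb) (J.mul_mem_left _ ha)
      add_mem' := by
        intro a b ha hb
        have : a + b - algebraMap ℂ _ (enveloping.counit g (a + b)) =
            (a - algebraMap ℂ _ (enveloping.counit g a)) +
              (b - algebraMap ℂ _ (enveloping.counit g b)) := by
          rw [map_add, map_add]; abel
        change _ ∈ J
        rw [this]
        exact J.add_mem ha hb
      algebraMap_mem' := by
        intro r
        change _ ∈ J
        rw [AlgHom.commutes]
        simp }
  have hB : B = ⊤ := hX B fun x hx => by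
    change _ ∈ J
    rw [enveloping.counit_ι, map_zero, sub_zero]
    exact Ideal.subset_span ⟨x, hx, rfl⟩
  intro u hu
  have : u ∈ B := hB ▸ Algebra.mem_top
  have h2 : u - algebraMap ℂ _ (enveloping.counit g u) ∈ J := this
  rwa [mem_augIdeal.1 hu, map_zero, sub_zero] at h2

lemma ι_mem_augIdeal (x : g) : UniversalEnvelopingAlgebra.ι ℂ x ∈ augIdeal g :=
  enveloping.counit_ι x

/-- `ι x` as an element of the augmentation ideal. -/
noncomputable def augι (x : g) : augIdeal g := ⟨_, ι_mem_augIdeal x⟩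

lemma augIdeal_span_eq_top {X : Set g}
    (hX : ∀ B : Subalgebra ℂ (UniversalEnvelopingAlgebra ℂ g),
      (∀ x ∈ X, UniversalEnvelopingAlgebra.ι ℂ x ∈ B) → B = ⊤) :
    Submodule.span (UniversalEnvelopingAlgebra ℂ g) (augι '' X) = ⊤ := by
  have hinj := Submodule.map_injective_of_injective (augIdeal g).subtype_injective
  apply hinj
  rw [Submodule.map_span, ← Set.image_comp, Submodule.map_top, Submodule.range_subtype]
  refine le_antisymm ?_ (augIdeal_le_span hX)
  rw [Submodule.span_le]
  rintro _ ⟨x, -, rfl⟩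
  exact ι_mem_augIdeal x

lemma augIdeal_hom_ext {M : Type} [AddCommGroup M] [Module (UniversalEnvelopingAlgebra ℂ g) M]
    {f f' : augIdeal g →ₗ[UniversalEnvelopingAlgebra ℂ g] M}
    (hf : ∀ x : g, f (augι x) = f' (augι x)) : f = f' := by
  refine LinearMap.ext_on (augIdeal_span_eq_top (X := Set.univ) fun B hB =>
    enveloping.subalgebra_eq_top B fun x => hB x trivial) ?_
  rintro _ ⟨x, -, rfl⟩
  exact hf x

variable (g) in
/-- The augmentation ideal as a `U(𝔤)`-module. -/
noncomputable abbrev augModule : ModuleCat.{0} (UniversalEnvelopingAlgebra ℂ g) :=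
  ModuleCat.of _ (augIdeal g)

variable (g) in
/-- The regular `U(𝔤)`-module. -/
noncomputable abbrev regularModule : ModuleCat.{0} (UniversalEnvelopingAlgebra ℂ g) :=
  ModuleCat.of _ (UniversalEnvelopingAlgebra ℂ g)

variable (g) in
/-- The inclusion `I → U(𝔤)`. -/
noncomputable def augIncl : augModule g ⟶ regularModule g :=
  ModuleCat.ofHom (augIdeal g).subtype

variable (g) in
/-- The augmentation `U(𝔤) → ℂ` as a morphism of `U(𝔤)`-modules. -/
noncomputable def augProj : regularModule g ⟶ trivialModule g :=
  ModuleCat.ofHom (Y := trivialModule g)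
    { toFun u := enveloping.counit g u
      map_add' u v := map_add (enveloping.counit g) u v
      map_smul' u v := by exact map_mul (enveloping.counit g) u v }

variable (g) in
lemma augIncl_augProj : augIncl g ≫ augProj g = 0 := by
  apply ModuleCat.hom_ext
  ext u
  exact u.2

variable (g) in
/-- The short complex `0 → I → U(𝔤) → ℂ → 0`. -/
noncomputable abbrev augSeq : ShortComplex (ModuleCat.{0} (UniversalEnvelopingAlgebra ℂ g)) :=
  ShortComplex.mk (augIncl g) (augProj g) (augIncl_augProj g)

lemma augSeq_shortExact (g : Type) [LieRing g] [LieAlgebra ℂ g] : (augSeq g).ShortExact where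
  exact := by
    rw [ShortComplex.ShortExact.moduleCat_exact_iff_function_exact]
    intro (u : UniversalEnvelopingAlgebra ℂ g)
    constructor
    · intro hu
      exact ⟨(⟨u, hu⟩ : augIdeal g), rfl⟩
    · rintro ⟨v, rfl⟩
      exact Subtype.property (p := fun u => u ∈ augIdeal g) v
  mono_f := by
    rw [ModuleCat.mono_iff_injective]
    exact (augIdeal g).subtype_injective
  epi_g := by
    rw [ModuleCat.epi_iff_surjective]
    intro (c : ℂ)
    exact ⟨algebraMap ℂ (UniversalEnvelopingAlgebra ℂ g) c, (enveloping.counit g).commutes c⟩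

/-- The algebra homomorphism `U(𝔤) → ℂ[ε]` with `x ↦ φ(x) ε`. -/
noncomputable def charDual (φ : g →ₗ⁅ℂ⁆ ℂ) : UniversalEnvelopingAlgebra ℂ g →ₐ[ℂ] DualNumber ℂ :=
  UniversalEnvelopingAlgebra.lift ℂ
    { toLinearMap := TrivSqZeroExt.inrHom ℂ ℂ ∘ₗ (φ : g →ₗ[ℂ] ℂ)
      map_lie' {x y} := by
        simp [LieRing.of_associative_ring_bracket, mul_comm] }

lemma charDual_ι (φ : g →ₗ⁅ℂ⁆ ℂ) (x : g) :
    charDual φ (UniversalEnvelopingAlgebra.ι ℂ x) = TrivSqZeroExt.inr (φ x) :=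
  UniversalEnvelopingAlgebra.lift_ι_apply ℂ _ x

lemma charDual_fst (φ : g →ₗ⁅ℂ⁆ ℂ) (u : UniversalEnvelopingAlgebra ℂ g) :
    (charDual φ u).fst = enveloping.counit g u := by
  have : (TrivSqZeroExt.fstHom ℂ ℂ ℂ).comp (charDual φ) = enveloping.counit g := by
    apply UniversalEnvelopingAlgebra.hom_ext
    apply LieHom.ext
    intro x
    change (charDual φ (UniversalEnvelopingAlgebra.ι ℂ x)).fst =
      enveloping.counit g (UniversalEnvelopingAlgebra.ι ℂ x)
    rw [charDual_ι, enveloping.counit_ι, TrivSqZeroExt.fst_inr]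
  exact AlgHom.congr_fun this u

/-- The `U(𝔤)`-linear map `I → ℂ` with `x ↦ φ(x)`, for a character `φ` of `𝔤`. -/
noncomputable def charLinear (φ : g →ₗ⁅ℂ⁆ ℂ) :
    augIdeal g →ₗ[UniversalEnvelopingAlgebra ℂ g] trivialModule g where
  toFun u := (charDual φ u).snd
  map_add' u v := by
    change (charDual φ (u + v)).snd = ((charDual φ u).snd + (charDual φ v).snd : ℂ)
    rw [map_add, TrivSqZeroExt.snd_add]
  map_smul' u v := by
    change (charDual φ (u * v)).snd = (enveloping.counit g u * (charDual φ v).snd : ℂ)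
    -- The `ε`-coefficient is a derivation over the augmentation; its second term carries the
    -- augmentation of `v` and vanishes for `v` in the augmentation ideal.
    rw [map_mul, TrivSqZeroExt.snd_mul, charDual_fst, charDual_fst, mem_augIdeal.1 v.2]
    simp

lemma charLinear_augι (φ : g →ₗ⁅ℂ⁆ ℂ) (x : g) : charLinear φ (augι x) = φ x := by
  change (charDual φ (UniversalEnvelopingAlgebra.ι ℂ x)).snd = φ x
  rw [charDual_ι, TrivSqZeroExt.snd_inr]

/-- The map `charLinear φ` as a morphism of `U(𝔤)`-modules. -/
noncomputable def charHom (φ : g →ₗ⁅ℂ⁆ ℂ) : augModule g ⟶ trivialModule g :=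
  ModuleCat.ofHom (Y := trivialModule g) (charLinear φ)

lemma augModule_hom_ext {M : ModuleCat.{0} (UniversalEnvelopingAlgebra ℂ g)}
    {f f' : augModule g ⟶ M} (hf : ∀ x : g, f.hom (augι x) = f'.hom (augι x)) : f = f' :=
  ModuleCat.hom_ext (augIdeal_hom_ext hf)

lemma charHom_augι (φ : g →ₗ⁅ℂ⁆ ℂ) (x : g) : (charHom φ).hom (augι x) = φ x :=
  charLinear_augι φ x

/-- The class in `H^1(𝔤, ℂ)` of a character `φ` of `𝔤`. -/
noncomputable def charClass (φ : g →ₗ⁅ℂ⁆ ℂ) : LieCohomology g 1 :=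
  (augSeq_shortExact g).extClass.comp (Ext.mk₀ (charHom φ)) (add_zero 1)

lemma charClass_add {φ ψ χ : g →ₗ⁅ℂ⁆ ℂ} (hχ : ∀ x, χ x = φ x + ψ x) :
    charClass χ = charClass φ + charClass ψ := by
  have : charHom χ = charHom φ + charHom ψ := by
    refine augModule_hom_ext fun x => ?_
    rw [ModuleCat.hom_add, LinearMap.add_apply, charHom_augι, charHom_augι, charHom_augι, hχ]
    rfl
  rw [charClass, this, Ext.mk₀_add, Ext.comp_add]
  rfl

lemma charClass_smul {φ χ : g →ₗ⁅ℂ⁆ ℂ} {c : ℂ} (hχ : ∀ x, χ x = c * φ x) :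
    charClass χ = c • charClass φ := by
  have : charHom χ = c • charHom φ := by
    refine augModule_hom_ext fun x => ?_
    change (charHom χ).hom (augι x) = algebraMap ℂ (UniversalEnvelopingAlgebra ℂ g) c •
      (charHom φ).hom (augι x)
    rw [charHom_augι, charHom_augι, hχ]
    exact congrArg (· * φ x) ((enveloping.counit g).commutes c).symm
  rw [charClass, this, Ext.mk₀_smul, Ext.comp_smul]
  rfl

lemma charClass_zero {φ : g →ₗ⁅ℂ⁆ ℂ} (hφ : ∀ x, φ x = 0) : charClass φ = 0 := by
  rw [charClass_smul (φ := φ) (c := 0) (by simp [hφ]), zero_smul]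

/-- Restriction is multiplicative for the Yoneda product, as the two comparison isomorphisms of
trivial modules in the middle cancel. -/
lemma LieCohomology.map_comp_ext (ψ : g →ₗ⁅ℂ⁆ h) {a b c : ℕ} (e : LieCohomology h a)
    (e' : LieCohomology h b) (hc : a + b = c) :
    LieCohomology.map ψ c (e.comp e' hc) =
      (LieCohomology.map ψ a e).comp (LieCohomology.map ψ b e') hc := by
  simp only [LieCohomology.map, ExtFunctoriality.conjMap_apply, Ext.mapExactFunctor_comp]
  subst hc
  simp only [Ext.comp_assoc_of_third_deg_zero]
  rw [Ext.comp_assoc _ _ _ (zero_add a) rfl (by lia)]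
  congr 1
  rw [Ext.comp_assoc_of_second_deg_zero, Ext.mk₀_comp_mk₀_assoc, Iso.inv_hom_id,
    Ext.mk₀_id_comp]

lemma LieCohomology.map_mk₀_id (ψ : g →ₗ⁅ℂ⁆ h) :
    LieCohomology.map ψ 0 (Ext.mk₀ (𝟙 (trivialModule h))) = Ext.mk₀ (𝟙 (trivialModule g)) := by
  rw [LieCohomology.map, ExtFunctoriality.conjMap_apply, Ext.mapExactFunctor_mk₀,
    Ext.mk₀_comp_mk₀, Ext.mk₀_comp_mk₀, CategoryTheory.Functor.map_id, Category.id_comp,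
    Iso.hom_inv_id]

lemma enveloping.map_mem_augIdeal (ψ : g →ₗ⁅ℂ⁆ h) {u : UniversalEnvelopingAlgebra ℂ g}
    (hu : u ∈ augIdeal g) : enveloping.map ψ u ∈ augIdeal h := by
  rw [mem_augIdeal] at *
  rw [← hu, ← enveloping.counit_comp_map ψ]
  rfl

/-- The map `U(𝔤) → U(𝔥)` as a morphism of `U(𝔤)`-modules. -/
noncomputable def regularMap (ψ : g →ₗ⁅ℂ⁆ h) :
    regularModule g ⟶ (pullbackModule ψ).obj (regularModule h) :=
  ModuleCat.ofHom (Y := (pullbackModule ψ).obj (regularModule h))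
    { toFun u := enveloping.map ψ u
      map_add' u v := map_add (enveloping.map ψ) u v
      map_smul' u v := by exact map_mul (enveloping.map ψ) u v }

/-- The map of augmentation ideals induced by a Lie algebra homomorphism. -/
noncomputable def augMap (ψ : g →ₗ⁅ℂ⁆ h) :
    augModule g ⟶ (pullbackModule ψ).obj (augModule h) :=
  ModuleCat.ofHom (Y := (pullbackModule ψ).obj (augModule h))
    { toFun u := (⟨enveloping.map ψ u, enveloping.map_mem_augIdeal ψ u.2⟩ : augIdeal h)
      map_add' u v := Subtype.ext (map_add (enveloping.map ψ) u.1 v.1)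
      map_smul' u v := by exact Subtype.ext (map_mul (enveloping.map ψ) u v.1) }

/-- The morphism of augmentation sequences induced by a Lie algebra homomorphism. -/
noncomputable def augSeqMap (ψ : g →ₗ⁅ℂ⁆ h) : augSeq g ⟶ (augSeq h).map (pullbackModule ψ) where
  τ₁ := augMap ψ
  τ₂ := regularMap ψ
  τ₃ := (pullbackTrivial ψ).hom
  comm₁₂ := rfl
  comm₂₃ := by
    apply ModuleCat.hom_ext
    refine LinearMap.ext fun u => ?_
    exact AlgHom.congr_fun (enveloping.counit_comp_map ψ) u

/-- The augmentation sequence is functorial in the Lie algebra, so its extension class is natural;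
only the pushouts along the characters remain to be compared. -/
lemma map_charClass (ψ : g →ₗ⁅ℂ⁆ h) (φ : h →ₗ⁅ℂ⁆ ℂ) :
    LieCohomology.map ψ 1 (charClass φ) = charClass (φ.comp ψ) := by
  have nat := ShortComplex.ShortExact.extClass_naturality (augSeq_shortExact g)
    ((augSeq_shortExact h).map_of_exact (pullbackModule ψ)) (augSeqMap ψ)
  have key : augMap ψ ≫ (pullbackModule ψ).map (charHom φ) ≫ (pullbackTrivial ψ).inv =
      charHom (φ.comp ψ) := by
    refine augModule_hom_ext fun x => ?_
    rw [charHom_augι]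
    change charLinear φ ⟨enveloping.map ψ (UniversalEnvelopingAlgebra.ι ℂ x), _⟩ = _
    simp only [enveloping.map_ι]
    exact charLinear_augι φ (ψ x)
  let E : Ext ((pullbackModule ψ).obj (trivialModule h)) ((pullbackModule ψ).obj (augModule h)) 1 :=
    ((augSeq_shortExact h).map_of_exact (pullbackModule ψ)).extClass
  have hE : (augSeq_shortExact h).extClass.mapExactFunctor (pullbackModule ψ) = E :=
    Ext.mapExactFunctor_extClass (pullbackModule ψ) (augSeq_shortExact h)
  have nat' : (augSeq_shortExact g).extClass.comp (Ext.mk₀ (augMap ψ)) (add_zero 1) =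
    (Ext.mk₀ (pullbackTrivial ψ).hom).comp E (zero_add 1) := nat
  rw [LieCohomology.map, ExtFunctoriality.conjMap_apply, charClass, Ext.mapExactFunctor_comp,
    Ext.mapExactFunctor_mk₀, hE, Ext.comp_assoc_of_third_deg_zero, Ext.mk₀_comp_mk₀,
    ← Ext.comp_assoc _ _ _ (zero_add 1) (add_zero 1) (by lia), ← nat',
    Ext.comp_assoc_of_third_deg_zero, Ext.mk₀_comp_mk₀, key]
  rfl

end AugmentationIdeal

/-! ### Fox calculus: the augmentation ideal of a free Lie algebra is free. -/

section FreeAugmentation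

open CategoryTheory CategoryTheory.Abelian

attribute [local instance 100] LieRing.ofAssociativeRing

variable {m : ℕ}

/-- The enveloping algebra of the free Lie algebra on `m` generators. -/
local notation "UL" => UniversalEnvelopingAlgebra ℂ (FreeLieAlgebra ℂ (Fin m))

/-- The generator `x_j` of the enveloping algebra of the free Lie algebra. -/
noncomputable def freeGen (j : Fin m) : UL :=
  UniversalEnvelopingAlgebra.ι ℂ (FreeLieAlgebra.of ℂ j)

/-- The operator by which `x_j` acts on `U(L)^m × ℂ`, an extension of `ℂ` by a free module. -/
noncomputable def foxOp (j : Fin m) : Module.End ℂ ((Fin m → UL) × ℂ) where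
  toFun w := (fun k => freeGen j * w.1 k + if k = j then algebraMap ℂ _ w.2 else 0, 0)
  map_add' v w := by
    ext k
    · by_cases hk : k = j
      · simp [hk, mul_add]; abel
      · simp [hk, mul_add]
    · simp
  map_smul' c w := by
    ext k
    · by_cases hk : k = j <;> simp [hk, Algebra.smul_def, mul_add, Algebra.left_comm]
    · simp

/-- The action of `U(L)` on `U(L)^m × ℂ` in which `x_j (0, 1) = (e_j, 0)`. -/
noncomputable def foxAct : UL →ₐ[ℂ] Module.End ℂ ((Fin m → UL) × ℂ) :=
  UniversalEnvelopingAlgebra.lift ℂ (FreeLieAlgebra.lift ℂ foxOp)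

lemma foxAct_gen (j : Fin m) : foxAct (freeGen j) = foxOp j := by
  rw [foxAct, freeGen, UniversalEnvelopingAlgebra.lift_ι_apply, FreeLieAlgebra.lift_of_apply]

/-- With `foxAct_snd` this says that the Fox module has a free submodule with trivial quotient.
Hence the first component `D(u)` of `foxAct u (0, 1)` satisfies `D(uv) = u D(v) + ε(v) D(u)`: its
entries are the Fox derivatives. -/
lemma foxAct_free (u : UL) (w : Fin m → UL) : foxAct u (w, 0) = (fun k => u * w k, 0) := by
  let B : Subalgebra ℂ UL :=
    { carrier := {u | ∀ w : Fin m → UL, foxAct u (w, 0) = (fun k => u * w k, 0)}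
      mul_mem' := by
        intro a b ha hb w
        rw [map_mul, Module.End.mul_apply, hb, ha]
        simp [mul_assoc]
      add_mem' := by
        intro a b ha hb w
        rw [map_add, LinearMap.add_apply, ha, hb]
        ext k <;> simp [add_mul]
      algebraMap_mem' := by
        intro r w
        rw [AlgHom.commutes, Module.algebraMap_end_apply]
        ext k <;> simp [Algebra.smul_def] }
  have hB : B = ⊤ := enveloping.subalgebra_eq_top_of_free B fun j w => by
    change foxAct (freeGen j) (w, 0) = _
    rw [foxAct_gen]
    ext k <;> simp [foxOp, freeGen]
  have : u ∈ B := hB ▸ Algebra.mem_top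
  exact this w

lemma foxAct_snd (u : UL) (w : (Fin m → UL) × ℂ) :
    (foxAct u w).2 = enveloping.counit _ u * w.2 := by
  let B : Subalgebra ℂ UL :=
    { carrier := {u | ∀ w : (Fin m → UL) × ℂ, (foxAct u w).2 = enveloping.counit _ u * w.2}
      mul_mem' := by
        intro a b ha hb w
        rw [map_mul, Module.End.mul_apply, ha, hb, map_mul, mul_assoc]
      add_mem' := by
        intro a b ha hb w
        rw [map_add, LinearMap.add_apply, Prod.snd_add, ha, hb, map_add, add_mul]
      algebraMap_mem' := by
        intro r w
        rw [AlgHom.commutes, AlgHom.commutes, Module.algebraMap_end_apply]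
        rfl }
  have hB : B = ⊤ := enveloping.subalgebra_eq_top_of_free B fun j w => by
    change (foxAct (freeGen j) w).2 = enveloping.counit _ (freeGen j) * w.2
    rw [foxAct_gen, freeGen, enveloping.counit_ι, zero_mul]
    rfl
  have : u ∈ B := hB ▸ Algebra.mem_top
  exact this w

/-- The `j`-th coordinate of an element of the augmentation ideal `I = ⨁ U(L) x_j`. -/
noncomputable def freeCoord (j : Fin m) :
    augModule (FreeLieAlgebra ℂ (Fin m)) ⟶ regularModule (FreeLieAlgebra ℂ (Fin m)) :=
  ModuleCat.ofHom
    { toFun u := (foxAct u.1 (0, 1)).1 j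
      map_add' u v := by
        change (foxAct (u.1 + v.1) (0, 1)).1 j = _
        rw [map_add, LinearMap.add_apply, Prod.fst_add, Pi.add_apply]
      map_smul' u v := by
        change (foxAct (u * v.1) (0, 1)).1 j = u * (foxAct v.1 (0, 1)).1 j
        -- For `v` in the augmentation ideal the term `ε(v) D(u)` disappears, which makes the Fox
        -- derivatives linear over `U(L)`.
        have hv : foxAct v.1 (0, 1) = ((foxAct v.1 (0, 1)).1, 0) := by
          refine Prod.ext rfl ?_
          rw [foxAct_snd, mem_augIdeal.1 v.2, zero_mul]
        rw [map_mul, Module.End.mul_apply, hv, foxAct_free] }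

/-- The inclusion `u ↦ u x_j` of `U(L)` into the augmentation ideal. -/
noncomputable def freeIncl (j : Fin m) :
    regularModule (FreeLieAlgebra ℂ (Fin m)) ⟶ augModule (FreeLieAlgebra ℂ (Fin m)) :=
  ModuleCat.ofHom (LinearMap.toSpanSingleton _ _ (augι (FreeLieAlgebra.of ℂ j)))

lemma freeCoord_gen (j k : Fin m) :
    (freeCoord j).hom (augι (FreeLieAlgebra.of ℂ k)) = if j = k then (1 : UL) else 0 := by
  change (foxAct (freeGen k) (0, 1)).1 j = _
  rw [foxAct_gen]
  simp [foxOp]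

lemma freeIncl_freeCoord (j k : Fin m) :
    freeIncl k ≫ freeCoord j = if j = k then 𝟙 _ else 0 := by
  apply ModuleCat.hom_ext
  apply LinearMap.ext_ring
  change (freeCoord j).hom ((1 : UL) • augι (FreeLieAlgebra.of ℂ k)) = _
  rw [one_smul, freeCoord_gen]
  split_ifs <;> rfl

lemma augModule_free_hom_ext {M : ModuleCat.{0} UL}
    {f f' : augModule (FreeLieAlgebra ℂ (Fin m)) ⟶ M}
    (hf : ∀ j, f.hom (augι (FreeLieAlgebra.of ℂ j)) = f'.hom (augι (FreeLieAlgebra.of ℂ j))) :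
    f = f' := by
  apply ModuleCat.hom_ext
  refine LinearMap.ext_on (augIdeal_span_eq_top (X := Set.range (FreeLieAlgebra.of ℂ))
    fun B hB => enveloping.subalgebra_eq_top_of_free B fun j => hB _ ⟨j, rfl⟩) ?_
  rintro _ ⟨_, ⟨j, rfl⟩, rfl⟩
  exact hf j

/-- Together with `freeIncl_freeCoord`, this exhibits the augmentation ideal as the direct sum of
`m` copies of the regular module. It suffices to evaluate on the `x_k`, which generate the ideal. -/
lemma sum_freeCoord_freeIncl :
    ∑ j : Fin m, freeCoord j ≫ freeIncl j = 𝟙 (augModule (FreeLieAlgebra ℂ (Fin m))) := by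
  refine augModule_free_hom_ext fun k => ?_
  rw [ModuleCat.hom_sum, LinearMap.sum_apply]
  change ∑ j, ((freeCoord j).hom (augι (FreeLieAlgebra.of ℂ k)) : UL) •
    augι (FreeLieAlgebra.of ℂ j) = augι (FreeLieAlgebra.of ℂ k)
  refine (Finset.sum_congr rfl fun j _ =>
    congrArg (fun u : UL => u • augι (FreeLieAlgebra.of ℂ j)) (freeCoord_gen j k)).trans ?_
  simp

/-- The character of the free Lie algebra dual to the generator `x_j`. -/
noncomputable def dualChar (j : Fin m) : FreeLieAlgebra ℂ (Fin m) →ₗ⁅ℂ⁆ ℂ :=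
  FreeLieAlgebra.lift ℂ (Pi.single j 1)

lemma charHom_dualChar (j : Fin m) : charHom (dualChar j) = freeCoord j ≫ augProj _ := by
  refine augModule_free_hom_ext fun k => ?_
  rw [charHom_augι, dualChar, FreeLieAlgebra.lift_of_apply]
  change _ = enveloping.counit _ ((freeCoord j).hom (augι (FreeLieAlgebra.of ℂ k)))
  rw [freeCoord_gen]
  split_ifs with h
  · subst h; simp
  · simp [Pi.single_eq_of_ne (Ne.symm h)]

instance regularModule_projective (g : Type) [LieRing g] [LieAlgebra ℂ g] :
    Projective (regularModule g) :=
  (IsProjective.iff_projective _).1 (inferInstance :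
    Module.Projective (UniversalEnvelopingAlgebra ℂ g) (UniversalEnvelopingAlgebra ℂ g))

/-- Dimension shifting: such a class comes from an `Ext` group of positive degree out of the
augmentation ideal, whose identity factors through projective modules. -/
lemma cohomology_free_eq_zero {i : ℕ} (e : LieCohomology (FreeLieAlgebra ℂ (Fin m)) (i + 2)) :
    e = 0 := by
  have h0 (k : ℕ) : Subsingleton (Ext (regularModule (FreeLieAlgebra ℂ (Fin m)))
      (trivialModule (FreeLieAlgebra ℂ (Fin m))) (k + 1)) := Ext.subsingleton_of_projective _ _ _
  obtain ⟨e', rfl⟩ := Ext.contravariant_sequence_exact₃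
    (augSeq_shortExact (FreeLieAlgebra ℂ (Fin m))) _ e
    ((h0 (i + 1)).elim _ _) (n₀ := i + 1) (by lia)
  have : e' = 0 := by
    rw [← Ext.mk₀_id_comp e', ← sum_freeCoord_freeIncl, Ext.mk₀_sum, Ext.sum_comp]
    refine Finset.sum_eq_zero fun j _ => ?_
    rw [← Ext.mk₀_comp_mk₀_assoc, (h0 i).elim ((Ext.mk₀ (freeIncl j)).comp e' _) 0, Ext.comp_zero]
  rw [this, Ext.comp_zero]

/-- The square of the class of a character vanishes. -/
lemma charClass_comp_self {g : Type} [LieRing g] [LieAlgebra ℂ g] (φ : g →ₗ⁅ℂ⁆ ℂ) :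
    (charClass φ).comp (charClass φ) rfl = 0 := by
  -- A character factors through the one-dimensional Lie algebra, which maps to the free Lie algebra
  -- on one generator. The square is thus pulled back from a second cohomology group that vanishes.
  let s : ℂ →ₗ⁅ℂ⁆ FreeLieAlgebra ℂ (Fin 1) :=
    { toLinearMap := LinearMap.toSpanSingleton ℂ _ (FreeLieAlgebra.of ℂ 0)
      map_lie' {x y} := by
        simp [LieRing.of_associative_ring_bracket, mul_comm] }
  have h : φ = (dualChar (0 : Fin 1)).comp (s.comp φ) := by
    ext x
    change φ x = dualChar 0 (φ x • FreeLieAlgebra.of ℂ 0)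
    rw [map_smul, dualChar, FreeLieAlgebra.lift_of_apply]
    simp
  rw [h, ← map_charClass, ← LieCohomology.map_comp_ext,
    cohomology_free_eq_zero (i := 0) (Ext.comp _ _ _), map_zero]

end FreeAugmentation

/-! ### Shapiro's lemma for a product of two Lie algebras. -/

section TwistedInduction

open CategoryTheory CategoryTheory.Abelian CategoryTheory.Limits
open scoped TensorProduct

attribute [local instance 100] LieRing.ofAssociativeRing

attribute [local instance] ModuleCat.moduleOfAlgebraModule ModuleCat.isScalarTower_of_algebra_moduleCat

variable {g h l : Type} [LieRing g] [LieAlgebra ℂ g] [LieRing h] [LieAlgebra ℂ h]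
  [LieRing l] [LieAlgebra ℂ l]

/-- A decomposition of a Lie algebra `𝔤` as a product `𝔥 × 𝔩`. -/
structure LieSplitting (g h l : Type) [LieRing g] [LieAlgebra ℂ g] [LieRing h] [LieAlgebra ℂ h]
    [LieRing l] [LieAlgebra ℂ l] where
  fst : g →ₗ⁅ℂ⁆ h
  snd : g →ₗ⁅ℂ⁆ l
  inl : h →ₗ⁅ℂ⁆ g
  inr : l →ₗ⁅ℂ⁆ g
  fst_inl : ∀ y, fst (inl y) = y
  snd_inl : ∀ y, snd (inl y) = 0
  fst_inr : ∀ z, fst (inr z) = 0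
  snd_inr : ∀ z, snd (inr z) = z
  decomp : ∀ x, inl (fst x) + inr (snd x) = x
  comm : ∀ y z, ⁅inl y, inr z⁆ = 0

namespace LieSplitting

variable (S : LieSplitting g h l)

local notation "U" => UniversalEnvelopingAlgebra ℂ

/-- The action of `𝔤` on `U(𝔩) ⊗ M` for a `U(𝔥)`-module `M`. -/
noncomputable def indLie (M : ModuleCat.{0} (U h)) : g →ₗ⁅ℂ⁆ Module.End ℂ (U l ⊗[ℂ] M) where
  toFun x := LinearMap.rTensor M (LinearMap.mulLeft ℂ (UniversalEnvelopingAlgebra.ι ℂ (S.snd x))) +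
    LinearMap.lTensor (U l) (Algebra.lsmul ℂ ℂ M (UniversalEnvelopingAlgebra.ι ℂ (S.fst x)))
  map_add' x y := by
    ext u n
    simp [add_mul, TensorProduct.add_tmul]
    abel
  map_smul' c x := by
    ext u n
    simp [TensorProduct.smul_tmul']
  map_lie' {x y} := by
    ext u n
    simp only [LieHom.map_lie, LieRing.of_associative_ring_bracket, TensorProduct.AlgebraTensorModule.curry_apply,
      TensorProduct.curry_apply, LinearMap.coe_restrictScalars, LinearMap.add_apply,
      LinearMap.rTensor_tmul, LinearMap.lTensor_tmul, LinearMap.mulLeft_apply,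
      Algebra.lsmul_coe, LinearMap.sub_apply, Module.End.mul_apply, map_add, sub_mul, sub_smul,
      TensorProduct.sub_tmul, TensorProduct.tmul_sub, mul_smul, mul_assoc]
    abel

/-- The algebra homomorphism giving the action of `U(𝔤)` on `U(𝔩) ⊗ M`. -/
noncomputable def indAct (M : ModuleCat.{0} (U h)) : U g →ₐ[ℂ] Module.End ℂ (U l ⊗[ℂ] M) :=
  UniversalEnvelopingAlgebra.lift ℂ (S.indLie M)

lemma indAct_ι (M : ModuleCat.{0} (U h)) (x : g) (u : U l) (n : M) :
    S.indAct M (UniversalEnvelopingAlgebra.ι ℂ x) (u ⊗ₜ n) =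
      (UniversalEnvelopingAlgebra.ι ℂ (S.snd x) * u) ⊗ₜ n +
        u ⊗ₜ (UniversalEnvelopingAlgebra.ι ℂ (S.fst x) • n) := by
  rw [indAct, UniversalEnvelopingAlgebra.lift_ι_apply]
  rfl

/-- The `U(𝔤)`-module `U(𝔩) ⊗ M` induced by a `U(𝔥)`-module `M`. -/
noncomputable def indObj (M : ModuleCat.{0} (U h)) : ModuleCat.{0} (U g) :=
  (ModuleCat.restrictScalars (S.indAct M).toRingHom).obj
    (ModuleCat.of (Module.End ℂ (U l ⊗[ℂ] M)) (U l ⊗[ℂ] M))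

/-- A linear map compatible with the action of `𝔤` defines a morphism out of `U(𝔩) ⊗ M`. -/
noncomputable def indHomMk {M : ModuleCat.{0} (U h)} {N : ModuleCat.{0} (U g)}
    (f : U l ⊗[ℂ] M →+ N) (hc : ∀ (c : ℂ) w, f (c • w) = algebraMap ℂ (U g) c • f w)
    (hf : ∀ (x : g) (u : U l) (n : M), f ((UniversalEnvelopingAlgebra.ι ℂ (S.snd x) * u) ⊗ₜ n) +
      f (u ⊗ₜ (UniversalEnvelopingAlgebra.ι ℂ (S.fst x) • n)) =
        UniversalEnvelopingAlgebra.ι ℂ x • f (u ⊗ₜ n)) : S.indObj M ⟶ N :=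
  ModuleCat.ofHom (X := S.indObj M)
    { toFun := f
      map_add' := f.map_add
      map_smul' a w := by
        let B : Subalgebra ℂ (U g) :=
          { carrier := {a | ∀ w, f (S.indAct M a w) = a • f w}
            mul_mem' := by
              intro a b ha hb w
              rw [map_mul, Module.End.mul_apply, ha, hb, mul_smul]
            add_mem' := by
              intro a b ha hb w
              rw [map_add, LinearMap.add_apply, map_add, ha, hb, add_smul]
            algebraMap_mem' := by
              intro r w
              rw [AlgHom.commutes, Module.algebraMap_end_apply, hc] }
        have hB : B = ⊤ := enveloping.subalgebra_eq_top B fun x w => by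
          induction w using TensorProduct.induction_on with
          | zero => simp
          | add v w hv hw => rw [map_add, map_add, map_add, smul_add, hv, hw]
          | tmul u n => rw [indAct_ι, map_add, hf]
        have : a ∈ B := hB ▸ Algebra.mem_top
        exact this w }

lemma indObj_hom_ext {M : ModuleCat.{0} (U h)} {N : ModuleCat.{0} (U g)} {f f' : S.indObj M ⟶ N}
    (hf : ∀ (u : U l) (n : M), f.hom (u ⊗ₜ[ℂ] n : U l ⊗[ℂ] M) = f'.hom (u ⊗ₜ[ℂ] n : U l ⊗[ℂ] M)) :
    f = f' := by
  apply ModuleCat.hom_ext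
  refine LinearMap.ext fun (w : U l ⊗[ℂ] M) => ?_
  induction w using TensorProduct.induction_on with
  | zero => exact (map_zero f.hom).trans (map_zero f'.hom).symm
  | add v w hv hw =>
    exact (map_add f.hom _ _).trans ((congrArg₂ (· + ·) hv hw).trans (map_add f'.hom _ _).symm)
  | tmul u n => exact hf u n

lemma ι_smul_tmul (M : ModuleCat.{0} (U h)) (x : g) (u : U l) (n : M) :
    UniversalEnvelopingAlgebra.ι ℂ x • (show S.indObj M from u ⊗ₜ[ℂ] n) =
      (show S.indObj M from (UniversalEnvelopingAlgebra.ι ℂ (S.snd x) * u) ⊗ₜ[ℂ] n +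
        u ⊗ₜ[ℂ] (UniversalEnvelopingAlgebra.ι ℂ (S.fst x) • n)) :=
  S.indAct_ι M x u n

/-- A morphism of `U(𝔥)`-modules as a `ℂ`-linear map. -/
noncomputable abbrev toLin {R : Type} [Ring R] [Algebra ℂ R] {M N : ModuleCat.{0} R} (f : M ⟶ N) :
    M →ₗ[ℂ] N where
  toFun := f.hom
  map_add' := f.hom.map_add
  map_smul' c x := by
    change f.hom (algebraMap ℂ R c • x) = algebraMap ℂ R c • f.hom x
    rw [map_smul]

/-- The functor `M ↦ U(𝔩) ⊗ M` from `U(𝔥)`-modules to `U(𝔤)`-modules. -/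
noncomputable def indFunctor : ModuleCat.{0} (U h) ⥤ ModuleCat.{0} (U g) where
  obj M := S.indObj M
  map {M N} f := S.indHomMk (N := S.indObj N) (LinearMap.lTensor (U l) (toLin f)).toAddMonoidHom (by
      intro c w
      change LinearMap.lTensor (U l) (toLin f) (c • w) =
        S.indAct N (algebraMap ℂ _ c) (LinearMap.lTensor (U l) (toLin f) w)
      rw [AlgHom.commutes, Module.algebraMap_end_apply, map_smul]) (by
      intro x u n
      refine Eq.trans ?_ (S.ι_smul_tmul N x u (f.hom n)).symm
      change (_ : U l ⊗[ℂ] N) + u ⊗ₜ[ℂ] (f.hom (_ • n)) = _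
      rw [map_smul]
      rfl)
  map_id M := S.indObj_hom_ext fun u n => rfl
  map_comp f f' := S.indObj_hom_ext fun u n => rfl

instance : S.indFunctor.Additive where
  map_add {_ _ f f'} := S.indObj_hom_ext fun u n => TensorProduct.tmul_add u (f.hom n) (f'.hom n)

/-- Exactness is tested on underlying vector spaces, and `U(𝔩)` is flat over the field `ℂ`. -/
lemma indFunctor_exact (T : ShortComplex (ModuleCat.{0} (U h))) (hT : T.Exact) :
    (T.map S.indFunctor).Exact := by
  rw [CategoryTheory.ShortComplex.ShortExact.moduleCat_exact_iff_function_exact] at hT ⊢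
  exact Module.Flat.lTensor_exact (U l) (f := toLin T.f) (g := toLin T.g) hT

instance : PreservesFiniteLimits S.indFunctor := by
  have := ((Functor.exact_tfae S.indFunctor).out 1 3).mp S.indFunctor_exact
  exact this.1

instance : PreservesFiniteColimits S.indFunctor := by
  have := ((Functor.exact_tfae S.indFunctor).out 1 3).mp S.indFunctor_exact
  exact this.2

/-- This is what makes `u ⊗ n ↦ u n` linear over `U(𝔤)`: an element of `𝔥` has to be moved past
`U(𝔩)`. -/
lemma comm_enveloping (y : h) (u : U l) :
    enveloping.map S.inr u * UniversalEnvelopingAlgebra.ι ℂ (S.inl y) =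
      UniversalEnvelopingAlgebra.ι ℂ (S.inl y) * enveloping.map S.inr u := by
  let B : Subalgebra ℂ (U l) := (Subalgebra.centralizer ℂ
    {UniversalEnvelopingAlgebra.ι ℂ (S.inl y)}).comap (enveloping.map S.inr)
  have hB : B = ⊤ := enveloping.subalgebra_eq_top B fun z => by
    change enveloping.map S.inr (UniversalEnvelopingAlgebra.ι ℂ z) ∈ Subalgebra.centralizer ℂ _
    rw [Subalgebra.mem_centralizer_iff, enveloping.map_ι]
    rintro _ rfl
    rw [← sub_eq_zero, ← LieRing.of_associative_ring_bracket, ← LieHom.map_lie, S.comm, map_zero]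
  have : u ∈ B := hB ▸ Algebra.mem_top
  exact ((Subalgebra.mem_centralizer_iff ℂ).1 this _ rfl).symm

/-- The map `u ⊗ n ↦ u n` from `U(𝔩) ⊗ N` to `N`. -/
noncomputable def indCounitLin (N : ModuleCat.{0} (U g)) :
    U l ⊗[ℂ] (pullbackModule S.inl).obj N →ₗ[ℂ] N :=
  TensorProduct.lift ((Algebra.lsmul ℂ ℂ N).toLinearMap ∘ₗ
        (enveloping.map S.inr).toLinearMap) ∘ₗ
      LinearMap.lTensor (U l) (show (pullbackModule S.inl).obj N →ₗ[ℂ] N from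
        { toFun := fun n => (show N from n)
          map_add' := fun _ _ => rfl
          map_smul' := fun c n => by
            change (enveloping.map S.inl (algebraMap ℂ _ c)) • (show N from n) = _
            rw [AlgHom.commutes]
            rfl })

/-- The map `u ⊗ n ↦ ε(u) n` from `U(𝔩) ⊗ M` to `M`. -/
noncomputable def indAugLin (l : Type) [LieRing l] [LieAlgebra ℂ l] (M : ModuleCat.{0} (U h)) :
    U l ⊗[ℂ] M →ₗ[ℂ] M :=
  (TensorProduct.lid ℂ M).toLinearMap ∘ₗ LinearMap.rTensor M (enveloping.counit l).toLinearMap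

/-- The counit `U(𝔩) ⊗ N → N` of the induction adjunction. -/
noncomputable def indCounit : pullbackModule S.inl ⋙ S.indFunctor ⟶ 𝟭 (ModuleCat.{0} (U g)) where
  app N := S.indHomMk (M := (pullbackModule S.inl).obj N) (S.indCounitLin N).toAddMonoidHom
    (fun c w => (S.indCounitLin N).map_smul c w) (by
      intro x u n
      change enveloping.map S.inr (UniversalEnvelopingAlgebra.ι ℂ (S.snd x) * u) • (show N from n) +
        enveloping.map S.inr u • enveloping.map S.inl (UniversalEnvelopingAlgebra.ι ℂ (S.fst x)) •
          (show N from n) = UniversalEnvelopingAlgebra.ι ℂ x •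
            enveloping.map S.inr u • (show N from n)
      rw [map_mul, enveloping.map_ι, enveloping.map_ι, ← mul_smul, ← mul_smul, ← add_smul,
        comm_enveloping, ← add_mul, ← map_add, add_comm, S.decomp])
  naturality {N N'} f := S.indObj_hom_ext fun u n => by
    exact (map_smul f.hom (enveloping.map S.inr u) (show N from n)).symm

/-- The component at `N` of the counit. -/
noncomputable def indCounitApp (N : ModuleCat.{0} (U g)) :
    S.indFunctor.obj ((pullbackModule S.inl).obj N) ⟶ N := S.indCounit.app N

/-- The map `U(𝔩) ⊗ M → M` induced by the augmentation of `U(𝔩)`. -/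
noncomputable def indAug : S.indFunctor ⟶ pullbackModule S.fst where
  app M := S.indHomMk (N := (pullbackModule S.fst).obj M)
    (indAugLin l M).toAddMonoidHom (by
      intro c w
      refine ((indAugLin l M).map_smul c w).trans ?_
      change _ = enveloping.map S.fst (algebraMap ℂ _ c) • (show M from _)
      rw [AlgHom.commutes]
      rfl) (by
      intro x u n
      change enveloping.counit l (UniversalEnvelopingAlgebra.ι ℂ (S.snd x) * u) • (n : M) +
        enveloping.counit l u • (UniversalEnvelopingAlgebra.ι ℂ (S.fst x) • n) =
        enveloping.map S.fst (UniversalEnvelopingAlgebra.ι ℂ x) • (enveloping.counit l u • n)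
      rw [map_mul, enveloping.counit_ι, zero_mul, zero_smul, zero_add, enveloping.map_ι,
        smul_comm])
  naturality {M M'} f := S.indObj_hom_ext fun u n => by
    exact (map_smul (toLin f) (enveloping.counit l u) n).symm

/-- The unit `M → U(𝔩) ⊗ M` of the induction adjunction. -/
noncomputable def indUnit (M : ModuleCat.{0} (U h)) :
    M ⟶ (pullbackModule S.inl).obj (S.indFunctor.obj M) :=
  ModuleCat.ofHom (Y := (pullbackModule S.inl).obj (S.indFunctor.obj M))
    { toFun n := (1 ⊗ₜ[ℂ] n : U l ⊗[ℂ] M)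
      map_add' n n' := TensorProduct.tmul_add _ _ _
      map_smul' a n := by
        let B : Subalgebra ℂ (U h) :=
          { carrier := {a | ∀ n : M, ((1 : U l) ⊗ₜ[ℂ] (a • n) : U l ⊗[ℂ] M) =
              S.indAct M (enveloping.map S.inl a) (1 ⊗ₜ[ℂ] n)}
            mul_mem' := by
              intro a b ha hb n
              rw [map_mul, map_mul, Module.End.mul_apply, ← hb, ← ha, mul_smul]
            add_mem' := by
              intro a b ha hb n
              rw [map_add, map_add, LinearMap.add_apply, ← hb, ← ha, add_smul,
                TensorProduct.tmul_add]
            algebraMap_mem' := by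
              intro r n
              rw [AlgHom.commutes, AlgHom.commutes, Module.algebraMap_end_apply, algebraMap_smul,
                TensorProduct.tmul_smul] }
        have hB : B = ⊤ := enveloping.subalgebra_eq_top B fun y n => by
          rw [enveloping.map_ι, indAct_ι, S.snd_inl, S.fst_inl, map_zero, zero_mul,
            TensorProduct.zero_tmul, zero_add]
        have : a ∈ B := hB ▸ Algebra.mem_top
        exact this n }

/-- The element `u` of `U(𝔩)` acts on `U(𝔩) ⊗ M` by multiplication. -/
lemma indAct_inr (M : ModuleCat.{0} (U h)) (u v : U l) (n : M) :
    S.indAct M (enveloping.map S.inr u) (v ⊗ₜ n) = (u * v) ⊗ₜ n := by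
  let B : Subalgebra ℂ (U l) :=
    { carrier := {u | ∀ (v : U l), S.indAct M (enveloping.map S.inr u) (v ⊗ₜ n) = (u * v) ⊗ₜ n}
      mul_mem' := by
        intro a b ha hb v
        rw [map_mul, map_mul, Module.End.mul_apply, hb, ha, mul_assoc]
      add_mem' := by
        intro a b ha hb v
        rw [map_add, map_add, LinearMap.add_apply, hb, ha, add_mul, TensorProduct.add_tmul]
      algebraMap_mem' := by
        intro r v
        rw [AlgHom.commutes, AlgHom.commutes, Module.algebraMap_end_apply, ← Algebra.smul_def,
          TensorProduct.smul_tmul'] }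
  have hB : B = ⊤ := enveloping.subalgebra_eq_top B fun z v => by
    rw [enveloping.map_ι, indAct_ι, S.snd_inr, S.fst_inr, map_zero, zero_smul,
      TensorProduct.tmul_zero, add_zero]
  have : u ∈ B := hB ▸ Algebra.mem_top
  exact this v

lemma indUnit_indCounit (M : ModuleCat.{0} (U h)) :
    S.indFunctor.map (S.indUnit M) ≫ S.indCounitApp (S.indFunctor.obj M) =
      𝟙 (S.indFunctor.obj M) :=
  S.indObj_hom_ext fun u n => by
    change S.indAct M (enveloping.map S.inr u) (1 ⊗ₜ n) = u ⊗ₜ n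
    rw [indAct_inr, mul_one]

/-- Every extension of the trivial module by the induced module comes from `𝔥`. -/
lemma exists_of_ind {i : ℕ}
    (e : Ext (S.indFunctor.obj (trivialModule h)) (trivialModule g) i) :
    ∃ b : LieCohomology h i, e = (Ext.mk₀ (S.indAug.app (trivialModule h) ≫
      (pullbackTrivial S.fst).inv)).comp (LieCohomology.map S.fst i b) (zero_add i) := by
  have : PreservesFiniteLimits (pullbackModule S.inl ⋙ S.indFunctor) :=
    comp_preservesFiniteLimits _ _
  have : PreservesFiniteColimits (pullbackModule S.inl ⋙ S.indFunctor) :=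
    comp_preservesFiniteColimits _ _
  have h1 := ExtFunctoriality.natTrans _ _ S.indCounit e
  rw [ExtFunctoriality.mapComp, ExtFunctoriality.mapId] at h1
  change Ext.comp ((e.mapExactFunctor (pullbackModule S.inl)).mapExactFunctor S.indFunctor)
    (Ext.mk₀ (S.indCounitApp (trivialModule g))) _ =
    Ext.comp (Ext.mk₀ (S.indCounitApp (S.indFunctor.obj (trivialModule h)))) e _ at h1
  -- The adjoint of `e`: restrict it to `𝔥` and precompose with the unit of the adjunction.
  let b : LieCohomology h i := (Ext.mk₀ (S.indUnit _)).comp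
    ((e.mapExactFunctor (pullbackModule S.inl)).comp (Ext.mk₀ (pullbackTrivial S.inl).inv)
      (add_zero i)) (zero_add i)
  -- On the trivial module the counit of the adjunction is just the augmentation of `U(𝔩)`.
  have key : S.indFunctor.map (pullbackTrivial S.inl).hom ≫
      S.indCounitApp (trivialModule g) =
      S.indAug.app (trivialModule h) ≫ (pullbackTrivial S.fst).inv :=
    S.indObj_hom_ext fun u n => by
      change (enveloping.counit g (enveloping.map S.inr u) * (show ℂ from n) : ℂ) =
        enveloping.counit h (algebraMap ℂ _ (enveloping.counit l u)) * (show ℂ from n)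
      rw [AlgHom.commutes, ← enveloping.counit_comp_map S.inr]
      rfl
  -- Naturality of the counit and one triangle identity recover `e` from the extension induced by
  -- `b`.
  have h2 : e = (b.mapExactFunctor S.indFunctor).comp
      (Ext.mk₀ (S.indAug.app (trivialModule h) ≫ (pullbackTrivial S.fst).inv)) (add_zero i) := by
    rw [← key, ← Ext.mk₀_comp_mk₀]
    simp only [b, Ext.mapExactFunctor_comp, Ext.mapExactFunctor_mk₀,
      Ext.comp_assoc_of_third_deg_zero]
    rw [Ext.mk₀_comp_mk₀_assoc, ← S.indFunctor.map_comp, Iso.inv_hom_id,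
      CategoryTheory.Functor.map_id, Ext.mk₀_id_comp, h1, Ext.mk₀_comp_mk₀_assoc,
      indUnit_indCounit, Ext.mk₀_id_comp]
  refine ⟨b, ?_⟩
  -- Naturality of the augmentation replaces the extension induced from `b` by its pullback along
  -- the projection to `𝔥`.
  have h3 := ExtFunctoriality.natTrans _ _ S.indAug b
  rw [h2, ← Ext.mk₀_comp_mk₀, ← Ext.comp_assoc_of_third_deg_zero, h3,
    LieCohomology.map, ExtFunctoriality.conjMap_apply,
    Ext.comp_assoc_of_third_deg_zero, Ext.mk₀_comp_mk₀, Ext.mk₀_comp_mk₀_assoc, Category.assoc,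
    Iso.inv_hom_id, Category.comp_id]

/-- The module induced by the trivial module is the restriction of the regular module of `𝔩`. -/
noncomputable def regularToInd : (pullbackModule S.snd).obj (regularModule l) ⟶
    S.indFunctor.obj (trivialModule h) :=
  ModuleCat.ofHom (X := (pullbackModule S.snd).obj (regularModule l))
    (Y := S.indFunctor.obj (trivialModule h))
    { toFun u := (show U l ⊗[ℂ] trivialModule h from (show U l from u) ⊗ₜ[ℂ]
        (show trivialModule h from (1 : ℂ)))
      map_add' u u' := TensorProduct.add_tmul _ _ _
      map_smul' a u := by
        let B : Subalgebra ℂ (U g) :=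
          { carrier := {a | ∀ u : U l, ((enveloping.map S.snd a * u) ⊗ₜ[ℂ]
              (show trivialModule h from (1 : ℂ)) : U l ⊗[ℂ] trivialModule h) =
              S.indAct _ a (u ⊗ₜ[ℂ] (show trivialModule h from (1 : ℂ)))}
            mul_mem' := by
              intro a b ha hb n
              rw [map_mul, map_mul, Module.End.mul_apply, ← hb, ← ha, mul_assoc]
            add_mem' := by
              intro a b ha hb n
              rw [map_add, map_add, LinearMap.add_apply, ← hb, ← ha, add_mul,
                TensorProduct.add_tmul]
            algebraMap_mem' := by
              intro r n
              rw [AlgHom.commutes, AlgHom.commutes, Module.algebraMap_end_apply,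
                ← Algebra.smul_def, TensorProduct.smul_tmul'] }
        have hB : B = ⊤ := enveloping.subalgebra_eq_top B fun y u => by
          rw [enveloping.map_ι, indAct_ι, left_eq_add]
          refine Eq.trans ?_ (TensorProduct.tmul_zero _ u)
          congr 1
          change enveloping.counit h (UniversalEnvelopingAlgebra.ι ℂ (S.fst y)) * (1 : ℂ) = 0
          rw [enveloping.counit_ι, zero_mul]
        have : a ∈ B := hB ▸ Algebra.mem_top
        exact this u }

instance : IsIso S.regularToInd := by
  rw [ConcreteCategory.isIso_iff_bijective]
  let e : U l ≃ₗ[ℂ] U l ⊗[ℂ] trivialModule h :=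
    (TensorProduct.rid ℂ (U l)).symm.trans (TensorProduct.congr (LinearEquiv.refl ℂ _)
      { toFun := fun c : ℂ => (show trivialModule h from c)
        map_add' := fun _ _ => rfl
        map_smul' := fun c d => by
          change (c * d : ℂ) = enveloping.counit h (algebraMap ℂ _ c) * d
          rw [AlgHom.commutes]
          rfl
        invFun := fun c => c
        left_inv := fun _ => rfl
        right_inv := fun _ => rfl })
  exact e.bijective

/-- Shapiro's lemma in the form used below: `U(𝔩)` is the induced trivial module, so every extension
out of it is a class of `𝔥` pulled back to `𝔤` and then along the augmentation. In particular it
factors through the augmentation. -/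
lemma exists_of_regular {i : ℕ}
    (e : Ext ((pullbackModule S.snd).obj (regularModule l)) (trivialModule g) i) :
    ∃ b : LieCohomology h i, e = (Ext.mk₀ ((pullbackModule S.snd).map (augProj l) ≫
      (pullbackTrivial S.snd).inv)).comp (LieCohomology.map S.fst i b) (zero_add i) := by
  obtain ⟨b, hb⟩ := S.exists_of_ind ((Ext.mk₀ (inv S.regularToInd)).comp e (zero_add i))
  refine ⟨b, ?_⟩
  have key : S.regularToInd ≫ S.indAug.app (trivialModule h) ≫ (pullbackTrivial S.fst).inv =
      (pullbackModule S.snd).map (augProj l) ≫ (pullbackTrivial S.snd).inv := by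
    apply ModuleCat.hom_ext
    refine LinearMap.ext fun (u : U l) => ?_
    change (enveloping.counit h (algebraMap ℂ _ (enveloping.counit l u)) * 1 : ℂ) =
      enveloping.counit l u
    rw [AlgHom.commutes, mul_one]
    rfl
  rw [← key, ← Ext.mk₀_comp_mk₀_assoc, ← hb, Ext.mk₀_comp_mk₀_assoc, IsIso.hom_inv_id,
    Ext.mk₀_id_comp]

end LieSplitting

end TwistedInduction

/-! ### Künneth decomposition for a product with a free Lie algebra. -/

section FreeFactor

open CategoryTheory CategoryTheory.Abelian

attribute [local instance 100] LieRing.ofAssociativeRing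

variable {g h : Type} [LieRing g] [LieAlgebra ℂ g] [LieRing h] [LieAlgebra ℂ h] {m : ℕ}

namespace LieSplitting

section

variable {l : Type} [LieRing l] [LieAlgebra ℂ l] (S : LieSplitting g h l)

/-- The augmentation `U(𝔩) → ℂ` as a morphism of `U(𝔤)`-modules. -/
noncomputable def pullbackAug : (pullbackModule S.snd).obj (regularModule l) ⟶ trivialModule g :=
  (pullbackModule S.snd).map (augProj l) ≫ (pullbackTrivial S.snd).inv

lemma map_inl_map_fst {i : ℕ} (b : LieCohomology h i) :
    LieCohomology.map S.inl i (LieCohomology.map S.fst i b) = b := by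
  rw [← LieCohomology.map_comp, show S.fst.comp S.inl = LieHom.id from LieHom.ext S.fst_inl,
    LieCohomology.map_id]

/-- The map `ℂ → U(𝔩)`, a section of the augmentation over `U(𝔥)`. -/
noncomputable def pullbackUnit : trivialModule h ⟶
    (pullbackModule S.inl).obj ((pullbackModule S.snd).obj (regularModule l)) :=
  ModuleCat.ofHom (X := trivialModule h)
    (Y := (pullbackModule S.inl).obj ((pullbackModule S.snd).obj (regularModule l)))
    { toFun (c : ℂ) := algebraMap ℂ (UniversalEnvelopingAlgebra ℂ l) c
      map_add' c d := map_add (algebraMap ℂ (UniversalEnvelopingAlgebra ℂ l)) c d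
      map_smul' u c := by
        change algebraMap ℂ (UniversalEnvelopingAlgebra ℂ l) (enveloping.counit h u * (show ℂ from c)) =
          enveloping.map S.snd (enveloping.map S.inl u) * algebraMap ℂ _ (show ℂ from c)
        rw [map_mul]
        congr 1
        have : (enveloping.map S.snd).comp (enveloping.map S.inl) =
            (Algebra.ofId ℂ _).comp (enveloping.counit h) := by
          apply UniversalEnvelopingAlgebra.hom_ext
          apply LieHom.ext
          intro y
          change enveloping.map S.snd (enveloping.map S.inl (UniversalEnvelopingAlgebra.ι ℂ y)) =
            algebraMap ℂ _ (enveloping.counit h (UniversalEnvelopingAlgebra.ι ℂ y))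
          rw [enveloping.map_ι, enveloping.map_ι, enveloping.counit_ι, S.snd_inl, map_zero,
            map_zero]
        exact (AlgHom.congr_fun this u).symm }

lemma pullbackUnit_aug : S.pullbackUnit ≫ (pullbackModule S.inl).map S.pullbackAug =
    (pullbackTrivial S.inl).hom := by
  apply ModuleCat.hom_ext
  refine LinearMap.ext fun (c : ℂ) => ?_
  exact (enveloping.counit l).commutes c

/-- Over `U(𝔥)` the augmentation of `U(𝔩)` is split by the unit map, so the restriction of a class
to `𝔥` can be recovered from its pullback along the augmentation. -/
lemma map_inl_eq_of_aug {i : ℕ} {x y : LieCohomology g i}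
    (hxy : (Ext.mk₀ S.pullbackAug).comp x (zero_add i) =
      (Ext.mk₀ S.pullbackAug).comp y (zero_add i)) :
    LieCohomology.map S.inl i x = LieCohomology.map S.inl i y := by
  have key (z : LieCohomology g i) : LieCohomology.map S.inl i z = (Ext.mk₀ S.pullbackUnit).comp
      ((((Ext.mk₀ S.pullbackAug).comp z (zero_add i)).mapExactFunctor (pullbackModule S.inl)).comp
        (Ext.mk₀ (pullbackTrivial S.inl).inv) (add_zero i)) (zero_add i) := by
    rw [LieCohomology.map, ExtFunctoriality.conjMap_apply, Ext.mapExactFunctor_comp,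
      Ext.mapExactFunctor_mk₀, ← pullbackUnit_aug, ← Ext.mk₀_comp_mk₀_assoc,
      Ext.comp_assoc_of_third_deg_zero]
  rw [key, key, hxy]

end

variable (S : LieSplitting g h (FreeLieAlgebra ℂ (Fin m)))

/-- The class in `H^1(𝔤, ℂ)` dual to the generator `x_j` of the free factor. -/
noncomputable def dualClass (j : Fin m) : LieCohomology g 1 :=
  charClass ((dualChar j).comp S.snd)

/-- The class of the augmentation sequence of the free factor, over `U(𝔤)`. -/
noncomputable def pullbackExtClass :
    Ext ((pullbackModule S.snd).obj (trivialModule (FreeLieAlgebra ℂ (Fin m))))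
      ((pullbackModule S.snd).obj (augModule (FreeLieAlgebra ℂ (Fin m)))) 1 :=
  ((augSeq_shortExact (FreeLieAlgebra ℂ (Fin m))).map_of_exact (pullbackModule S.snd)).extClass

lemma mapExactFunctor_augSeq_extClass :
    (augSeq_shortExact (FreeLieAlgebra ℂ (Fin m))).extClass.mapExactFunctor (pullbackModule S.snd) =
      S.pullbackExtClass :=
  Ext.mapExactFunctor_extClass (pullbackModule S.snd)
    (augSeq_shortExact (FreeLieAlgebra ℂ (Fin m)))

lemma pullbackExtClass_exact₁ {Y : ModuleCat.{0} (UniversalEnvelopingAlgebra ℂ g)} {i : ℕ}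
    (x : Ext ((pullbackModule S.snd).obj (augModule (FreeLieAlgebra ℂ (Fin m)))) Y i)
    (hx : S.pullbackExtClass.comp x (add_comm 1 i) = 0) :
    ∃ y : Ext ((pullbackModule S.snd).obj (regularModule (FreeLieAlgebra ℂ (Fin m)))) Y i,
      (Ext.mk₀ ((pullbackModule S.snd).map (augIncl _))).comp y (zero_add i) = x :=
  Ext.contravariant_sequence_exact₁ ((augSeq_shortExact (FreeLieAlgebra ℂ (Fin m))).map_of_exact
    (pullbackModule S.snd)) Y x (add_comm 1 i) hx

lemma pullbackExtClass_exact₃ {Y : ModuleCat.{0} (UniversalEnvelopingAlgebra ℂ g)} {i : ℕ}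
    (x : Ext ((pullbackModule S.snd).obj (trivialModule (FreeLieAlgebra ℂ (Fin m)))) Y (i + 1))
    (hx : (Ext.mk₀ ((pullbackModule S.snd).map (augProj _))).comp x (zero_add (i + 1)) = 0) :
    ∃ y : Ext ((pullbackModule S.snd).obj (augModule (FreeLieAlgebra ℂ (Fin m)))) Y i,
      S.pullbackExtClass.comp y (add_comm 1 i) = x :=
  Ext.contravariant_sequence_exact₃ ((augSeq_shortExact (FreeLieAlgebra ℂ (Fin m))).map_of_exact
    (pullbackModule S.snd)) Y x hx (add_comm 1 i)

/-- The class of the augmentation sequence of the free factor, as an extension of the trivial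
module of `𝔤`. -/
noncomputable def pullbackClass : Ext (trivialModule g)
    ((pullbackModule S.snd).obj (augModule (FreeLieAlgebra ℂ (Fin m)))) 1 :=
  (Ext.mk₀ (pullbackTrivial S.snd).hom).comp S.pullbackExtClass (zero_add 1)

lemma dualClass_eq (j : Fin m) : S.dualClass j = S.pullbackClass.comp
    (Ext.mk₀ ((pullbackModule S.snd).map (freeCoord j) ≫ S.pullbackAug)) (add_zero 1) := by
  have h1 : (pullbackModule S.snd).map (freeCoord j) ≫ S.pullbackAug =
      (pullbackModule S.snd).map (charHom (dualChar j)) ≫ (pullbackTrivial S.snd).inv := by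
    rw [charHom_dualChar, CategoryTheory.Functor.map_comp, Category.assoc]
    rfl
  rw [h1, dualClass, ← map_charClass, LieCohomology.map, ExtFunctoriality.conjMap_apply, charClass,
    Ext.mapExactFunctor_comp, Ext.mapExactFunctor_mk₀, Ext.comp_assoc_of_third_deg_zero,
    Ext.mk₀_comp_mk₀, pullbackClass, mapExactFunctor_augSeq_extClass, Ext.comp_assoc_of_third_deg_zero]

/-- By Shapiro's lemma the pullback of `e` to `U(L)` is governed by the restriction of `e` to `𝔥`,
which is zero; the long exact sequence then puts `e` in the image of the connecting map. -/
lemma pullbackClass_exact {i : ℕ} (e : LieCohomology g (i + 1))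
    (he : LieCohomology.map S.inl (i + 1) e = 0) :
    ∃ e' : Ext ((pullbackModule S.snd).obj (augModule (FreeLieAlgebra ℂ (Fin m))))
      (trivialModule g) i, e = S.pullbackClass.comp e' (add_comm 1 i) := by
  have h0 : (Ext.mk₀ S.pullbackAug).comp e (zero_add (i + 1)) = 0 := by
    obtain ⟨b, hb⟩ := S.exists_of_regular ((Ext.mk₀ S.pullbackAug).comp e (zero_add (i + 1)))
    have := S.map_inl_eq_of_aug hb
    rw [map_inl_map_fst, he] at this
    rw [hb, ← this, map_zero, Ext.comp_zero]
  obtain ⟨e', he'⟩ := S.pullbackExtClass_exact₃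
    ((Ext.mk₀ (pullbackTrivial S.snd).inv).comp e (zero_add (i + 1)))
    ((Ext.mk₀_comp_mk₀_assoc _ _ _).trans h0)
  refine ⟨e', ?_⟩
  rw [pullbackClass, Ext.comp_assoc _ _ _ (zero_add 1) (add_comm 1 i) (by lia), he',
    Ext.mk₀_comp_mk₀_assoc, Iso.hom_inv_id, Ext.mk₀_id_comp]

lemma sum_dualClass_comp {i : ℕ} (b : Fin m → LieCohomology h i) :
    ∑ j, (S.dualClass j).comp (LieCohomology.map S.fst i (b j)) (add_comm 1 i) =
      S.pullbackClass.comp (∑ j, (Ext.mk₀ ((pullbackModule S.snd).map (freeCoord j))).comp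
        ((Ext.mk₀ S.pullbackAug).comp (LieCohomology.map S.fst i (b j)) (zero_add i))
          (zero_add i)) (add_comm 1 i) := by
  rw [Ext.comp_sum]
  refine Finset.sum_congr rfl fun j _ => ?_
  rw [dualClass_eq, Ext.mk₀_comp_mk₀_assoc, Ext.comp_assoc_of_second_deg_zero]

/-- After subtracting the part coming from `𝔥`, the class restricts to zero on `𝔥` and is the image
of an extension out of the augmentation ideal. That ideal is a sum of copies of `U(L)`, and on each
copy Shapiro's lemma supplies a class of `𝔥`. -/
lemma exists_decomposition {i : ℕ} (e : LieCohomology g (i + 1)) :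
    ∃ (a : LieCohomology h (i + 1)) (b : Fin m → LieCohomology h i),
      e = LieCohomology.map S.fst (i + 1) a +
        ∑ j, (S.dualClass j).comp (LieCohomology.map S.fst i (b j)) (add_comm 1 i) := by
  obtain ⟨e', he'⟩ := S.pullbackClass_exact
    (e - LieCohomology.map S.fst (i + 1) (LieCohomology.map S.inl (i + 1) e))
    (by rw [map_sub, map_inl_map_fst, sub_self])
  choose b hb using fun j => S.exists_of_regular
    ((Ext.mk₀ ((pullbackModule S.snd).map (freeIncl j))).comp e' (zero_add i))
  refine ⟨LieCohomology.map S.inl (i + 1) e, b, ?_⟩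
  rw [← sub_eq_iff_eq_add', he', sum_dualClass_comp]
  congr 1
  have h1 : ∑ j : Fin m, (pullbackModule S.snd).map (freeCoord j) ≫
      (pullbackModule S.snd).map (freeIncl j) = 𝟙 _ := by
    simp only [← CategoryTheory.Functor.map_comp]
    rw [← CategoryTheory.Functor.map_sum, sum_freeCoord_freeIncl, CategoryTheory.Functor.map_id]
  rw [← Ext.mk₀_id_comp e', ← h1, Ext.mk₀_sum, Ext.sum_comp]
  refine Finset.sum_congr rfl fun j _ => ?_
  rw [← Ext.mk₀_comp_mk₀_assoc, hb]
  rfl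

/-- Restriction to `𝔥` kills the dual classes and isolates `a`. The rest is the image of an
extension `e'` out of the augmentation ideal; if it vanishes, `e'` extends to `U(L)`. Extensions out
of `U(L)` factor through the augmentation, which is zero on the ideal, so `e' = 0`, and its
coordinates determine `b`. -/
lemma decomposition_unique {i : ℕ} {a : LieCohomology h (i + 1)} {b : Fin m → LieCohomology h i}
    (hab : LieCohomology.map S.fst (i + 1) a +
      ∑ j, (S.dualClass j).comp (LieCohomology.map S.fst i (b j)) (add_comm 1 i) = 0) :
    a = 0 ∧ b = 0 := by
  have hd (j : Fin m) : LieCohomology.map S.inl 1 (S.dualClass j) = 0 := by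
    rw [dualClass, map_charClass]
    refine charClass_zero fun x => ?_
    change dualChar j (S.snd (S.inl x)) = 0
    rw [S.snd_inl, map_zero]
  have ha : a = 0 := by
    have := congrArg (LieCohomology.map S.inl (i + 1)) hab
    rw [map_add, map_inl_map_fst, map_sum, map_zero] at this
    rw [← this, left_eq_add]
    exact Finset.sum_eq_zero fun j _ => by
      rw [LieCohomology.map_comp_ext, hd, Ext.zero_comp]
  refine ⟨ha, ?_⟩
  rw [ha, map_zero, zero_add, sum_dualClass_comp] at hab
  set e' := ∑ j, (Ext.mk₀ ((pullbackModule S.snd).map (freeCoord j))).comp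
        ((Ext.mk₀ S.pullbackAug).comp (LieCohomology.map S.fst i (b j)) (zero_add i))
          (zero_add i) with he'
  have h1 : S.pullbackExtClass.comp e' (add_comm 1 i) = 0 := by
    rw [← Ext.mk₀_id_comp (S.pullbackExtClass.comp e' _), ← (pullbackTrivial S.snd).inv_hom_id,
      ← Ext.mk₀_comp_mk₀_assoc, ← Ext.comp_assoc _ _ _ (zero_add 1) (add_comm 1 i) (by lia)]
    exact (congrArg (fun z => Ext.comp (Ext.mk₀ (pullbackTrivial S.snd).inv) z
      (zero_add (i + 1))) hab).trans (Ext.comp_zero _ _ _ _ _)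
  obtain ⟨x, hx⟩ := S.pullbackExtClass_exact₁ e' h1
  obtain ⟨c, rfl⟩ := S.exists_of_regular x
  have he0 : e' = 0 := by
    rw [← hx]
    rw [Ext.mk₀_comp_mk₀_assoc, ← Category.assoc, ← CategoryTheory.Functor.map_comp,
      augIncl_augProj, CategoryTheory.Functor.map_zero, Limits.zero_comp, Ext.mk₀_zero,
      Ext.zero_comp]
  funext k
  have h2 : (Ext.mk₀ ((pullbackModule S.snd).map (freeIncl k))).comp e' (zero_add i) =
      (Ext.mk₀ S.pullbackAug).comp (LieCohomology.map S.fst i (b k)) (zero_add i) := by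
    rw [he', Ext.comp_sum, Finset.sum_eq_single k]
    · rw [Ext.mk₀_comp_mk₀_assoc, ← CategoryTheory.Functor.map_comp, freeIncl_freeCoord, if_pos rfl,
        CategoryTheory.Functor.map_id, Ext.mk₀_id_comp]
    · intro j _ hj
      rw [Ext.mk₀_comp_mk₀_assoc, ← CategoryTheory.Functor.map_comp, freeIncl_freeCoord, if_neg hj,
        CategoryTheory.Functor.map_zero, Ext.mk₀_zero, Ext.zero_comp]
    · simp
  have h3 : (Ext.mk₀ S.pullbackAug).comp (LieCohomology.map S.fst i (b k)) (zero_add i) =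
      (Ext.mk₀ S.pullbackAug).comp (0 : LieCohomology g i) (zero_add i) := by
    rw [← h2, he0, Ext.comp_zero, Ext.comp_zero]
  have := S.map_inl_eq_of_aug h3
  rwa [map_inl_map_fst, map_zero] at this

/-- The decomposition of the cohomology of a product with a free Lie algebra. -/
noncomputable def cohomologyEquiv (i : ℕ) :
    (LieCohomology h (i + 1) × (Fin m → LieCohomology h i)) ≃ₗ[ℂ] LieCohomology g (i + 1) :=
  LinearEquiv.ofBijective
    { toFun x := LieCohomology.map S.fst (i + 1) x.1 +
        ∑ j, (S.dualClass j).comp (LieCohomology.map S.fst i (x.2 j)) (add_comm 1 i)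
      map_add' x y := by
        simp only [Prod.fst_add, Prod.snd_add, map_add, Pi.add_apply, Ext.comp_add,
          Finset.sum_add_distrib]
        abel
      map_smul' c x := by
        simp only [Prod.smul_fst, Prod.smul_snd, map_smul, Pi.smul_apply, Ext.comp_smul,
          ← Finset.smul_sum, smul_add, RingHom.id_apply] } (by
    constructor
    · rw [← LinearMap.ker_eq_bot, LinearMap.ker_eq_bot']
      rintro ⟨a, b⟩ hab
      obtain ⟨rfl, rfl⟩ := S.decomposition_unique hab
      rfl
    · intro e
      obtain ⟨a, b, rfl⟩ := S.exists_decomposition e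
      exact ⟨⟨a, b⟩, rfl⟩)

end LieSplitting

end FreeFactor

/-! ### Alternating products of degree one classes. -/

section CohomologyProducts

open CategoryTheory CategoryTheory.Abelian

attribute [local instance 100] LieRing.ofAssociativeRing

variable {g h : Type} [LieRing g] [LieAlgebra ℂ g] [LieRing h] [LieAlgebra ℂ h]
  {E E' : Type} [AddCommGroup E] [Module ℂ E] [AddCommGroup E'] [Module ℂ E']

/-- Left multiplication by degree one classes on the product of the cohomology groups. -/
noncomputable def leftMulClass (θ : E →ₗ[ℂ] LieCohomology g 1) :
    E →ₗ[ℂ] Module.End ℂ (∀ d, LieCohomology g d) where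
  toFun e :=
    { toFun x := fun
        | 0 => 0
        | d + 1 => (θ e).comp (x d) (add_comm 1 d)
      map_add' x y := by
        funext d
        cases d with
        | zero => exact (add_zero _).symm
        | succ d => exact Ext.comp_add _ _ _ _
      map_smul' c x := by
        funext d
        cases d with
        | zero => exact (smul_zero c).symm
        | succ d => exact Ext.comp_smul _ _ _ _ }
  map_add' e e' := by
    ext x d : 2
    cases d with
    | zero => exact (add_zero _).symm
    | succ d =>
      change (θ (e + e')).comp (x d) (add_comm 1 d) = _
      rw [map_add]
      exact Ext.add_comp _ _ _ (add_comm 1 d)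
  map_smul' c e := by
    ext x d : 2
    cases d with
    | zero => exact (smul_zero c).symm
    | succ d =>
      change (θ (c • e)).comp (x d) (add_comm 1 d) = _
      rw [map_smul]
      exact Ext.smul_comp (θ e) (x d) (add_comm 1 d) c

lemma leftMulClass_sq (θ : E →ₗ[ℂ] LieCohomology g 1) (hθ : ∀ e, (θ e).comp (θ e) rfl = 0)
    (e : E) : leftMulClass θ e * leftMulClass θ e = 0 := by
  ext x d : 2
  match d with
  | 0 => rfl
  | 1 => exact Ext.comp_zero (θ e) _ 0 1 (add_comm 1 0)
  | d + 2 =>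
    change (θ e).comp ((θ e).comp (x d) (add_comm 1 d)) (add_comm 1 (d + 1)) = 0
    rw [← Ext.comp_assoc _ _ _ rfl _ (by lia), hθ, Ext.zero_comp]

/-- The alternating product `H^1 × ⋯ × H^1 → H^i` of degree one classes with vanishing squares. -/
noncomputable def classProd (θ : E →ₗ[ℂ] LieCohomology g 1) (hθ : ∀ e, (θ e).comp (θ e) rfl = 0)
    (i : ℕ) : E [⋀^Fin i]→ₗ[ℂ] LieCohomology g i :=
  -- Since squares vanish, left multiplications extend to an action of the exterior algebra on the
  -- product of all cohomology groups. The alternating product is the action on the unit of `H^0`,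
  -- read in degree `i`.
  (LinearMap.proj i ∘ₗ LinearMap.applyₗ (Pi.single 0 (Ext.mk₀ (𝟙 (trivialModule g)))) ∘ₗ
    (ExteriorAlgebra.lift ℂ ⟨leftMulClass θ, leftMulClass_sq θ hθ⟩).toLinearMap).compAlternatingMap
    (ExteriorAlgebra.ιMulti ℂ i)

lemma classProd_zero (θ : E →ₗ[ℂ] LieCohomology g 1) (hθ) (v : Fin 0 → E) :
    classProd θ hθ 0 v = Ext.mk₀ (𝟙 (trivialModule g)) := by
  simp [classProd]

lemma classProd_succ (θ : E →ₗ[ℂ] LieCohomology g 1) (hθ) {i : ℕ} (v : Fin (i + 1) → E) :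
    classProd θ hθ (i + 1) v =
      (θ (v 0)).comp (classProd θ hθ i (Matrix.vecTail v)) (add_comm 1 i) := by
  simp only [classProd, LinearMap.compAlternatingMap_apply, ExteriorAlgebra.ιMulti_succ_apply,
    LinearMap.comp_apply, AlgHom.toLinearMap_apply, map_mul, ExteriorAlgebra.lift_ι_apply]
  rfl

lemma map_classProd (ψ : g →ₗ⁅ℂ⁆ h) (θ : E →ₗ[ℂ] LieCohomology h 1) (hθ)
    (θ' : E' →ₗ[ℂ] LieCohomology g 1) (hθ') (f : E → E')
    (hf : ∀ e, LieCohomology.map ψ 1 (θ e) = θ' (f e)) {i : ℕ} (v : Fin i → E) :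
    LieCohomology.map ψ i (classProd θ hθ i v) = classProd θ' hθ' i (fun a => f (v a)) := by
  induction i with
  | zero => rw [classProd_zero, classProd_zero, LieCohomology.map_mk₀_id]
  | succ i ih => rw [classProd_succ, classProd_succ, LieCohomology.map_comp_ext, ih, hf]; rfl

lemma cohomology_eq_zero_of_subsingleton [Subsingleton g] {i : ℕ} (e : LieCohomology g (i + 1)) :
    e = 0 := by
  have : Subsingleton (Ext (regularModule g) (trivialModule g) (i + 1)) :=
    Ext.subsingleton_of_projective _ _ _
  obtain ⟨e', rfl⟩ := Ext.contravariant_sequence_exact₃ (augSeq_shortExact g) _ e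
    (this.elim _ _) (add_comm 1 i)
  have h1 : 𝟙 (augModule g) = 0 := by
    refine augModule_hom_ext fun x => ?_
    have : augι x = 0 := Subtype.ext (by
      change UniversalEnvelopingAlgebra.ι ℂ x = 0
      rw [Subsingleton.elim x 0, map_zero])
    rw [this, map_zero, map_zero]
  rw [← Ext.mk₀_id_comp e', h1, Ext.mk₀_zero, Ext.zero_comp, Ext.comp_zero]

lemma trivialModule_hom_eq (f : trivialModule g ⟶ trivialModule g) :
    f = (show ℂ from f.hom (show trivialModule g from (1 : ℂ))) • 𝟙 (trivialModule g) := by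
  apply ModuleCat.hom_ext
  refine LinearMap.ext fun (c : ℂ) => ?_
  change f.hom (show trivialModule g from c) =
    algebraMap ℂ (UniversalEnvelopingAlgebra ℂ g) (show ℂ from f.hom (show trivialModule g from (1 : ℂ))) •
      (show trivialModule g from c)
  have h1 : (show trivialModule g from c) = algebraMap ℂ (UniversalEnvelopingAlgebra ℂ g) c •
      (show trivialModule g from (1 : ℂ)) := by
    change c = enveloping.counit g (algebraMap ℂ _ c) * (1 : ℂ)
    rw [AlgHom.commutes, mul_one]
    rfl
  rw [h1, map_smul]
  change (enveloping.counit g _ * _ : ℂ) = enveloping.counit g _ * (enveloping.counit g _ * (1 : ℂ))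
  rw [AlgHom.commutes, AlgHom.commutes, mul_one, mul_comm]
  rfl

lemma exists_eq_smul_mk₀_id (e : LieCohomology g 0) :
    ∃ c : ℂ, e = c • Ext.mk₀ (𝟙 (trivialModule g)) := by
  obtain ⟨f, rfl⟩ := (Ext.mk₀_bijective _ _).2 e
  exact ⟨_, by rw [← Ext.mk₀_smul, ← trivialModule_hom_eq]⟩

lemma finrank_cohomology_zero : Module.finrank ℂ (LieCohomology g 0) = 1 := by
  refine finrank_eq_one (Ext.mk₀ (𝟙 (trivialModule g))) ?_ fun w => ?_
  · rw [Ne, Ext.mk₀_eq_zero_iff]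
    intro h0
    have := congrArg (fun f => (show ℂ from f.hom (show trivialModule g from (1 : ℂ)))) h0
    exact one_ne_zero (α := ℂ) this
  · obtain ⟨c, rfl⟩ := exists_eq_smul_mk₀_id w
    exact ⟨c, rfl⟩

instance : FiniteDimensional ℂ (LieCohomology g 0) :=
  FiniteDimensional.of_finrank_eq_succ finrank_cohomology_zero

end CohomologyProducts

/-! ### The cohomology of `L^{⊕ n}` with its action of `GL(V) × S_n`. -/

section FreeLieSumCohomology

open CategoryTheory CategoryTheory.Abelian

attribute [local instance 100] LieRing.ofAssociativeRing

variable {m n : ℕ}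

/-- The dual of `V = ℂ^m`. -/
local notation "W" => Module.Dual ℂ (Fin m → ℂ)

/-- The element of `L^{⊕ n}` with given components. -/
noncomputable def freeLieSumMk (x : Fin n → FreeLieAlgebra ℂ (Fin m)) : FreeLieSum m n :=
  (DirectSum.linearEquivFunOnFintype ℂ (Fin n) _).symm x

lemma freeLieSumMk_apply (x : Fin n → FreeLieAlgebra ℂ (Fin m)) (k : Fin n) :
    freeLieSumMk x k = x k := rfl

/-- The character of the free Lie algebra extending a linear form on `V`. -/
noncomputable def freeChar (f : W) : FreeLieAlgebra ℂ (Fin m) →ₗ⁅ℂ⁆ ℂ :=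
  FreeLieAlgebra.lift ℂ fun j => f (Pi.single j 1)

lemma freeChar_lie (f : W) (x y : FreeLieAlgebra ℂ (Fin m)) : freeChar f ⁅x, y⁆ = 0 := by
  rw [LieHom.map_lie, LieRing.of_associative_ring_bracket, mul_comm, sub_self]

lemma freeChar_of (f : W) (j : Fin m) :
    freeChar f (FreeLieAlgebra.of ℂ j) = f (Pi.single j 1) := by
  rw [freeChar, FreeLieAlgebra.lift_of_apply]

lemma freeChar_gen (f : W) (v : Fin m → ℂ) : freeChar f (freeLieGen m v) = f v := by
  have : (freeChar f : FreeLieAlgebra ℂ (Fin m) →ₗ[ℂ] ℂ) ∘ₗ freeLieGen m = f := by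
    ext j
    simp [freeLieGen, Fintype.linearCombination_apply_single, freeChar_of]
  exact LinearMap.congr_fun this v

lemma freeChar_add (f f' : W) (x : FreeLieAlgebra ℂ (Fin m)) :
    freeChar (f + f') x = freeChar f x + freeChar f' x := by
  let φ : FreeLieAlgebra ℂ (Fin m) →ₗ⁅ℂ⁆ ℂ :=
    { toLinearMap := (freeChar f : _ →ₗ[ℂ] ℂ) + (freeChar f' : _ →ₗ[ℂ] ℂ)
      map_lie' {x y} := by
        change freeChar f ⁅x, y⁆ + freeChar f' ⁅x, y⁆ = _
        rw [freeChar_lie, freeChar_lie, LieRing.of_associative_ring_bracket, mul_comm, sub_self,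
          add_zero] }
  have : freeChar (f + f') = φ := by
    ext j
    change _ = freeChar f (FreeLieAlgebra.of ℂ j) + freeChar f' (FreeLieAlgebra.of ℂ j)
    rw [freeChar_of, freeChar_of, freeChar_of, LinearMap.add_apply]
  rw [this]
  rfl

lemma freeChar_smul (c : ℂ) (f : W) (x : FreeLieAlgebra ℂ (Fin m)) :
    freeChar (c • f) x = c * freeChar f x := by
  let φ : FreeLieAlgebra ℂ (Fin m) →ₗ⁅ℂ⁆ ℂ :=
    { toLinearMap := c • (freeChar f : _ →ₗ[ℂ] ℂ)
      map_lie' {x y} := by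
        change c • freeChar f ⁅x, y⁆ = _
        rw [freeChar_lie, LieRing.of_associative_ring_bracket, mul_comm, sub_self, smul_zero] }
  have : freeChar (c • f) = φ := by
    ext j
    change _ = c • freeChar f (FreeLieAlgebra.of ℂ j)
    rw [freeChar_of, freeChar_of, LinearMap.smul_apply]
  rw [this]
  rfl

lemma freeChar_freeLieMap (f : W) (A : (Fin m → ℂ) →ₗ[ℂ] (Fin m → ℂ))
    (x : FreeLieAlgebra ℂ (Fin m)) : freeChar f (freeLieMap A x) = freeChar (f ∘ₗ A) x := by
  have : (freeChar f).comp (freeLieMap A) = freeChar (f ∘ₗ A) := by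
    ext j
    rw [LieHom.comp_apply, freeLieMap_of, freeChar_gen, freeChar_of, LinearMap.comp_apply]
  exact LieHom.congr_fun this x

/-- The character of `L^{⊕ n}` given by linear forms on the `n` copies of `V`. -/
noncomputable def sumChar (f : Fin n → W) : FreeLieSum m n →ₗ⁅ℂ⁆ ℂ where
  toFun x := ∑ k, freeChar (f k) (x k)
  map_add' x y := by
    simp only [DirectSum.add_apply, map_add, Finset.sum_add_distrib]
  map_smul' c x := by
    simp only [DirectSum.smul_apply, map_smul, Finset.smul_sum, RingHom.id_apply]
  map_lie' {x y} := by
    simp only [DirectSum.bracket_apply, freeChar_lie, Finset.sum_const_zero,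
      LieRing.of_associative_ring_bracket]
    rw [mul_comm, sub_self]

lemma sumChar_apply (f : Fin n → W) (x : FreeLieSum m n) :
    sumChar f x = ∑ k, freeChar (f k) (x k) := rfl

variable (m n) in
/-- The map `(V^*)^n → H^1(L^{⊕ n}, ℂ)`. -/
noncomputable def degreeOneClass : (Fin n → W) →ₗ[ℂ] LieCohomology (FreeLieSum m n) 1 where
  toFun f := charClass (sumChar f)
  map_add' f f' := charClass_add fun x => by
    simp only [sumChar_apply, Pi.add_apply, freeChar_add, Finset.sum_add_distrib]
  map_smul' c f := charClass_smul fun x => by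
    simp only [sumChar_apply, Pi.smul_apply, freeChar_smul, Finset.mul_sum]
    rfl

variable (m n) in
/-- The product map `(V^*)^n × ⋯ × (V^*)^n → H^i(L^{⊕ n}, ℂ)`. -/
noncomputable def sumProd (i : ℕ) :
    (Fin n → W) [⋀^Fin i]→ₗ[ℂ] LieCohomology (FreeLieSum m n) i :=
  classProd (degreeOneClass m n) (fun f => charClass_comp_self (sumChar f)) i

variable (m n) in
/-- The decomposition of `L^{⊕ (n + 1)}` as a product of `L^{⊕ n}` and the first summand. -/
noncomputable def freeLieSumSplitting :
    LieSplitting (FreeLieSum m (n + 1)) (FreeLieSum m n) (FreeLieAlgebra ℂ (Fin m)) where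
  fst :=
    { toFun x := freeLieSumMk fun k => x k.succ
      map_add' x y := by
        ext k
        simp only [freeLieSumMk_apply, DirectSum.add_apply]
      map_smul' c x := by
        ext k
        simp only [freeLieSumMk_apply, DirectSum.smul_apply, RingHom.id_apply]
      map_lie' {x y} := by
        ext k
        simp only [freeLieSumMk_apply, DirectSum.bracket_apply] }
  snd :=
    { toFun x := x 0
      map_add' x y := DirectSum.add_apply _ _ _
      map_smul' c x := DirectSum.smul_apply _ _ _
      map_lie' {x y} := DirectSum.bracket_apply _ _ _ _ }
  inl :=
    { toFun y := freeLieSumMk (Fin.cons 0 fun k => y k)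
      map_add' x y := by
        ext k
        refine Fin.cases ?_ (fun k => ?_) k <;>
          simp [freeLieSumMk_apply, DirectSum.add_apply]
      map_smul' c x := by
        ext k
        refine Fin.cases ?_ (fun k => ?_) k <;>
          simp [freeLieSumMk_apply, DirectSum.smul_apply]
      map_lie' {x y} := by
        ext k
        refine Fin.cases ?_ (fun k => ?_) k <;>
          simp [freeLieSumMk_apply, DirectSum.bracket_apply] }
  inr :=
    { toFun z := freeLieSumMk (Fin.cons z fun _ => 0)
      map_add' x y := by
        ext k
        refine Fin.cases ?_ (fun k => ?_) k <;>
          simp [freeLieSumMk_apply, DirectSum.add_apply]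
      map_smul' c x := by
        ext k
        refine Fin.cases ?_ (fun k => ?_) k <;>
          simp [freeLieSumMk_apply, DirectSum.smul_apply]
      map_lie' {x y} := by
        ext k
        refine Fin.cases ?_ (fun k => ?_) k <;>
          simp [freeLieSumMk_apply, DirectSum.bracket_apply] }
  fst_inl y := by
    ext k
    rfl
  snd_inl y := rfl
  fst_inr z := by
    ext k
    rfl
  snd_inr z := rfl
  decomp x := by
    ext k
    rw [DirectSum.add_apply]
    refine Fin.cases ?_ (fun k => ?_) k
    · exact zero_add _
    · exact add_zero _
  comm y z := by
    ext k
    rw [DirectSum.bracket_apply]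
    refine Fin.cases ?_ (fun k => ?_) k
    · exact zero_lie _
    · exact lie_zero _

lemma map_fst_degreeOneClass (f : Fin n → W) :
    LieCohomology.map (freeLieSumSplitting m n).fst 1 (degreeOneClass m n f) =
      degreeOneClass m (n + 1) (Fin.cons 0 f) := by
  refine (map_charClass _ _).trans (congrArg charClass (LieHom.ext fun x => ?_))
  rw [LieHom.comp_apply, sumChar_apply, sumChar_apply, Fin.sum_univ_succ]
  have : freeChar (0 : W) (x 0) = 0 := by
    rw [← zero_smul ℂ (0 : W), freeChar_smul, zero_mul]
  simp only [Fin.cons_zero, Fin.cons_succ, this, zero_add]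
  rfl

lemma map_fst_sumProd {i : ℕ} (v : Fin i → Fin n → W) :
    LieCohomology.map (freeLieSumSplitting m n).fst i (sumProd m n i v) =
      sumProd m (n + 1) i (fun a => Fin.cons 0 (v a)) :=
  map_classProd _ _ _ _ _ _ map_fst_degreeOneClass v

lemma dualClass_freeLieSumSplitting (j : Fin m) :
    (freeLieSumSplitting m n).dualClass j =
      degreeOneClass m (n + 1) (Pi.single 0 (LinearMap.proj j)) := by
  refine congrArg charClass (LieHom.ext fun x => ?_)
  rw [LieHom.comp_apply, sumChar_apply, Finset.sum_eq_single 0]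
  · rw [Pi.single_eq_same]
    change dualChar j (x 0) = _
    congr 1
    ext k
    rw [dualChar, FreeLieAlgebra.lift_of_apply, freeChar_of, LinearMap.proj_apply,
      Pi.single_comm]
  · intro k _ hk
    rw [Pi.single_eq_of_ne hk, ← zero_smul ℂ (0 : W), freeChar_smul, zero_mul]
  · simp

variable (m n) in
/-- The span of the products of classes from the summands `k 0 < k 1 < ⋯`. -/
noncomputable def monoSpan (i : ℕ) : Submodule ℂ (LieCohomology (FreeLieSum m n) i) :=
  Submodule.span ℂ {e | ∃ (k : Fin i → Fin n) (f : Fin i → W), StrictMono k ∧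
    e = sumProd m n i fun a => Pi.single (k a) (f a)}

lemma cons_zero_single (k : Fin n) (f : W) :
    (Fin.cons 0 (Pi.single k f : Fin n → W) : Fin (n + 1) → W) = Pi.single k.succ f := by
  funext l
  refine Fin.cases ?_ (fun l => ?_) l
  · rw [Fin.cons_zero, Pi.single_eq_of_ne (Fin.succ_ne_zero k).symm]
  · by_cases hl : l = k
    · subst hl; simp
    · rw [Fin.cons_succ, Pi.single_eq_of_ne hl, Pi.single_eq_of_ne (by simpa using hl)]

/-- Induction on the number of summands: the decomposition either pulls back a product from the
later summands, or multiplies one by a class of the first summand. -/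
lemma monoSpan_eq_top (i : ℕ) : monoSpan m n i = ⊤ := by
  induction n generalizing i with
  | zero =>
    cases i with
    | zero =>
      refine eq_top_iff.2 fun e _ => ?_
      obtain ⟨c, rfl⟩ := exists_eq_smul_mk₀_id e
      refine Submodule.smul_mem _ _ (Submodule.subset_span ⟨Fin.elim0, Fin.elim0, ?_, ?_⟩)
      · intro a; exact a.elim0
      · exact (classProd_zero _ _ _).symm
    | succ i =>
      have : Subsingleton (FreeLieSum m 0) := ⟨fun x y => by ext k; exact k.elim0⟩
      refine eq_top_iff.2 fun e _ => ?_
      rw [cohomology_eq_zero_of_subsingleton e]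
      exact Submodule.zero_mem _
  | succ n ih =>
    cases i with
    | zero =>
      refine eq_top_iff.2 fun e _ => ?_
      obtain ⟨c, rfl⟩ := exists_eq_smul_mk₀_id e
      refine Submodule.smul_mem _ _ (Submodule.subset_span ⟨Fin.elim0, Fin.elim0, ?_, ?_⟩)
      · intro a; exact a.elim0
      · exact (classProd_zero _ _ _).symm
    | succ i =>
      refine eq_top_iff.2 fun e _ => ?_
      obtain ⟨a, b, rfl⟩ := (freeLieSumSplitting m n).exists_decomposition e
      refine Submodule.add_mem _ ?_ (Submodule.sum_mem _ fun j _ => ?_)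
      · clear * - ih
        have ha : a ∈ monoSpan m n (i + 1) := ih (i + 1) ▸ Submodule.mem_top
        induction ha using Submodule.span_induction with
        | zero => rw [map_zero]; exact Submodule.zero_mem _
        | add x y _ _ hx hy => rw [map_add]; exact Submodule.add_mem _ hx hy
        | smul c x _ hx => rw [map_smul]; exact Submodule.smul_mem _ _ hx
        | mem x hx =>
          obtain ⟨k, f, hk, rfl⟩ := hx
          refine Submodule.subset_span ⟨fun a => (k a).succ, f,
            fun a b hab => Fin.succ_lt_succ_iff.2 (hk hab), ?_⟩
          rw [map_fst_sumProd]
          simp only [cons_zero_single]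
      · have hb : b j ∈ monoSpan m n i := ih i ▸ Submodule.mem_top
        generalize b j = x at hb
        induction hb using Submodule.span_induction with
        | zero => rw [map_zero, Ext.comp_zero]; exact Submodule.zero_mem _
        | add x y _ _ hx hy => rw [map_add, Ext.comp_add]; exact Submodule.add_mem _ hx hy
        | smul c x _ hx => rw [map_smul, Ext.comp_smul]; exact Submodule.smul_mem _ _ hx
        | mem x hx =>
          obtain ⟨k, f, hk, rfl⟩ := hx
          -- The split-off summand has index `0` and its class is placed first, so the sequence of
          -- indices stays increasing.
          refine Submodule.subset_span ⟨Fin.cons 0 fun a => (k a).succ,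
            Fin.cons (LinearMap.proj j) f, ?_, ?_⟩
          · intro a b
            refine Fin.cases ?_ (fun a => ?_) a <;> refine Fin.cases ?_ (fun b => ?_) b
            · simp
            · simp [Fin.succ_pos]
            · simp
            · intro hab
              simpa using hk (Fin.succ_lt_succ_iff.1 hab)
          · rw [map_fst_sumProd, dualClass_freeLieSumSplitting]
            refine Eq.trans ?_ (classProd_succ _ _ _).symm
            congr 1
            refine congrArg (sumProd m (n + 1) i) (funext fun a => ?_)
            rw [cons_zero_single]
            rfl

/-- The Künneth decomposition turns into Pascal's rule for the binomial coefficients. -/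
lemma finrank_cohomology (i : ℕ) : FiniteDimensional ℂ (LieCohomology (FreeLieSum m n) i) ∧
    Module.finrank ℂ (LieCohomology (FreeLieSum m n) i) = n.choose i * m ^ i := by
  induction n generalizing i with
  | zero =>
    cases i with
    | zero => exact ⟨inferInstance, by rw [finrank_cohomology_zero]; simp⟩
    | succ i =>
      have : Subsingleton (FreeLieSum m 0) := ⟨fun x y => by ext k; exact k.elim0⟩
      have : Subsingleton (LieCohomology (FreeLieSum m 0) (i + 1)) :=
        ⟨fun x y => (cohomology_eq_zero_of_subsingleton x).trans
          (cohomology_eq_zero_of_subsingleton y).symm⟩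
      exact ⟨inferInstance, by rw [Module.finrank_zero_of_subsingleton]; simp⟩
  | succ n ih =>
    cases i with
    | zero => exact ⟨inferInstance, by rw [finrank_cohomology_zero]; simp⟩
    | succ i =>
      have := (ih i).1
      have := (ih (i + 1)).1
      have e := (freeLieSumSplitting m n).cohomologyEquiv i
      refine ⟨e.finiteDimensional, ?_⟩
      rw [← e.finrank_eq, Module.finrank_prod, Module.finrank_pi_fintype, (ih _).2, Finset.sum_const,
        (ih _).2, Finset.card_univ, Fintype.card_fin, smul_eq_mul, Nat.choose_succ_succ]
      ring

/-- The map `(V^*)^{⊗ i} → H^i(L^{⊕ n}, ℂ)`: the product of classes from the summands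
`k 0, k 1, …`. -/
noncomputable def tensorClass {i : ℕ} (k : Fin i → Fin n) :
    (PiTensorProduct ℂ fun _ : Fin i => W) →ₗ[ℂ] LieCohomology (FreeLieSum m n) i :=
  PiTensorProduct.lift ((sumProd m n i).toMultilinearMap.compLinearMap
    fun a => LinearMap.single ℂ (fun _ => W) (k a))

lemma tensorClass_tprod {i : ℕ} (k : Fin i → Fin n) (f : Fin i → W) :
    tensorClass k (PiTensorProduct.tprod ℂ f) = sumProd m n i fun a => Pi.single (k a) (f a) := by
  simp [tensorClass]

/-- Anticommutativity of degree one classes. This sign is the reason why the multiplicity space of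
the Schur functor of `μ'` involves the Specht module of `μ`. -/
lemma tensorClass_perm {i : ℕ} (k : Fin i → Fin n) (τ : Equiv.Perm (Fin i))
    (u : PiTensorProduct ℂ fun _ : Fin i => W) :
    tensorClass k (tensorPermRep W i τ u) =
      ((Equiv.Perm.sign τ : ℤ) : ℂ) • tensorClass (k ∘ τ) u := by
  induction u using PiTensorProduct.induction_on with
  | add x y hx hy => rw [map_add, map_add, hx, hy, map_add, smul_add]
  | smul_tprod c f =>
    rw [map_smul, map_smul, map_smul, smul_comm]
    congr 1
    change tensorClass k (PiTensorProduct.reindex ℂ (fun _ => W) τ (PiTensorProduct.tprod ℂ f)) = _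
    rw [PiTensorProduct.reindex_tprod, tensorClass_tprod, tensorClass_tprod]
    have h1 := (sumProd m n i).map_perm
      (fun a => (Pi.single (k (τ a)) (f a) : Fin n → W)) τ⁻¹
    have h2 : (fun a => (Pi.single (k (τ a)) (f a) : Fin n → W)) ∘ (τ⁻¹ : Equiv.Perm (Fin i)) =
        fun a => Pi.single (k a) (f (τ.symm a)) := by
      funext a
      change (Pi.single (k (τ (τ.symm a))) (f (τ.symm a)) : Fin n → W) = _
      rw [Equiv.apply_symm_apply]
    rw [h2, Equiv.Perm.sign_inv] at h1
    rw [h1, Units.smul_def, ← Int.cast_smul_eq_zsmul ℂ]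
    rfl

lemma cohomologyRep_degreeOneClass (a : GLV m × Equiv.Perm (Fin n)) (f : Fin n → W) :
    LieCohomology.map (freeLieSumAct a⁻¹) 1 (degreeOneClass m n f) =
      degreeOneClass m n fun k => (standardRep m).dual a.1 (f (a.2⁻¹ k)) := by
  refine (map_charClass _ _).trans (congrArg charClass (LieHom.ext fun x => ?_))
  rw [LieHom.comp_apply, sumChar_apply, sumChar_apply,
    ← Equiv.sum_comp a.2 (fun k => freeChar _ (x k))]
  refine Finset.sum_congr rfl fun k _ => ?_
  rw [freeLieSumAct_apply, freeChar_freeLieMap,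
    show a.2⁻¹ (a.2 k) = k from a.2.symm_apply_apply k, Prod.snd_inv, inv_inv]
  rfl

lemma map_freeLieSumAct_sumProd {i : ℕ} (a : GLV m × Equiv.Perm (Fin n))
    (v : Fin i → Fin n → W) :
    LieCohomology.map (freeLieSumAct a⁻¹) i (sumProd m n i v) =
      sumProd m n i fun b k => (standardRep m).dual a.1 (v b (a.2⁻¹ k)) :=
  map_classProd (freeLieSumAct a⁻¹) (degreeOneClass m n) _ (degreeOneClass m n) _
    (fun f k => (standardRep m).dual a.1 (f (a.2⁻¹ k))) (cohomologyRep_degreeOneClass a) v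

/-- The two groups act separately: `GL(V)` only on the tensor and `S_n` only on the labels of the
summands. -/
lemma cohomologyRep_tensorClass {i : ℕ} (a : GLV m × Equiv.Perm (Fin n)) (k : Fin i → Fin n)
    (u : PiTensorProduct ℂ fun _ : Fin i => W) :
    cohomologyRep m n i a (tensorClass k u) =
      tensorClass (a.2 ∘ k) (tensorPowerRep (standardRep m).dual i a.1 u) := by
  induction u using PiTensorProduct.induction_on with
  | add x y hx hy => simp only [map_add, hx, hy]
  | smul_tprod c f =>
    simp only [map_smul]
    congr 1
    change LieCohomology.map (freeLieSumAct a⁻¹) i _ =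
      tensorClass _ (PiTensorProduct.map _ (PiTensorProduct.tprod ℂ f))
    rw [PiTensorProduct.map_tprod, tensorClass_tprod, tensorClass_tprod]
    refine (map_freeLieSumAct_sumProd a _).trans ?_
    refine congrArg (sumProd m n i) (funext fun b => funext fun l => ?_)
    by_cases hl : l = a.2 (k b)
    · subst hl
      simp
    · rw [Function.comp_apply, Pi.single_eq_of_ne hl, Pi.single_eq_of_ne, map_zero]
      exact fun h => hl (Equiv.Perm.inv_eq_iff_eq.1 h)

variable (m n) in
/-- The sum over all subsets `s` of size `i` of the maps `(V^*)^{⊗ i} → H^i(L^{⊕ n}, ℂ)`. -/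
noncomputable def subsetClass (i : ℕ) :
    ({s : Finset (Fin n) // s.card = i} → PiTensorProduct ℂ fun _ : Fin i => W) →ₗ[ℂ]
      LieCohomology (FreeLieSum m n) i :=
  ∑ s, tensorClass (s.1.orderEmbOfFin s.2) ∘ₗ LinearMap.proj s

lemma subsetClass_apply {i : ℕ}
    (u : {s : Finset (Fin n) // s.card = i} → PiTensorProduct ℂ fun _ : Fin i => W) :
    subsetClass m n i u = ∑ s, tensorClass (s.1.orderEmbOfFin s.2) (u s) := by
  simp [subsetClass]

lemma finrank_tensorPower (i : ℕ) :
    Module.finrank ℂ (PiTensorProduct ℂ fun _ : Fin i => W) = m ^ i := by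
  rw [Module.finrank_eq_card_basis (Basis.piTensorProduct fun _ : Fin i =>
    (Pi.basisFun ℂ (Fin m)).dualBasis)]
  simp

/-- Increasing sequences of indices enumerate the subsets of size `i`, so the products already known
to span give surjectivity. Injectivity follows because both sides have dimension `n.choose i * m ^
i`. -/
lemma subsetClass_bijective (i : ℕ) : Function.Bijective (subsetClass m n i) := by
  have hsurj : Function.Surjective (subsetClass m n i) := by
    rw [← LinearMap.range_eq_top, eq_top_iff, ← monoSpan_eq_top, monoSpan, Submodule.span_le]
    rintro _ ⟨k, f, hk, rfl⟩
    let s : {s : Finset (Fin n) // s.card = i} :=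
      ⟨Finset.univ.image k, by rw [Finset.card_image_of_injective _ hk.injective]; simp⟩
    refine ⟨Pi.single s (PiTensorProduct.tprod ℂ f), ?_⟩
    rw [subsetClass_apply, Finset.sum_eq_single s]
    · rw [Pi.single_eq_same, ← Finset.orderEmbOfFin_unique s.2 (f := k) (by simp [s]) hk,
        tensorClass_tprod]
    · intro t _ ht
      rw [Pi.single_eq_of_ne ht, map_zero]
    · simp
  have hf : Module.Finite ℂ (PiTensorProduct ℂ fun _ : Fin i => W) :=
    Module.Finite.of_basis (Basis.piTensorProduct fun _ : Fin i =>
      (Pi.basisFun ℂ (Fin m)).dualBasis)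
  have := (finrank_cohomology (m := m) (n := n) i).1
  refine ⟨(LinearMap.injective_iff_surjective_of_finrank_eq_finrank ?_).2 hsurj, hsurj⟩
  rw [Module.finrank_pi_fintype, finrank_cohomology i |>.2, Finset.sum_const, finrank_tensorPower,
    Finset.card_univ, Fintype.card_finset_len, Fintype.card_fin, smul_eq_mul]

end FreeLieSumCohomology

/-! ### Primitive idempotents in group algebras. -/

section GroupAlgebra

open scoped MonoidAlgebra

variable {G : Type} [Group G]

variable (G) in
/-- The coefficient of the identity element. -/
noncomputable def coeffOne : ℂ[G] →ₗ[ℂ] ℂ where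
  toFun z := z.coeff 1
  map_add' _ _ := rfl
  map_smul' _ _ := rfl

lemma coeffOne_single [DecidableEq G] (g : G) (a : ℂ) :
    coeffOne G (MonoidAlgebra.single g a) = if g = 1 then a else 0 :=
  Finsupp.single_apply

lemma coeffOne_mul_comm (x y : ℂ[G]) : coeffOne G (x * y) = coeffOne G (y * x) := by
  classical
  induction x using MonoidAlgebra.induction_linear with
  | zero => simp
  | add x x' hx hx' => rw [add_mul, map_add, hx, hx', mul_add, map_add]
  | single g a =>
    induction y using MonoidAlgebra.induction_linear with
    | zero => simp
    | add x x' hx hx' => rw [mul_add, map_add, hx, hx', add_mul, map_add]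
    | single h b =>
      rw [MonoidAlgebra.single_mul_single, MonoidAlgebra.single_mul_single, coeffOne_single,
        coeffOne_single, mul_comm b a]
      exact if_congr mul_eq_one_comm rfl rfl

lemma coeffOne_single_mul (g : G) (z : ℂ[G]) :
    coeffOne G (MonoidAlgebra.single g 1 * z) = z.coeff g⁻¹ := by
  classical
  induction z using MonoidAlgebra.induction_linear with
  | zero => simp
  | add x y hx hy => rw [mul_add, map_add, hx, hy]; rfl
  | single h a =>
    rw [MonoidAlgebra.single_mul_single, coeffOne_single, one_mul, MonoidAlgebra.coeff_single, Finsupp.single_apply,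
      mul_eq_one_iff_eq_inv']

lemma eq_zero_of_coeffOne_mul {z : ℂ[G]} (h : ∀ y, coeffOne G (y * z) = 0) : z = 0 := by
  ext g
  have := h (MonoidAlgebra.single g⁻¹ 1)
  rwa [coeffOne_single_mul, inv_inv] at this

/-- Every diagonal entry is the same: the coefficient of `g` in `z g` is the coefficient of the
identity in `z`. -/
lemma trace_mulLeft_groupAlgebra [Fintype G] (z : ℂ[G]) :
    LinearMap.trace ℂ ℂ[G] (LinearMap.mulLeft ℂ z) = Fintype.card G * coeffOne G z := by
  classical
  rw [LinearMap.trace_eq_matrix_trace ℂ (MonoidAlgebra.basis G ℂ), Matrix.trace]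
  have key (g : G) : (LinearMap.toMatrix (MonoidAlgebra.basis G ℂ) (MonoidAlgebra.basis G ℂ)
      (LinearMap.mulLeft ℂ z)).diag g = coeffOne G z := by
    rw [Matrix.diag_apply, LinearMap.toMatrix_apply, MonoidAlgebra.basis_apply,
      LinearMap.mulLeft_apply]
    change (z * MonoidAlgebra.single g 1).coeff g = _
    have h := coeffOne_single_mul g⁻¹ (z * MonoidAlgebra.single g 1)
    rw [inv_inv] at h
    rw [← h, coeffOne_mul_comm, mul_assoc, MonoidAlgebra.single_mul_single, mul_inv_cancel, one_mul,
      ← MonoidAlgebra.one_def, mul_one]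
  rw [Finset.sum_congr rfl fun g _ => key g, Finset.sum_const, nsmul_eq_mul, Finset.card_univ]

/-- A scalar multiple `c` of a primitive idempotent of a group algebra, normalized so that the
coefficient of the identity is `1`; then `c * c = κ • c`. -/
structure IsPrimitiveMultiple (c : ℂ[G]) (κ : ℂ) : Prop where
  ne_zero : κ ≠ 0
  coeffOne_eq : coeffOne G c = 1
  mul_mul (z : ℂ[G]) : c * z * c = (κ * coeffOne G (z * c)) • c

lemma IsPrimitiveMultiple.mul_self {c : ℂ[G]} {κ : ℂ} (hc : IsPrimitiveMultiple c κ) :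
    c * c = κ • c := by
  have := hc.mul_mul 1
  rwa [mul_one, one_mul, hc.coeffOne_eq, mul_one] at this

/-- If `κ` were zero, `c` would square to zero and left multiplication by it would have trace zero;
but that trace is the order of `G`. The scalar in `c z c` is then identified by comparing
coefficients of the identity. -/
lemma exists_isPrimitiveMultiple [Fintype G] {c : ℂ[G]} (h1 : coeffOne G c = 1)
    (h : ∀ z, ∃ s : ℂ, c * z * c = s • c) : ∃ κ, IsPrimitiveMultiple c κ := by
  obtain ⟨κ, hκ⟩ := h 1
  rw [mul_one] at hκ
  refine ⟨κ, ?_, h1, fun z => ?_⟩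
  · rintro rfl
    have : IsNilpotent (LinearMap.mulLeft ℂ c) := by
      refine ⟨2, ?_⟩
      rw [pow_two, Module.End.mul_eq_comp, ← LinearMap.mulLeft_mul, hκ, zero_smul]
      exact LinearMap.mulLeft_zero_eq_zero _ _
    have := (LinearMap.isNilpotent_trace_of_isNilpotent this).eq_zero
    rw [trace_mulLeft_groupAlgebra, h1, mul_one, Nat.cast_eq_zero] at this
    exact Fintype.card_ne_zero this
  · obtain ⟨s, hs⟩ := h z
    have h2 := congrArg (coeffOne G) hs
    rw [map_smul, h1, coeffOne_mul_comm, ← mul_assoc, hκ, smul_mul_assoc, map_smul, smul_eq_mul,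
      smul_eq_mul, mul_one, coeffOne_mul_comm] at h2
    rw [hs, ← h2]

variable {R C : Subgroup G} [DecidablePred (· ∈ R)] [DecidablePred (· ∈ C)] [Fintype G]

variable (R) in
/-- The sum of the elements of a subgroup, weighted by a character. -/
noncomputable def charSum (χ : G →* ℤˣ) : ℂ[G] :=
  ∑ g : G with g ∈ R, MonoidAlgebra.single g ((χ g : ℤ) : ℂ)

lemma single_mul_charSum (χ : G →* ℤˣ) {r : G} (hr : r ∈ R) :
    MonoidAlgebra.single r 1 * charSum R χ = ((χ r : ℤ) : ℂ) • charSum R χ := by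
  rw [charSum, Finset.mul_sum, Finset.smul_sum]
  refine Finset.sum_nbij' (fun g => r * g) (fun g => r⁻¹ * g) ?_ ?_ ?_ ?_ ?_
  · simp [R.mul_mem_cancel_left hr]
  · simp [R.mul_mem_cancel_left (R.inv_mem hr)]
  · simp
  · simp
  · intro g _
    rw [MonoidAlgebra.single_mul_single, MonoidAlgebra.smul_single, one_mul, map_mul, smul_eq_mul,
      ← Int.cast_mul, ← Units.val_mul, ← mul_assoc, Int.units_mul_self, one_mul]

lemma charSum_mul_single (χ : G →* ℤˣ) {r : G} (hr : r ∈ R) :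
    charSum R χ * MonoidAlgebra.single r 1 = ((χ r : ℤ) : ℂ) • charSum R χ := by
  rw [charSum, Finset.sum_mul, Finset.smul_sum]
  refine Finset.sum_nbij' (fun g => g * r) (fun g => g * r⁻¹) ?_ ?_ ?_ ?_ ?_
  · simp [R.mul_mem_cancel_right hr]
  · simp [R.mul_mem_cancel_right (R.inv_mem hr)]
  · simp
  · simp
  · intro g _
    rw [MonoidAlgebra.single_mul_single, MonoidAlgebra.smul_single, mul_one, map_mul, smul_eq_mul,
      ← Int.cast_mul, ← Units.val_mul, mul_comm (χ g), ← mul_assoc, Int.units_mul_self, one_mul]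

/-- A product of an element of `R` and one of `C` is trivial only if both lie in the intersection,
so a single pair contributes. -/
lemma coeffOne_charSum_mul (χ χ' : G →* ℤˣ) (hRC : ∀ g ∈ R, g ∈ C → g = 1) :
    coeffOne G (charSum R χ * charSum C χ') = 1 := by
  classical
  rw [charSum, charSum, Finset.sum_mul_sum, map_sum, Finset.sum_eq_single 1]
  · rw [map_sum, Finset.sum_eq_single 1]
    · simp [MonoidAlgebra.single_mul_single, coeffOne_single]
    · intro q hq h1
      rw [MonoidAlgebra.single_mul_single, coeffOne_single, one_mul, if_neg h1]
    · simp [C.one_mem]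
  · intro r hr h1
    rw [map_sum]
    refine Finset.sum_eq_zero fun q hq => ?_
    rw [MonoidAlgebra.single_mul_single, coeffOne_single, if_neg]
    intro h
    rw [Finset.mem_filter] at hr hq
    refine h1 (hRC r hr.2 ?_)
    rw [eq_inv_of_mul_eq_one_left h]
    exact C.inv_mem hq.2
  · simp [R.one_mem]

/-- For `g = r q` the two factors are absorbed by the character sums. Otherwise `t g = g (g⁻¹ t g)`
lets `t` be absorbed on either side with two different signs, which forces the product to vanish. -/
lemma exists_charSum_mul_mul (χ χ' : G →* ℤˣ)
    (h : ∀ g, (∃ r ∈ R, ∃ q ∈ C, g = r * q) ∨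
      ∃ t ∈ R, g⁻¹ * t * g ∈ C ∧ χ t ≠ χ' (g⁻¹ * t * g)) (z : ℂ[G]) :
    ∃ s : ℂ, charSum R χ * z * charSum C χ' = s • (charSum R χ * charSum C χ') := by
  induction z using MonoidAlgebra.induction_linear with
  | zero => exact ⟨0, by simp⟩
  | add x y hx hy =>
    obtain ⟨s, hs⟩ := hx
    obtain ⟨t, ht⟩ := hy
    exact ⟨s + t, by rw [mul_add, add_mul, hs, ht, add_smul]⟩
  | single g a =>
    have ha : MonoidAlgebra.single g a = a • MonoidAlgebra.single g (1 : ℂ) := by simp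
    suffices ∃ s : ℂ, charSum R χ * MonoidAlgebra.single g 1 * charSum C χ' =
        s • (charSum R χ * charSum C χ') by
      obtain ⟨s, hs⟩ := this
      exact ⟨a * s, by rw [ha, mul_smul_comm, smul_mul_assoc, hs, smul_smul]⟩
    obtain ⟨r, hr, q, hq, rfl⟩ | ⟨t, ht, ht', hne⟩ := h g
    · refine ⟨((χ r : ℤ) : ℂ) * ((χ' q : ℤ) : ℂ), ?_⟩
      rw [show MonoidAlgebra.single (r * q) (1 : ℂ) =
        MonoidAlgebra.single r 1 * MonoidAlgebra.single q 1 by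
          rw [MonoidAlgebra.single_mul_single, one_mul], ← mul_assoc, charSum_mul_single χ hr,
        mul_assoc, single_mul_charSum χ' hq, smul_mul_assoc, mul_smul_comm, smul_smul]
    · refine ⟨0, ?_⟩
      rw [zero_smul]
      have h1 : (MonoidAlgebra.single t 1 * MonoidAlgebra.single g 1 : ℂ[G]) =
          MonoidAlgebra.single g 1 * MonoidAlgebra.single (g⁻¹ * t * g) 1 := by
        rw [MonoidAlgebra.single_mul_single, MonoidAlgebra.single_mul_single]
        congr 1
        group
      have h2 : ((χ t : ℤ) : ℂ) • (charSum R χ * MonoidAlgebra.single g 1 * charSum C χ') =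
          ((χ' (g⁻¹ * t * g) : ℤ) : ℂ) •
            (charSum R χ * MonoidAlgebra.single g 1 * charSum C χ') := by
        rw [← smul_mul_assoc, ← smul_mul_assoc, ← charSum_mul_single χ ht, mul_assoc (charSum R χ),
          h1, ← mul_assoc, mul_assoc, single_mul_charSum χ' ht', mul_smul_comm]
      rw [← sub_eq_zero, ← sub_smul, smul_eq_zero, sub_eq_zero] at h2
      refine h2.resolve_left fun h3 => hne (Units.ext ?_)
      exact_mod_cast h3

end GroupAlgebra

/-! ### Young symmetrizers are multiples of primitive idempotents. -/

section YoungSymmetrizer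

open scoped MonoidAlgebra

variable {d : ℕ} {lam : YoungDiagram}

/-- The permutations preserving the rows of a filling. -/
def rowStabilizer (T : lam.cells ≃ Fin d) : Subgroup (Equiv.Perm (Fin d)) where
  carrier := {σ | ∀ x, (T.symm (σ x)).1.1 = (T.symm x).1.1}
  one_mem' _ := rfl
  mul_mem' {σ τ} hσ hτ x := (hσ (τ x)).trans (hτ x)
  inv_mem' {σ} hσ x := by
    have := hσ (σ⁻¹ x)
    rw [← Equiv.Perm.mul_apply, mul_inv_cancel] at this
    exact this.symm

/-- The permutations preserving the columns of a filling. -/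
def colStabilizer (T : lam.cells ≃ Fin d) : Subgroup (Equiv.Perm (Fin d)) where
  carrier := {σ | ∀ x, (T.symm (σ x)).1.2 = (T.symm x).1.2}
  one_mem' _ := rfl
  mul_mem' {σ τ} hσ hτ x := (hσ (τ x)).trans (hτ x)
  inv_mem' {σ} hσ x := by
    have := hσ (σ⁻¹ x)
    rw [← Equiv.Perm.mul_apply, mul_inv_cancel] at this
    exact this.symm

variable (T : lam.cells ≃ Fin d)

lemma mem_rowStabilizer {σ : Equiv.Perm (Fin d)} :
    σ ∈ rowStabilizer T ↔ ∀ x, (T.symm (σ x)).1.1 = (T.symm x).1.1 := Iff.rfl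

lemma mem_colStabilizer {σ : Equiv.Perm (Fin d)} :
    σ ∈ colStabilizer T ↔ ∀ x, (T.symm (σ x)).1.2 = (T.symm x).1.2 := Iff.rfl

noncomputable instance : DecidablePred (· ∈ rowStabilizer T) := Classical.decPred _

noncomputable instance : DecidablePred (· ∈ colStabilizer T) := Classical.decPred _

lemma rowSymmetrizer_eq : rowSymmetrizer T = charSum (rowStabilizer T) 1 := by
  refine Finset.sum_congr ?_ fun σ _ => by simp
  ext σ
  simp [mem_rowStabilizer]

lemma colAntisymmetrizer_eq :
    colAntisymmetrizer T = charSum (colStabilizer T) Equiv.Perm.sign := by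
  refine Finset.sum_congr ?_ fun σ _ => rfl
  ext σ
  simp [mem_colStabilizer]

lemma eq_one_of_mem_stabilizers {σ : Equiv.Perm (Fin d)} (h1 : σ ∈ rowStabilizer T)
    (h2 : σ ∈ colStabilizer T) : σ = 1 := by
  ext1 x
  exact T.symm.injective (Subtype.ext (Prod.ext (h1 x) (h2 x)))

/-- If `g⁻¹` maps elements in a common row of `T` to distinct columns, then it maps the elements
of a row to columns which meet this row. -/
lemma col_lt_rowLen (g : Equiv.Perm (Fin d))
    (hg : ∀ x y, (T.symm x).1.1 = (T.symm y).1.1 →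
      (T.symm (g⁻¹ x)).1.2 = (T.symm (g⁻¹ y)).1.2 → x = y) (y : Fin d) :
    (T.symm (g⁻¹ y)).1.2 < lam.rowLen (T.symm y).1.1 := by
  set row : Fin d → ℕ := fun x => (T.symm x).1.1 with hrow
  set col : Fin d → ℕ := fun x => (T.symm x).1.2 with hcol
  have hlt (x : Fin d) : col x < lam.rowLen (row x) :=
    YoungDiagram.mem_iff_lt_rowLen.1 ((YoungDiagram.mem_cells _).1 (T.symm x).2)
  set c := lam.rowLen (row y) with hc
  -- In each row, `N` counts the elements that `g⁻¹` sends to one of the first `c` columns and `M`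
  -- those lying there already. Distinctness of the columns gives `|N r| ≤ |M r|`, while both counts
  -- have the same total, so equality holds in every row. In the row of `y`, which has length `c`,
  -- `M` is the whole row, and hence so is `N`.
  let N (r : ℕ) : Finset (Fin d) := {x | row x = r ∧ col (g⁻¹ x) < c}
  let M (r : ℕ) : Finset (Fin d) := {x | row x = r ∧ col x < c}
  have hle (r : ℕ) : (N r).card ≤ (M r).card := by
    rcases le_total c (lam.rowLen r) with h | h
    · have h1 : (N r).card ≤ c := by
        rw [← Finset.card_range c]
        refine Finset.card_le_card_of_injOn (fun x => col (g⁻¹ x)) (fun x hx => ?_)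
          fun x hx z hz hxz => ?_
        · simpa using (Finset.mem_filter.1 hx).2.2
        · exact hg x z ((Finset.mem_filter.1 hx).2.1.trans (Finset.mem_filter.1 hz).2.1.symm) hxz
      have h2 : c ≤ (M r).card := by
        rw [← Finset.card_range c]
        have hmem (j : ℕ) (hj : j < c) : (r, j) ∈ lam.cells :=
          (YoungDiagram.mem_cells _).2 (YoungDiagram.mem_iff_lt_rowLen.2 (hj.trans_le h))
        refine Finset.card_le_card_of_surjOn col ?_
        intro j hj
        have hj := Finset.mem_range.1 hj
        refine ⟨T ⟨(r, j), hmem j hj⟩, ?_, ?_⟩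
        · simp [M, hrow, hcol, hj]
        · simp [hcol]
      exact h1.trans h2
    · refine Finset.card_le_card fun x hx => ?_
      have hx := (Finset.mem_filter.1 hx).2
      refine Finset.mem_filter.2 ⟨Finset.mem_univ _, hx.1, ?_⟩
      have := hlt x
      rw [hx.1] at this
      exact this.trans_le h
  let s : Finset ℕ := Finset.univ.image row
  have hN : ∑ r ∈ s, (N r).card = (Finset.univ.filter fun x => col (g⁻¹ x) < c).card := by
    rw [Finset.card_eq_sum_card_fiberwise (f := row) (t := s) (fun x _ => by simp [s])]
    refine Finset.sum_congr rfl fun r _ => ?_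
    rw [Finset.filter_filter]
    simp only [N, and_comm]
  have hM : ∑ r ∈ s, (M r).card = (Finset.univ.filter fun x => col x < c).card := by
    rw [Finset.card_eq_sum_card_fiberwise (f := row) (t := s) (fun x _ => by simp [s])]
    refine Finset.sum_congr rfl fun r _ => ?_
    rw [Finset.filter_filter]
    simp only [M, and_comm]
  have hNM : (Finset.univ.filter fun x => col (g⁻¹ x) < c).card =
      (Finset.univ.filter fun x => col x < c).card :=
    Finset.card_equiv g⁻¹ fun x => by simp
  have heq := (Finset.sum_eq_sum_iff_of_le fun r _ => hle r).1 (hN.trans (hNM.trans hM.symm))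
    (row y) (by simp [s])
  have hMy : M (row y) = Finset.univ.filter fun x => row x = row y := by
    ext x
    simp only [M, Finset.mem_filter, Finset.mem_univ, true_and, and_iff_left_iff_imp]
    intro hx
    rw [hc, ← hx]
    exact hlt x
  have hsub : N (row y) ⊆ M (row y) := by
    rw [hMy]
    intro x hx
    exact Finset.mem_filter.2 ⟨Finset.mem_univ _, (Finset.mem_filter.1 hx).2.1⟩
  have hy : y ∈ N (row y) := by
    rw [Finset.eq_of_subset_of_card_le hsub heq.ge, hMy]
    simp
  exact (Finset.mem_filter.1 hy).2.2

/-- If `g⁻¹` separates the columns within each row, moving `y` along its row to the column of `g⁻¹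
y` is a row permutation `r` with `r g` preserving columns. Otherwise two elements of a row land in a
common column, and their transposition has sign `-1`. -/
lemma row_col_dichotomy (g : Equiv.Perm (Fin d)) :
    (∃ r ∈ rowStabilizer T, ∃ q ∈ colStabilizer T, g = r * q) ∨
      ∃ t ∈ rowStabilizer T, g⁻¹ * t * g ∈ colStabilizer T ∧
        (1 : Equiv.Perm (Fin d) →* ℤˣ) t ≠ Equiv.Perm.sign (g⁻¹ * t * g) := by
  by_cases hg : ∀ x y, (T.symm x).1.1 = (T.symm y).1.1 →
      (T.symm (g⁻¹ x)).1.2 = (T.symm (g⁻¹ y)).1.2 → x = y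
  · left
    have hmem (y : Fin d) : ((T.symm y).1.1, (T.symm (g⁻¹ y)).1.2) ∈ lam.cells :=
      (YoungDiagram.mem_cells _).2 (YoungDiagram.mem_iff_lt_rowLen.2 (col_lt_rowLen T g hg y))
    let f : Fin d → Fin d := fun y => T ⟨_, hmem y⟩
    have hf : Function.Injective f := fun x y h => by
      have := congrArg Subtype.val (T.injective h)
      exact hg x y (Prod.ext_iff.1 this).1 (Prod.ext_iff.1 this).2
    let r := Equiv.ofBijective f (Finite.injective_iff_bijective.1 hf)
    have hr : r ∈ rowStabilizer T := fun x => by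
      change (T.symm (T _)).1.1 = _
      rw [Equiv.symm_apply_apply]
    refine ⟨r⁻¹, inv_mem hr, r * g, fun x => ?_, by group⟩
    change (T.symm (T _)).1.2 = _
    rw [Equiv.symm_apply_apply]
    change (T.symm (g⁻¹ (g x))).1.2 = _
    rw [← Equiv.Perm.mul_apply, inv_mul_cancel, Equiv.Perm.one_apply]
  · right
    push Not at hg
    obtain ⟨x, y, h1, h2, hne⟩ := hg
    have hconj : g⁻¹ * Equiv.swap x y * g = Equiv.swap (g⁻¹ x) (g⁻¹ y) := by
      rw [Equiv.swap_apply_apply, inv_inv]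
    have hswap (f : Fin d → ℕ) (a b : Fin d) (hab : f a = f b) (z : Fin d) :
        f (Equiv.swap a b z) = f z := by
      by_cases ha : z = a
      · rw [ha, Equiv.swap_apply_left, hab]
      · by_cases hb : z = b
        · rw [hb, Equiv.swap_apply_right, hab]
        · rw [Equiv.swap_apply_of_ne_of_ne ha hb]
    refine ⟨Equiv.swap x y, hswap (fun z => (T.symm z).1.1) x y h1, ?_, ?_⟩
    · rw [hconj]
      exact hswap (fun z => (T.symm z).1.2) _ _ h2
    · rw [hconj, Equiv.Perm.sign_swap (by simpa using hne)]
      rw [MonoidHom.one_apply]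
      decide

/-- With `c = a b`, write `c z c = a (b z a) b` and apply the dichotomy to the element in the
middle. -/
lemma exists_isPrimitiveMultiple_youngSymmetrizer :
    ∃ κ, IsPrimitiveMultiple (youngSymmetrizer T) κ := by
  rw [youngSymmetrizer, rowSymmetrizer_eq, colAntisymmetrizer_eq]
  refine exists_isPrimitiveMultiple
    (coeffOne_charSum_mul _ _ fun g h1 h2 => eq_one_of_mem_stabilizers T h1 h2) fun z => ?_
  obtain ⟨s, hs⟩ := exists_charSum_mul_mul 1 Equiv.Perm.sign (row_col_dichotomy T)
    (charSum (colStabilizer T) Equiv.Perm.sign * z * charSum (rowStabilizer T) 1)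
  exact ⟨s, by rw [← hs]; simp only [mul_assoc]⟩

end YoungSymmetrizer

/-! ### Transposing the diagram twists the Specht module by the sign. -/

section SpechtTwist

open scoped MonoidAlgebra

variable {d : ℕ}

variable (d) in
/-- The automorphism `σ ↦ sgn(σ) σ` of the group algebra of the symmetric group. -/
noncomputable def signTwist : ℂ[Equiv.Perm (Fin d)] →ₐ[ℂ] ℂ[Equiv.Perm (Fin d)] :=
  MonoidAlgebra.lift ℂ _ (Equiv.Perm (Fin d))
    { toFun σ := MonoidAlgebra.single σ ((Equiv.Perm.sign σ : ℤ) : ℂ)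
      map_one' := by simp [MonoidAlgebra.one_def]
      map_mul' σ τ := by
        simp only [map_mul, Units.val_mul, Int.cast_mul, MonoidAlgebra.single_mul_single] }

lemma signTwist_single (σ : Equiv.Perm (Fin d)) (a : ℂ) :
    signTwist d (MonoidAlgebra.single σ a) =
      MonoidAlgebra.single σ (((Equiv.Perm.sign σ : ℤ) : ℂ) * a) := by
  simp [signTwist, MonoidAlgebra.lift_single, MonoidAlgebra.smul_single, mul_comm]

lemma signTwist_signTwist (z : ℂ[Equiv.Perm (Fin d)]) : signTwist d (signTwist d z) = z := by
  induction z using MonoidAlgebra.induction_linear with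
  | zero => simp
  | add x y hx hy => rw [map_add, map_add, hx, hy]
  | single σ a =>
    rw [signTwist_single, signTwist_single, ← mul_assoc, ← Int.cast_mul, ← Units.val_mul,
      Int.units_mul_self, Units.val_one, Int.cast_one, one_mul]

lemma signTwist_charSum (R : Subgroup (Equiv.Perm (Fin d))) [DecidablePred (· ∈ R)]
    (χ : Equiv.Perm (Fin d) →* ℤˣ) :
    signTwist d (charSum R χ) = charSum R (Equiv.Perm.sign * χ) := by
  simp only [charSum, map_sum, signTwist_single, MonoidHom.mul_apply, Units.val_mul, Int.cast_mul]

lemma charSum_conj {G : Type} [Group G] [Fintype G] {R R' : Subgroup G} [DecidablePred (· ∈ R)]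
    [DecidablePred (· ∈ R')] (χ : G →* ℤˣ) (p : G) (h : ∀ g, p * g * p⁻¹ ∈ R' ↔ g ∈ R) :
    MonoidAlgebra.single p 1 * charSum R χ * MonoidAlgebra.single p⁻¹ 1 = charSum R' χ := by
  rw [charSum, charSum, Finset.mul_sum, Finset.sum_mul]
  refine Finset.sum_nbij' (fun g => p * g * p⁻¹) (fun g => p⁻¹ * g * p) ?_ ?_ ?_ ?_ ?_
  · simp [h]
  · intro g hg
    simp only [Finset.mem_filter, Finset.mem_univ, true_and] at hg ⊢
    rw [← h]
    simpa [mul_assoc] using hg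
  · intro g _
    group
  · intro g _
    group
  · intro g _
    rw [MonoidAlgebra.single_mul_single, MonoidAlgebra.single_mul_single, map_mul, map_mul, map_inv,
      one_mul, mul_one, mul_comm (χ p), mul_inv_cancel_right]

variable {μ : YoungDiagram} (T : μ.cells ≃ Fin d) (T' : μ.transpose.cells ≃ Fin d)

/-- The permutation relating a filling of a diagram and a filling of the transposed diagram. -/
def transposePerm : Equiv.Perm (Fin d) :=
  (T.symm.trans ((Equiv.prodComm ℕ ℕ).subtypeEquiv fun x => by
    rw [YoungDiagram.mem_cells, YoungDiagram.mem_cells, YoungDiagram.mem_transpose]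
    rfl)).trans T'

lemma symm_transposePerm (x : Fin d) :
    (T'.symm (transposePerm T T' x)).1 = (T.symm x).1.swap := by
  change (T'.symm (T' _)).1 = _
  rw [Equiv.symm_apply_apply]
  rfl

lemma conj_mem_rowStabilizer (σ : Equiv.Perm (Fin d)) :
    transposePerm T T' * σ * (transposePerm T T')⁻¹ ∈ rowStabilizer T' ↔
      σ ∈ colStabilizer T := by
  rw [mem_rowStabilizer, ← (transposePerm T T').forall_congr_right]
  simp [symm_transposePerm, mem_colStabilizer]

lemma conj_mem_colStabilizer (σ : Equiv.Perm (Fin d)) :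
    transposePerm T T' * σ * (transposePerm T T')⁻¹ ∈ colStabilizer T' ↔
      σ ∈ rowStabilizer T := by
  rw [mem_colStabilizer, ← (transposePerm T T').forall_congr_right]
  simp [symm_transposePerm, mem_rowStabilizer]

/-- Transposition exchanges row and column stabilizers, and the sign twist exchanges symmetrizing
and antisymmetrizing; the product therefore appears in the order `b_T a_T`. -/
lemma youngSymmetrizer_transpose :
    youngSymmetrizer T' = MonoidAlgebra.single (transposePerm T T') 1 *
      signTwist d (colAntisymmetrizer T * rowSymmetrizer T) *
        MonoidAlgebra.single (transposePerm T T')⁻¹ 1 := by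
  rw [youngSymmetrizer, rowSymmetrizer_eq, rowSymmetrizer_eq, colAntisymmetrizer_eq,
    colAntisymmetrizer_eq, ← charSum_conj _ _ (conj_mem_rowStabilizer T T'),
    ← charSum_conj _ _ (conj_mem_colStabilizer T T'), map_mul, signTwist_charSum,
    signTwist_charSum, mul_one]
  have h1 : (Equiv.Perm.sign * Equiv.Perm.sign : Equiv.Perm (Fin d) →* ℤˣ) = 1 := by
    ext σ
    simp
  have h2 : (MonoidAlgebra.single (transposePerm T T')⁻¹ 1 *
      MonoidAlgebra.single (transposePerm T T') 1 : ℂ[Equiv.Perm (Fin d)]) = 1 := by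
    rw [MonoidAlgebra.single_mul_single, inv_mul_cancel, one_mul, MonoidAlgebra.one_def]
  rw [h1]
  simp only [mul_assoc]
  rw [← mul_assoc (MonoidAlgebra.single (transposePerm T T')⁻¹ 1)
    (MonoidAlgebra.single (transposePerm T T') 1), h2, one_mul]

lemma mul_youngSymmetrizer {κ : ℂ} (hκ : IsPrimitiveMultiple (youngSymmetrizer T) κ)
    {x : ℂ[Equiv.Perm (Fin d)]} (hx : x ∈ (spechtSub T).toSubmodule) :
    x * youngSymmetrizer T = κ • x := by
  obtain ⟨y, rfl⟩ := hx
  rw [LinearMap.mulRight_apply, mul_assoc, hκ.mul_self, mul_smul_comm]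

lemma leftRegular_eq {G : Type} [Group G] (g : G) (z : ℂ[G]) :
    Representation.leftRegular ℂ G g z = MonoidAlgebra.single g 1 * z := by
  induction z using MonoidAlgebra.induction_linear with
  | zero => simp
  | add x y hx hy => rw [map_add, hx, hy, mul_add]
  | single x r => simp

/-- The Specht module of the transposed partition is the twist by the sign character. -/
lemma exists_spechtTwist : ∃ ψ : SpechtModule T ≃ₗ[ℂ] (spechtSub T').toSubmodule,
    ∀ (σ : Equiv.Perm (Fin d)) (x : SpechtModule T), (ψ (spechtRep T σ x)).1 =
      ((Equiv.Perm.sign σ : ℤ) : ℂ) • (MonoidAlgebra.single σ 1 * (ψ x).1) := by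
  obtain ⟨κ, hκ⟩ := exists_isPrimitiveMultiple_youngSymmetrizer T
  obtain ⟨κ', hκ'⟩ := exists_isPrimitiveMultiple_youngSymmetrizer T'
  set p := transposePerm T T' with hp
  have hpp : (MonoidAlgebra.single p⁻¹ 1 * MonoidAlgebra.single p 1 : ℂ[Equiv.Perm (Fin d)]) = 1 := by
    rw [MonoidAlgebra.single_mul_single, inv_mul_cancel, one_mul, MonoidAlgebra.one_def]
  -- Multiplication by `a_T` passes from the ideal of `a_T b_T` to that of `b_T a_T`, which the
  -- twist and `p⁻¹` carry to the ideal of `c_{T'}`. The map `F'` goes back by means of `b_T`; the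
  -- two composites are the scalars `κ` and `κ'`.
  let F : ℂ[Equiv.Perm (Fin d)] →ₗ[ℂ] ℂ[Equiv.Perm (Fin d)] :=
    LinearMap.mulRight ℂ (MonoidAlgebra.single p⁻¹ 1) ∘ₗ (signTwist d).toLinearMap ∘ₗ
      LinearMap.mulRight ℂ (rowSymmetrizer T)
  let F' : ℂ[Equiv.Perm (Fin d)] →ₗ[ℂ] ℂ[Equiv.Perm (Fin d)] :=
    LinearMap.mulRight ℂ (colAntisymmetrizer T) ∘ₗ (signTwist d).toLinearMap ∘ₗ
      LinearMap.mulRight ℂ (MonoidAlgebra.single p 1)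
  have hF (x) : F x = signTwist d (x * rowSymmetrizer T) * MonoidAlgebra.single p⁻¹ 1 := rfl
  have hF' (x) : F' x = signTwist d (x * MonoidAlgebra.single p 1) * colAntisymmetrizer T := rfl
  have hmem : ∀ x ∈ (spechtSub T).toSubmodule, F x ∈ (spechtSub T').toSubmodule := by
    rintro _ ⟨y, rfl⟩
    refine ⟨signTwist d (y * rowSymmetrizer T) * MonoidAlgebra.single p⁻¹ 1, ?_⟩
    rw [LinearMap.mulRight_apply, LinearMap.mulRight_apply, hF, youngSymmetrizer_transpose T T',
      ← hp, youngSymmetrizer]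
    simp only [map_mul, mul_assoc]
    rw [← mul_assoc (MonoidAlgebra.single p⁻¹ 1) (MonoidAlgebra.single p 1), hpp, one_mul]
  have hmem' : ∀ x ∈ (spechtSub T').toSubmodule, F' x ∈ (spechtSub T).toSubmodule := by
    rintro _ ⟨y, rfl⟩
    refine ⟨signTwist d (y * MonoidAlgebra.single p 1) * colAntisymmetrizer T, ?_⟩
    rw [LinearMap.mulRight_apply, LinearMap.mulRight_apply, hF', youngSymmetrizer_transpose T T',
      ← hp, youngSymmetrizer]
    simp only [map_mul, mul_assoc, signTwist_signTwist]
    rw [← mul_assoc (signTwist d (MonoidAlgebra.single p⁻¹ 1)), ← map_mul, hpp, map_one, one_mul]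
  have hFF' (x : (spechtSub T).toSubmodule) : F' (F x.1) = κ • x.1 := by
    rw [hF', hF, mul_assoc, hpp, mul_one, signTwist_signTwist, mul_assoc, ← youngSymmetrizer,
      mul_youngSymmetrizer T hκ x.2]
  have hF'F (x : (spechtSub T').toSubmodule) : F (F' x.1) = κ' • x.1 := by
    rw [← mul_youngSymmetrizer T' hκ' x.2, hF, hF', youngSymmetrizer_transpose T T', mul_assoc _ _ (rowSymmetrizer T),
      map_mul, signTwist_signTwist]
    simp only [mul_assoc, hp]
  have hinj : Function.Injective (F.restrict hmem) := fun x y hxy => by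
    have h := congrArg F' (congrArg Subtype.val hxy)
    rw [LinearMap.coe_restrict_apply, LinearMap.coe_restrict_apply, hFF', hFF'] at h
    exact Subtype.ext (smul_right_injective _ hκ.ne_zero h)
  have hsurj : Function.Surjective (F.restrict hmem) := fun x => by
    refine ⟨κ'⁻¹ • F'.restrict hmem' x, ?_⟩
    rw [map_smul]
    refine Subtype.ext ?_
    change κ'⁻¹ • F (F' x.1) = x.1
    rw [hF'F, smul_smul, inv_mul_cancel₀ hκ'.ne_zero, one_smul]
  refine ⟨LinearEquiv.ofBijective (F.restrict hmem) ⟨hinj, hsurj⟩, fun σ x => ?_⟩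
  change F (Representation.leftRegular ℂ (Equiv.Perm (Fin d)) σ x.1) = _ • (_ * F x.1)
  rw [leftRegular_eq, hF, hF, mul_assoc, map_mul, signTwist_single, mul_one, ← mul_assoc,
    ← smul_mul_assoc, ← smul_mul_assoc, MonoidAlgebra.smul_single, smul_eq_mul, mul_one]

end SpechtTwist

/-! ### Polarization of multilinear forms. -/

section Polarization

open scoped MonoidAlgebra

variable {d : ℕ}

/-- Expand `M` on the diagonal at `∑ t_i X_i` as a polynomial in the `t_i`. It vanishes identically,
and the sum over permutations is its coefficient at `t_1 ⋯ t_d`. -/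
lemma sum_perm_eq_zero_of_diagonal_eq_zero {E : Type} [AddCommGroup E] [Module ℂ E]
    (M : MultilinearMap ℂ (fun _ : Fin d => E) ℂ)
    (hM : ∀ y : E, M (fun _ => y) = 0) (X : Fin d → E) :
    ∑ σ : Equiv.Perm (Fin d), M (X ∘ σ) = 0 := by
  classical
  let p : MvPolynomial (Fin d) ℂ :=
    ∑ φ : Fin d → Fin d, MvPolynomial.monomial (∑ j, Finsupp.single (φ j) 1) (M (X ∘ φ))
  have hp : p = 0 := MvPolynomial.funext fun t => by
    have h := hM (∑ i, t i • X i)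
    rw [M.map_sum] at h
    rw [map_zero, ← h, map_sum]
    refine Finset.sum_congr rfl fun φ _ => ?_
    refine Eq.trans ?_ (M.map_smul_univ (fun j => t (φ j)) (X ∘ φ)).symm
    rw [MvPolynomial.eval_monomial, smul_eq_mul,
      mul_comm]
    congr 1
    rw [Finsupp.prod_fintype _ _ (by simp)]
    simp only [Finsupp.finsetSum_apply, ← Finset.prod_pow_eq_pow_sum]
    rw [Finset.prod_comm]
    refine Finset.prod_congr rfl fun j _ => ?_
    rw [Finset.prod_eq_single (φ j)]
    · simp
    · intro k _ hk
      rw [Finsupp.single_eq_of_ne hk, pow_zero]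
    · simp
  have hbij (φ : Fin d → Fin d) : (∑ j, Finsupp.single (φ j) 1 : Fin d →₀ ℕ) =
      ∑ j, Finsupp.single j 1 ↔ Function.Bijective φ := by
    constructor
    · intro h
      refine Finite.surjective_iff_bijective.1 fun i => ?_
      by_contra hi
      push Not at hi
      have h := DFunLike.congr_fun h i
      rw [Finsupp.finsetSum_apply, Finsupp.finsetSum_apply,
        Finset.sum_eq_zero fun j _ => Finsupp.single_eq_of_ne (hi j).symm,
        Finset.sum_eq_single i (fun j _ hj => Finsupp.single_eq_of_ne hj.symm) (by simp)] at h
      simp at h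
    · intro h
      exact Function.Bijective.sum_comp h fun j => (Finsupp.single j 1 : Fin d →₀ ℕ)
  have h := congrArg (MvPolynomial.coeff (∑ j, Finsupp.single j 1)) hp
  rw [MvPolynomial.coeff_zero, MvPolynomial.coeff_sum] at h
  simp only [MvPolynomial.coeff_monomial, hbij] at h
  rw [← Finset.sum_filter] at h
  rw [← h]
  exact (Finset.sum_bij (fun φ hφ => Equiv.ofBijective φ (Finset.mem_filter.1 hφ).2)
    (fun _ _ => Finset.mem_univ _) (fun _ _ _ _ h => by injection h)
    (fun σ _ => ⟨σ, Finset.mem_filter.2 ⟨Finset.mem_univ _, σ.bijective⟩, Equiv.coe_fn_injective rfl⟩) fun _ _ => rfl).symm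

/-- Zariski density of the invertible operators: the value at `t + y` is a polynomial in `t` that
vanishes off the finite spectrum of `-y`, hence also at `t = 0`. -/
lemma diagonal_eq_zero_of_units {W : Type} [AddCommGroup W] [Module ℂ W]
    [FiniteDimensional ℂ W] (M : MultilinearMap ℂ (fun _ : Fin d => Module.End ℂ W) ℂ)
    (hM : ∀ g : (Module.End ℂ W)ˣ, M (fun _ => (g : Module.End ℂ W)) = 0) (y : Module.End ℂ W) : M (fun _ => y) = 0 := by
  classical
  let p : Polynomial ℂ := ∑ s : Finset (Fin d),
    Polynomial.monomial s.card (M (s.piecewise (fun _ => 1) (fun _ => y)))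
  have hp (t : ℂ) : p.eval t = M (fun _ => t • 1 + y) := by
    have h := M.map_add_univ (fun _ => t • 1) (fun _ => y)
    rw [show (fun _ : Fin d => t • (1 : Module.End ℂ W)) + (fun _ => y) = fun _ => t • 1 + y from rfl] at h
    rw [h, Polynomial.eval_finsetSum]
    refine Finset.sum_congr rfl fun s _ => ?_
    have h2 := M.map_piecewise_smul (fun _ => t) (s.piecewise (fun _ => 1) (fun _ => y)) s
    rw [Finset.prod_const, smul_eq_mul] at h2
    rw [Polynomial.eval_monomial, mul_comm, ← h2]
    congr 1
    funext i
    by_cases hi : i ∈ s <;> simp [hi]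
  have hp0 : p = 0 := by
    refine Polynomial.eq_zero_of_infinite_isRoot p ?_
    have hfin : (spectrum ℂ (-y)).Finite := Module.End.finite_spectrum (-y)
    refine hfin.infinite_compl.mono fun t ht => ?_
    have ht' : IsUnit (algebraMap ℂ (Module.End ℂ W) t - -y) := by simpa [spectrum.mem_iff] using ht
    obtain ⟨g, hg⟩ := ht'
    rw [sub_neg_eq_add, Algebra.algebraMap_eq_smul_one] at hg
    change p.eval t = 0
    rw [hp, ← hg]
    exact hM g
  have := hp 0
  rwa [hp0, Polynomial.eval_zero, zero_smul, zero_add, eq_comm] at this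

end Polarization

/-! ### Averaged operators on tensor powers lie in the span of `g^{⊗ d}`. -/

section Commutant

variable {W : Type} [AddCommGroup W] [Module ℂ W] {d : ℕ}

local notation "U" => PiTensorProduct ℂ fun _ : Fin d => W

variable (W d) in
/-- The span of the operators `g^{⊗ d}` for invertible `g`. -/
noncomputable def powerSpan : Submodule ℂ (Module.End ℂ (PiTensorProduct ℂ fun _ : Fin d => W)) :=
  Submodule.span ℂ (Set.range fun g : (Module.End ℂ W)ˣ =>
    PiTensorProduct.map fun _ => (g : Module.End ℂ W))

variable (W d) in
/-- The sum of the conjugates of an operator on `W^{⊗ d}` by the symmetric group. -/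
noncomputable def permConjSum : Module.End ℂ (PiTensorProduct ℂ fun _ : Fin d => W) →ₗ[ℂ]
    Module.End ℂ (PiTensorProduct ℂ fun _ : Fin d => W) :=
  ∑ σ : Equiv.Perm (Fin d), LinearMap.mulLeftRight ℂ
    (tensorPermRep W d σ, tensorPermRep W d σ⁻¹)

lemma permConjSum_apply (X : Module.End ℂ U) :
    permConjSum W d X = ∑ σ, tensorPermRep W d σ * X * tensorPermRep W d σ⁻¹ := by
  simp [permConjSum, LinearMap.sum_apply, LinearMap.mulLeftRight_apply]

lemma tensorPermRep_tprod (σ : Equiv.Perm (Fin d)) (w : Fin d → W) :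
    tensorPermRep W d σ (PiTensorProduct.tprod ℂ w) =
      PiTensorProduct.tprod ℂ fun x => w (σ⁻¹ x) :=
  PiTensorProduct.reindex_tprod _ _

lemma tensorPermRep_conj_map (σ : Equiv.Perm (Fin d)) (X : Fin d → Module.End ℂ W) :
    tensorPermRep W d σ * PiTensorProduct.map X * tensorPermRep W d σ⁻¹ =
      PiTensorProduct.map (X ∘ (σ⁻¹ : Equiv.Perm (Fin d))) := by
  ext w
  simp only [LinearMap.compMultilinearMap_apply, Module.End.mul_apply, tensorPermRep_tprod,
    PiTensorProduct.map_tprod]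
  congr 1
  funext x
  rw [inv_inv, Function.comp_apply, ← Equiv.Perm.mul_apply σ, mul_inv_cancel, Equiv.Perm.one_apply]

variable [FiniteDimensional ℂ W]

/-- Otherwise a linear form kills the span but not this operator. As a multilinear form in `X` it
vanishes on the diagonal at invertible operators, so by polarization its symmetrization is zero, a
contradiction. -/
lemma permConjSum_map_mem (X : Fin d → Module.End ℂ W) :
    permConjSum W d (PiTensorProduct.map X) ∈ powerSpan W d := by
  by_contra h
  obtain ⟨f, hf, hle⟩ := Submodule.exists_le_ker_of_notMem h
  refine hf ?_
  let M := f.compMultilinearMap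
    (PiTensorProduct.mapMultilinear ℂ (fun _ : Fin d => W) (fun _ : Fin d => W))
  have hM := sum_perm_eq_zero_of_diagonal_eq_zero M
    (diagonal_eq_zero_of_units M fun g =>
      hle (Submodule.subset_span ⟨g, rfl⟩)) X
  rw [permConjSum_apply, map_sum, ← hM, ← Equiv.sum_comp (Equiv.inv (Equiv.Perm (Fin d)))]
  refine Finset.sum_congr rfl fun σ _ => ?_
  rw [tensorPermRep_conj_map]
  simp [M]

/-- In a tensor basis, the rank one operators given by matrix units are pure tensors of matrix units
on `W`; the general case follows by bilinearity. -/
lemma permConjSum_smulRight_mem (f : Module.Dual ℂ U) (v : U) :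
    permConjSum W d (f.smulRight v) ∈ powerSpan W d := by
  classical
  let b := Module.finBasis ℂ W
  let B := Basis.piTensorProduct fun _ : Fin d => b
  have key (k k' : Fin d → Fin (Module.finrank ℂ W)) :
      (B.coord k).smulRight (B k') =
        PiTensorProduct.map fun x => (b.coord (k x)).smulRight (b (k' x)) := by
    refine B.ext fun l => ?_
    rw [LinearMap.smulRight_apply, B.coord_apply, B.repr_self, Basis.piTensorProduct_apply,
      Basis.piTensorProduct_apply, PiTensorProduct.map_tprod]
    simp only [LinearMap.smulRight_apply, b.coord_apply, b.repr_self]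
    rw [MultilinearMap.map_smul_univ]
    congr 1
    simp only [Finsupp.single_apply, Finset.prod_ite_zero, Finset.prod_const_one, funext_iff]
    simp
  rw [← B.sum_dual_apply_smul_coord f, ← B.sum_repr v]
  have : (∑ x, f (B x) • B.coord x).smulRight (∑ i, B.repr v i • B i) =
      ∑ x, ∑ i, (f (B x) * B.repr v i) • (B.coord x).smulRight (B i) := by
    refine LinearMap.ext fun w => ?_
    simp only [LinearMap.smulRight_apply, LinearMap.sum_apply, LinearMap.smul_apply,
      Finset.sum_smul, smul_smul, smul_eq_mul]
    refine Finset.sum_congr rfl fun x _ => ?_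
    rw [Finset.smul_sum]
    refine Finset.sum_congr rfl fun y _ => ?_
    rw [smul_smul]
    congr 1
    ring
  rw [this, map_sum]
  refine Submodule.sum_mem _ fun k _ => ?_
  rw [map_sum]
  refine Submodule.sum_mem _ fun k' _ => ?_
  rw [map_smul, key]
  exact Submodule.smul_mem _ _ (permConjSum_map_mem _)

end Commutant

/-! ### Irreducibility of Schur modules, and their maps to tensor powers. -/

section SchurModule

open scoped MonoidAlgebra

variable {W : Type} [AddCommGroup W] [Module ℂ W] {d : ℕ}

local notation "U" => PiTensorProduct ℂ fun _ : Fin d => W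

lemma asAlgebraHom_eq_sum {G V : Type} [Group G] [Fintype G] [AddCommGroup V] [Module ℂ V]
    (ρ : Representation ℂ G V) (z : ℂ[G]) (v : V) :
    ρ.asAlgebraHom z v = ∑ g, z.coeff g • ρ g v := by
  classical
  induction z using MonoidAlgebra.induction_linear with
  | zero => simp
  | add x y hx hy =>
    rw [map_add, LinearMap.add_apply, hx, hy, ← Finset.sum_add_distrib]
    exact Finset.sum_congr rfl fun g _ => (add_smul _ _ _).symm
  | single h a =>
    rw [Representation.asAlgebraHom_single, LinearMap.smul_apply, Finset.sum_eq_single h]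
    · simp
    · intro g _ hg
      rw [MonoidAlgebra.coeff_single, Finsupp.single_eq_of_ne hg, zero_smul]
    · simp

lemma powerSpan_comm {E : Module.End ℂ U} (hE : E ∈ powerSpan W d)
    (z : ℂ[Equiv.Perm (Fin d)]) (u : U) :
    E ((tensorPermRep W d).asAlgebraHom z u) = (tensorPermRep W d).asAlgebraHom z (E u) := by
  induction hE using Submodule.span_induction with
  | mem E hE =>
    obtain ⟨g, rfl⟩ := hE
    exact tensorPermRep_comm (Units.coeHom (Module.End ℂ W)) d g z u
  | zero => simp
  | add E F _ _ hE hF => rw [LinearMap.add_apply, LinearMap.add_apply, hE, hF, map_add]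
  | smul c E _ hE => rw [LinearMap.smul_apply, LinearMap.smul_apply, hE, map_smul]

lemma exists_dual_apply_ne_zero {V : Type} [AddCommGroup V] [Module ℂ V] {v : V} (hv : v ≠ 0) :
    ∃ f : Module.Dual ℂ V, f v ≠ 0 := by
  by_contra! h
  exact hv ((Module.forall_dual_apply_eq_zero_iff ℂ v).1 h)

section Primitive

variable {c : ℂ[Equiv.Perm (Fin d)]} {κ : ℂ}

lemma IsPrimitiveMultiple.apply_eq (hc : IsPrimitiveMultiple c κ) {u : U}
    (hu : u ∈ LinearMap.range ((tensorPermRep W d).asAlgebraHom c)) :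
    (tensorPermRep W d).asAlgebraHom c u = κ • u := by
  obtain ⟨u, rfl⟩ := hu
  rw [← Module.End.mul_apply, ← map_mul, hc.mul_self, map_smul, LinearMap.smul_apply]

/-- For every `y` the element `c y z c` acts by zero, but it equals `κ²` times the coefficient of
the identity in `y z` times `c`. As `c` acts nontrivially, all these coefficients vanish, and so
does `z`. -/
lemma IsPrimitiveMultiple.eq_zero_of_apply_eq_zero (hc : IsPrimitiveMultiple c κ)
    (hne : (tensorPermRep W d).asAlgebraHom c ≠ 0) {z : ℂ[Equiv.Perm (Fin d)]}
    (hz : z * c = κ • z)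
    (h : ∀ u ∈ LinearMap.range ((tensorPermRep W d).asAlgebraHom c),
      (tensorPermRep W d).asAlgebraHom z u = 0) : z = 0 := by
  refine eq_zero_of_coeffOne_mul fun y => ?_
  obtain ⟨w, hw⟩ := DFunLike.ne_iff.1 hne
  have h1 : (tensorPermRep W d).asAlgebraHom (c * (y * z) * c) w = 0 := by
    rw [← mul_assoc, map_mul, Module.End.mul_apply, map_mul, Module.End.mul_apply,
      h _ ⟨w, rfl⟩, map_zero]
  rw [hc.mul_mul, mul_assoc, hz, mul_smul_comm, map_smul, map_smul, LinearMap.smul_apply,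
    smul_eq_zero] at h1
  simpa [hc.ne_zero] using h1.resolve_right hw

variable [FiniteDimensional ℂ W]

/-- Schur's lemma for the conjugation sum of a rank one operator, on the image of a primitive
idempotent. -/
lemma IsPrimitiveMultiple.permConjSum_apply (hc : IsPrimitiveMultiple c κ) {u v : U}
    (hu : u ∈ LinearMap.range ((tensorPermRep W d).asAlgebraHom c))
    (hv : v ∈ LinearMap.range ((tensorPermRep W d).asAlgebraHom c)) (f : Module.Dual ℂ U) :
    permConjSum W d (f.smulRight v) u = (κ * f u) • v := by
  set P := (tensorPermRep W d).asAlgebraHom with hP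
  have hexp (w : U) : permConjSum W d (f.smulRight v) w =
      ∑ σ : Equiv.Perm (Fin d), f (tensorPermRep W d σ⁻¹ w) • tensorPermRep W d σ v := by
    rw [_root_.permConjSum_apply, LinearMap.sum_apply]
    refine Finset.sum_congr rfl fun σ _ => ?_
    rw [Module.End.mul_apply, Module.End.mul_apply, LinearMap.smulRight_apply, map_smul]
  -- The averaged operator lies in `powerSpan`, so it commutes with the action of `c`, which
  -- multiplies `u` by `κ`.
  have h1 : κ • permConjSum W d (f.smulRight v) u =
      ∑ σ : Equiv.Perm (Fin d), f (tensorPermRep W d σ⁻¹ u) • P c (tensorPermRep W d σ v) := by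
    rw [← map_smul, ← hc.apply_eq hu, powerSpan_comm (permConjSum_smulRight_mem f v), hexp, map_sum]
    exact Finset.sum_congr rfl fun σ _ => map_smul _ _ _
  -- As `κ • v = c v`, primitivity evaluates `c σ c` as a multiple of `c`. Summed over `σ`, the
  -- resulting coefficients reassemble `f (c u) = κ f(u)`.
  have h2 (σ : Equiv.Perm (Fin d)) : κ • P c (tensorPermRep W d σ v) =
      (κ * c.coeff σ⁻¹) • κ • v := by
    rw [← map_smul, ← map_smul, ← hc.apply_eq hv, ← hP,
      ← Representation.asAlgebraHom_single_one, ← hP, ← Module.End.mul_apply, ← Module.End.mul_apply,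
      ← map_mul, ← map_mul, hc.mul_mul, coeffOne_single_mul, map_smul,
      LinearMap.smul_apply]
  have h3 : κ • κ • permConjSum W d (f.smulRight v) u = κ • κ • (κ * f u) • v := by
    have h4 := hc.apply_eq hu
    rw [asAlgebraHom_eq_sum, ← Equiv.sum_comp (Equiv.inv (Equiv.Perm (Fin d)))] at h4
    have h5 : κ * f u = ∑ σ : Equiv.Perm (Fin d), c.coeff σ⁻¹ * f (tensorPermRep W d σ⁻¹ u) := by
      rw [← smul_eq_mul, ← map_smul, ← h4, map_sum]
      exact Finset.sum_congr rfl fun σ _ => map_smul _ _ _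
    rw [h1, Finset.smul_sum, h5, Finset.sum_smul, Finset.smul_sum, Finset.smul_sum]
    refine Finset.sum_congr rfl fun σ _ => ?_
    rw [smul_comm, h2]
    simp only [smul_smul]
    congr 1
    ring
  exact smul_right_injective _ hc.ne_zero (smul_right_injective _ hc.ne_zero h3)

end Primitive

variable {G : Type} [Group G] {ρ : Representation ℂ G W} {lam : YoungDiagram}
  (T : lam.cells ≃ Fin d)

lemma powerSpan_mem_of_invariant (hρ : ∀ g : (Module.End ℂ W)ˣ, ∃ a, ρ a = g)
    {E : Module.End ℂ U} (hE : E ∈ powerSpan W d) (N : Subrepresentation (tensorPowerRep ρ d))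
    {u : U} (hu : u ∈ N.toSubmodule) : E u ∈ N.toSubmodule := by
  induction hE using Submodule.span_induction with
  | mem E hE =>
    obtain ⟨g, rfl⟩ := hE
    obtain ⟨a, ha⟩ := hρ g
    change PiTensorProduct.map (fun _ => (g : Module.End ℂ W)) u ∈ _
    rw [← ha]
    exact N.apply_mem_toSubmodule a hu
  | zero => exact Submodule.zero_mem _
  | add E F _ _ hE hF => exact Submodule.add_mem _ hE hF
  | smul c E _ hE => exact Submodule.smul_mem _ _ hE

lemma powerSpan_map_of_equivariant (hρ : ∀ g : (Module.End ℂ W)ˣ, ∃ a, ρ a = g)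
    {E : Module.End ℂ U} (hE : E ∈ powerSpan W d) (N : Subrepresentation (tensorPowerRep ρ d))
    (φ : N.toSubmodule →ₗ[ℂ] U)
    (hφ : ∀ a u, φ (N.toRepresentation a u) = tensorPowerRep ρ d a (φ u))
    {u : U} (hu : u ∈ N.toSubmodule) (h : E u ∈ N.toSubmodule) :
    φ ⟨E u, h⟩ = E (φ ⟨u, hu⟩) := by
  induction hE using Submodule.span_induction with
  | mem E hE =>
    obtain ⟨g, rfl⟩ := hE
    obtain ⟨a, ha⟩ := hρ g
    have := hφ a ⟨u, hu⟩
    change φ ⟨PiTensorProduct.map (fun _ => (g : Module.End ℂ W)) u, h⟩ =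
      PiTensorProduct.map (fun _ => (g : Module.End ℂ W)) _
    simp only [← ha]
    exact this
  | zero => exact map_zero φ
  | add E F hE' hF' hE hF =>
    exact (map_add φ ⟨E u, _⟩ ⟨F u, _⟩).trans
      (congrArg₂ (· + ·) (hE (powerSpan_mem_of_invariant hρ hE' N hu))
        (hF (powerSpan_mem_of_invariant hρ hF' N hu)))
  | smul c E hE' hE =>
    exact (map_smul φ c ⟨E u, _⟩).trans
      (congrArg (c • ·) (hE (powerSpan_mem_of_invariant hρ hE' N hu)))

/-- Test on the basis tensor `e_k` in which position `x` carries the row index of `x`; this needs at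
least as many basis vectors as rows. Row permutations preserve the coefficient of `e_k`, and among
column permutations only the identity fixes `e_k`, so its coefficient in `c_T e_k` is the order of
the row stabilizer. -/
lemma asAlgebraHom_youngSymmetrizer_ne_zero {m : ℕ} (b : Module.Basis (Fin m) ℂ W)
    (hm : lam.colLen 0 ≤ m) : (tensorPermRep W d).asAlgebraHom (youngSymmetrizer T) ≠ 0 := by
  classical
  let B := Basis.piTensorProduct fun _ : Fin d => b
  have hrow (x : Fin d) : (T.symm x).1.1 < m := by
    refine lt_of_lt_of_le ?_ hm
    rw [← YoungDiagram.mem_iff_lt_colLen]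
    exact lam.up_left_mem le_rfl (Nat.zero_le _) ((YoungDiagram.mem_cells _).1 (T.symm x).2)
  let k : Fin d → Fin m := fun x => ⟨(T.symm x).1.1, hrow x⟩
  have hB (k' : Fin d → Fin m) (σ : Equiv.Perm (Fin d)) :
      tensorPermRep W d σ (B k') = B (k' ∘ (σ⁻¹ : Equiv.Perm (Fin d))) := by
    rw [Basis.piTensorProduct_apply, tensorPermRep_tprod, Basis.piTensorProduct_apply]
    rfl
  have hk (σ : Equiv.Perm (Fin d)) :
      k ∘ (σ⁻¹ : Equiv.Perm (Fin d)) = k ↔ σ ∈ rowStabilizer T := by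
    rw [← inv_mem_iff, mem_rowStabilizer, funext_iff]
    simp [k, Fin.ext_iff]
  have h1 (u : PiTensorProduct ℂ fun _ : Fin d => W) (σ : Equiv.Perm (Fin d))
      (hσ : σ ∈ rowStabilizer T) : B.coord k (tensorPermRep W d σ u) = B.coord k u := by
    have : B.coord k ∘ₗ tensorPermRep W d σ = B.coord k := by
      refine B.ext fun k' => ?_
      rw [LinearMap.comp_apply, hB, B.coord_apply, B.coord_apply, B.repr_self, B.repr_self,
        Finsupp.single_apply, Finsupp.single_apply]
      refine if_congr ⟨fun h => ?_, fun h => ?_⟩ rfl rfl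
      · have h2 := (hk σ⁻¹).2 (inv_mem hσ)
        rw [← h2, ← h, inv_inv]
        funext x
        simp
      · rw [h, (hk σ).2 hσ]
    exact LinearMap.congr_fun this u
  intro h
  have h2 := congrArg (B.coord k) (LinearMap.congr_fun h (B k))
  rw [youngSymmetrizer, rowSymmetrizer_eq, colAntisymmetrizer_eq, map_mul, Module.End.mul_apply,
    charSum, map_sum, LinearMap.sum_apply, map_sum, Finset.sum_congr rfl fun σ hσ => by
      rw [MonoidHom.one_apply, Units.val_one, Int.cast_one, Representation.asAlgebraHom_single_one,
        h1 _ σ (Finset.mem_filter.1 hσ).2], Finset.sum_const, LinearMap.zero_apply, map_zero,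
    charSum, map_sum, LinearMap.sum_apply, map_sum, Finset.sum_eq_single 1] at h2
  · rw [Representation.asAlgebraHom_single, map_one, map_one] at h2
    simp [B.coord_apply, Finset.filter_eq_empty_iff] at h2
    exact h2 (one_mem _)
  · intro σ hσ h1
    rw [Representation.asAlgebraHom_single, LinearMap.smul_apply, map_smul, hB, B.coord_apply,
      B.repr_self, Finsupp.single_eq_of_ne, smul_zero]
    refine fun h => h1 (eq_one_of_mem_stabilizers T ((hk σ).1 h.symm) (Finset.mem_filter.1 hσ).2)
  · simp [one_mem]

variable [FiniteDimensional ℂ W]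

/-- The averaged rank one operator sends a vector `u` with `f u ≠ 0` to a nonzero multiple of any
prescribed `v`, and it preserves every invariant subspace. -/
lemma schurRep_isIrreducible (hρ : ∀ g : (Module.End ℂ W)ˣ, ∃ a, ρ a = g)
    (hne : (tensorPermRep W d).asAlgebraHom (youngSymmetrizer T) ≠ 0) :
    (schurRep T ρ).IsIrreducible := by
  obtain ⟨κ, hc⟩ := exists_isPrimitiveMultiple_youngSymmetrizer T
  have hnt : Nontrivial (Subrepresentation (schurRep T ρ)) := by
    obtain ⟨w, hw⟩ := DFunLike.ne_iff.1 hne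
    refine ⟨⊥, ⊤, fun h => hw ?_⟩
    let x : SchurModule T ρ := (⟨_, w, rfl⟩ : (schurSub T ρ).toSubmodule)
    have h1 : x ∈ (⊥ : Subrepresentation (schurRep T ρ)).toSubmodule := by
      rw [h]
      exact Submodule.mem_top
    have h2 : x = 0 := (Submodule.mem_bot ℂ (M := SchurModule T ρ)).1 h1
    exact congrArg (schurSub T ρ).toSubmodule.subtype h2
  refine ⟨fun N => or_iff_not_imp_left.2 fun hN => ?_⟩
  have hN' : N.toSubmodule ≠ ⊥ := fun h => hN (Subrepresentation.toSubmodule_injective h)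
  obtain ⟨u, huN, hu0⟩ := Submodule.exists_mem_ne_zero_of_ne_bot hN'
  have hu1 : u.1 ≠ 0 := fun h => hu0 (Subtype.ext h)
  obtain ⟨f, hf⟩ := exists_dual_apply_ne_zero hu1
  let N' : Subrepresentation (tensorPowerRep ρ d) :=
    { toSubmodule := N.toSubmodule.map (schurSub T ρ).toSubmodule.subtype
      apply_mem_toSubmodule := by
        rintro a _ ⟨x, hx, rfl⟩
        exact ⟨schurRep T ρ a x, N.apply_mem_toSubmodule a hx, rfl⟩ }
  refine Subrepresentation.toSubmodule_injective (eq_top_iff.2 fun v _ => ?_)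
  have h1 := powerSpan_mem_of_invariant hρ (permConjSum_smulRight_mem f v.1) N'
    (u := u.1) ⟨u, huN, rfl⟩
  rw [hc.permConjSum_apply u.2 v.2] at h1
  obtain ⟨x, hx, hxv⟩ := (Submodule.smul_mem_iff _ (mul_ne_zero hc.ne_zero hf)).1 h1
  rwa [show x = v from Subtype.ext hxv] at hx

/-- Equivariant maps from the Schur module to the tensor power are given by elements of the left
ideal of the group algebra of the symmetric group. -/
lemma exists_asAlgebraHom_eq (hρ : ∀ g : (Module.End ℂ W)ˣ, ∃ a, ρ a = g)
    (φ : (schurSub T ρ).toSubmodule →ₗ[ℂ] U)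
    (hφ : ∀ a u, φ ((schurSub T ρ).toRepresentation a u) = tensorPowerRep ρ d a (φ u)) :
    ∃ z ∈ (spechtSub T).toSubmodule,
      ∀ u, φ u = (tensorPermRep W d).asAlgebraHom z u.1 := by
  obtain ⟨κ, hc⟩ := exists_isPrimitiveMultiple_youngSymmetrizer T
  by_cases h0 : ∀ u : (schurSub T ρ).toSubmodule, u = 0
  · exact ⟨0, Submodule.zero_mem _, fun u => by rw [h0 u]; simp⟩
  push Not at h0
  obtain ⟨u, hu0⟩ := h0
  have hu1 : u.1 ≠ 0 := fun h => hu0 (Subtype.ext h)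
  obtain ⟨f, hf⟩ := exists_dual_apply_ne_zero hu1
  -- Apply `φ` to the averaged operator `E` built from `f` and `v`: on one side `E u` is `κ f(u)`
  -- times `v`, on the other `E (φ u)` is a combination of the `σ v` whose coefficients define `x`.
  let x : ℂ[Equiv.Perm (Fin d)] := ∑ σ : Equiv.Perm (Fin d),
    MonoidAlgebra.single σ (f (tensorPermRep W d σ⁻¹ (φ u)))
  have key (v : (schurSub T ρ).toSubmodule) :
      (κ * f u.1) • φ v = (tensorPermRep W d).asAlgebraHom x v.1 := by
    have h1 := powerSpan_map_of_equivariant hρ (permConjSum_smulRight_mem f v.1) (schurSub T ρ)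
      φ hφ u.2 (powerSpan_mem_of_invariant hρ (permConjSum_smulRight_mem f v.1) _ u.2)
    have h2 : (⟨permConjSum W d (f.smulRight v.1) u.1, powerSpan_mem_of_invariant hρ
        (permConjSum_smulRight_mem f v.1) (schurSub T ρ) u.2⟩ : (schurSub T ρ).toSubmodule) =
        (κ * f u.1) • v := Subtype.ext (hc.permConjSum_apply u.2 v.2 f)
    rw [h2, map_smul] at h1
    rw [h1, permConjSum_apply, LinearMap.sum_apply, map_sum, LinearMap.sum_apply]
    refine Finset.sum_congr rfl fun σ _ => ?_
    rw [Module.End.mul_apply, Module.End.mul_apply, LinearMap.smulRight_apply, map_smul,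
      Representation.asAlgebraHom_single, LinearMap.smul_apply]
  refine ⟨(κ * f u.1)⁻¹ • κ⁻¹ • (x * youngSymmetrizer T),
    Submodule.smul_mem _ _ (Submodule.smul_mem _ _ ⟨x, rfl⟩), fun v => ?_⟩
  rw [map_smul, map_smul, LinearMap.smul_apply, LinearMap.smul_apply, map_mul, Module.End.mul_apply,
    hc.apply_eq v.2, map_smul, smul_smul κ⁻¹, inv_mul_cancel₀ hc.ne_zero, one_smul, ← key,
    smul_smul, inv_mul_cancel₀ (mul_ne_zero hc.ne_zero hf), one_smul]

end SchurModule

/-! ### The contragredient representation reaches all of `GL(V^*)`. -/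

section Dual

/-- Reflexivity makes every operator on `V^*` a transpose. The preimage is the transpose of `g⁻¹`,
because the dual representation already involves an inverse. -/
lemma exists_dual_eq (m : ℕ) (g : (Module.End ℂ (Module.Dual ℂ (Fin m → ℂ)))ˣ) :
    ∃ a, (standardRep m).dual a = g := by
  let F (h : Module.End ℂ (Module.Dual ℂ (Fin m → ℂ))) : Module.End ℂ (Fin m → ℂ) :=
    (Module.evalEquiv ℂ (Fin m → ℂ)).symm.toLinearMap ∘ₗ Module.Dual.transpose (R := ℂ) h ∘ₗ
      (Module.evalEquiv ℂ (Fin m → ℂ)).toLinearMap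
  have hF (h) (f : Module.Dual ℂ (Fin m → ℂ)) (v : Fin m → ℂ) : f (F h v) = h f v := by
    have := Module.apply_evalEquiv_symm_apply ℂ (Fin m → ℂ) f
      (Module.Dual.transpose (R := ℂ) h (Module.evalEquiv ℂ (Fin m → ℂ) v))
    exact this
  have hinj0 {v : Fin m → ℂ} (h : ∀ f : Module.Dual ℂ (Fin m → ℂ), f v = 0) : v = 0 :=
    (Module.forall_dual_apply_eq_zero_iff ℂ v).1 h
  have hinj {v w : Fin m → ℂ} (h : ∀ f : Module.Dual ℂ (Fin m → ℂ), f v = f w) : v = w :=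
    sub_eq_zero.1 (hinj0 fun f => by rw [map_sub, h, sub_self])
  let a : GLV m :=
    { val := F g⁻¹.1
      inv := F g.1
      val_inv := LinearMap.ext fun v => hinj fun f => by
        rw [Module.End.mul_apply, hF, hF, ← Module.End.mul_apply, Units.mul_inv]
        rfl
      inv_val := LinearMap.ext fun v => hinj fun f => by
        rw [Module.End.mul_apply, hF, hF, ← Module.End.mul_apply, Units.inv_mul]
        rfl }
  refine ⟨a, LinearMap.ext fun f => LinearMap.ext fun v => ?_⟩
  exact hF g.1 f v

end Dual

/-! ### Equivariant maps from the Schur module to the cohomology. -/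

section Multiplicity

open scoped MonoidAlgebra

lemma intertwiningMap_sum_apply {G V V' ι : Type} [Group G] [AddCommGroup V] [Module ℂ V]
    [AddCommGroup V'] [Module ℂ V'] {ρ : Representation ℂ G V} {σ : Representation ℂ G V'}
    (s : Finset ι) (f : ι → Representation.IntertwiningMap ρ σ) (v : V) :
    (∑ k ∈ s, f k).toLinearMap v = ∑ k ∈ s, (f k).toLinearMap v :=
  map_sum (AddMonoidHom.mk' (fun φ : Representation.IntertwiningMap ρ σ => φ.toLinearMap v)
    fun _ _ => rfl) f s

variable {m n i : ℕ}

local notation "W" => Module.Dual ℂ (Fin m → ℂ)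

lemma cohomologyRep_tensorClass_inl (a : GLV m) (k : Fin i → Fin n)
    (u : PiTensorProduct ℂ fun _ : Fin i => W) :
    cohomologyRep m n i (a, 1) (tensorClass k u) =
      tensorClass k (tensorPowerRep (standardRep m).dual i a u) :=
  cohomologyRep_tensorClass (a, 1) k u

variable {lam : YoungDiagram} (T : lam.cells ≃ Fin i)

/-- The space of equivariant maps from the Schur module of `V^*` to the cohomology. -/
abbrev MultiplicitySpace (m n : ℕ) {i : ℕ} {lam : YoungDiagram} (T : lam.cells ≃ Fin i) : Type :=
  Representation.IntertwiningMap (schurRep T (standardRep m).dual)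
    ((cohomologyRep m n i).comp (MonoidHom.inl (GLV m) (Equiv.Perm (Fin n))))

/-- The equivariant map from the Schur module to the cohomology defined by an element of the group
algebra of the symmetric group and a sequence of summands. -/
noncomputable def classMap (k : Fin i → Fin n) :
    ℂ[Equiv.Perm (Fin i)] →ₗ[ℂ] MultiplicitySpace m n T where
  toFun z :=
    { toLinearMap := tensorClass k ∘ₗ (tensorPermRep W i).asAlgebraHom z ∘ₗ
        (schurSub T (standardRep m).dual).toSubmodule.subtype
      isIntertwining' a := LinearMap.ext fun u => by
        refine Eq.trans ?_ (cohomologyRep_tensorClass_inl a k _).symm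
        exact congrArg (tensorClass k) (tensorPermRep_comm _ i a z _).symm }
  map_add' x y := by
    ext u
    change tensorClass k ((tensorPermRep W i).asAlgebraHom (x + y) u.1) = tensorClass k _ + tensorClass k _
    rw [map_add, LinearMap.add_apply, map_add]
    rfl
  map_smul' c x := by
    ext u
    change tensorClass k ((tensorPermRep W i).asAlgebraHom (c • x) u.1) = c • tensorClass k _
    rw [map_smul, LinearMap.smul_apply, map_smul]
    rfl

lemma classMap_apply (k : Fin i → Fin n) (z : ℂ[Equiv.Perm (Fin i)])
    (u : (schurSub T (standardRep m).dual).toSubmodule) :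
    (classMap T k z : MultiplicitySpace m n T).toLinearMap u =
      tensorClass k ((tensorPermRep W i).asAlgebraHom z u.1) := rfl

lemma multiplicityRep_classMap (s : Equiv.Perm (Fin n)) (k : Fin i → Fin n)
    (z : ℂ[Equiv.Perm (Fin i)]) :
    multiplicityRep (schurRep T (standardRep m).dual) (cohomologyRep m n i) s (classMap T k z) =
      classMap T (s ∘ k) z := by
  refine Representation.IntertwiningMap.ext (LinearMap.ext fun u => ?_)
  refine (cohomologyRep_tensorClass (1, s) k _).trans ?_
  rw [map_one]
  rfl

lemma classMap_single_mul (k : Fin i → Fin n) (σ : Equiv.Perm (Fin i))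
    (z : ℂ[Equiv.Perm (Fin i)]) :
    (classMap T k (MonoidAlgebra.single σ 1 * z) : MultiplicitySpace m n T) =
      ((Equiv.Perm.sign σ : ℤ) : ℂ) • classMap T (k ∘ σ) z := by
  refine Representation.IntertwiningMap.ext (LinearMap.ext fun u => ?_)
  refine Eq.trans ?_ (tensorClass_perm k σ ((tensorPermRep W i).asAlgebraHom z u.1))
  refine (classMap_apply T k _ u).trans ?_
  rw [map_mul, Module.End.mul_apply, Representation.asAlgebraHom_single_one]

/-- The decomposition of `H^i` over subsets is `GL(V)`-equivariant, so each component of `φ` is an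
equivariant map to a tensor power and comes from the Specht ideal. -/
lemma exists_sum_classMap (φ : MultiplicitySpace m n T) :
    ∃ z : {s : Finset (Fin n) // s.card = i} → (spechtSub T).toSubmodule,
      φ = ∑ s, classMap T (s.1.orderEmbOfFin s.2) (z s).1 := by
  let S := LinearEquiv.ofBijective (subsetClass m n i) (subsetClass_bijective i)
  have hS (a : GLV m) (v) : S (fun s => tensorPowerRep (standardRep m).dual i a (v s)) =
      cohomologyRep m n i (a, 1) (S v) := by
    change subsetClass m n i _ = cohomologyRep m n i (a, 1) (subsetClass m n i v)
    rw [subsetClass_apply, subsetClass_apply, map_sum]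
    exact Finset.sum_congr rfl fun s _ => (cohomologyRep_tensorClass_inl a _ _).symm
  have key (s : {s : Finset (Fin n) // s.card = i}) : ∃ z ∈ (spechtSub T).toSubmodule,
      ∀ u : (schurSub T (standardRep m).dual).toSubmodule,
        S.symm (φ.toLinearMap u) s = (tensorPermRep W i).asAlgebraHom z u.1 := by
    refine exists_asAlgebraHom_eq T (exists_dual_eq m)
      (LinearMap.proj s ∘ₗ S.symm.toLinearMap ∘ₗ φ.toLinearMap) fun a u => ?_
    have h1 : φ.toLinearMap (schurRep T (standardRep m).dual a u) =
        cohomologyRep m n i (a, 1) (φ.toLinearMap u) := LinearMap.congr_fun (φ.isIntertwining' a) u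
    have h2 : S.symm (cohomologyRep m n i (a, 1) (φ.toLinearMap u)) =
        fun s => tensorPowerRep (standardRep m).dual i a (S.symm (φ.toLinearMap u) s) := by
      rw [LinearEquiv.symm_apply_eq, hS, LinearEquiv.apply_symm_apply]
    exact congrFun ((congrArg S.symm h1).trans h2) s
  choose z hz h using key
  refine ⟨fun s => ⟨z s, hz s⟩, Representation.IntertwiningMap.ext (LinearMap.ext fun u => ?_)⟩
  have h1 : φ.toLinearMap u = S (S.symm (φ.toLinearMap u)) := (S.apply_symm_apply _).symm
  have h2 : S (S.symm (φ.toLinearMap u)) =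
      ∑ s, tensorClass (s.1.orderEmbOfFin s.2) (S.symm (φ.toLinearMap u) s) := subsetClass_apply _
  rw [h1, h2]
  refine Eq.trans ?_ (intertwiningMap_sum_apply _ _ _).symm
  exact Finset.sum_congr rfl fun s _ => by rw [h s u]; rfl

/-- Components at different subsets are independent, and an element of the Specht ideal that kills
the Schur module is zero. The latter requires the Young symmetrizer to act nontrivially, hence the
bound on the number of rows. -/
lemma eq_zero_of_sum_classMap_eq_zero (hm : lam.colLen 0 ≤ m)
    (z : {s : Finset (Fin n) // s.card = i} → (spechtSub T).toSubmodule)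
    (h : ∑ s, (classMap T (s.1.orderEmbOfFin s.2) (z s).1 : MultiplicitySpace m n T) = 0)
    (s : {s : Finset (Fin n) // s.card = i}) : z s = 0 := by
  obtain ⟨κ, hκ⟩ := exists_isPrimitiveMultiple_youngSymmetrizer T
  refine Subtype.ext (hκ.eq_zero_of_apply_eq_zero
    (asAlgebraHom_youngSymmetrizer_ne_zero T (Pi.basisFun ℂ (Fin m)).dualBasis hm)
    (mul_youngSymmetrizer T hκ (z s).2) fun u hu => ?_)
  have h3 := intertwiningMap_sum_apply Finset.univ
    (fun s => (classMap T (s.1.orderEmbOfFin s.2) (z s).1 : MultiplicitySpace m n T))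
    (⟨u, hu⟩ : (schurSub T (standardRep m).dual).toSubmodule)
  rw [h] at h3
  have h4 : subsetClass m n i (fun s => (tensorPermRep W i).asAlgebraHom (z s).1 u) =
      subsetClass m n i 0 := by
    rw [map_zero, subsetClass_apply]
    exact h3.symm
  exact congrFun ((subsetClass_bijective i).1 h4) s

end Multiplicity

/-! ### The Young subgroup as the stabilizer of the first block. -/

section Frobenius

variable {i j n : ℕ} (h : i + j = n)

lemma youngSubgroupHom_castLE (hi : i ≤ n) (g : Equiv.Perm (Fin i) × Equiv.Perm (Fin j)) (a : Fin i) :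
    youngSubgroupHom h g (Fin.castLE hi a) = Fin.castLE hi (g.1 a) := by
  have hk (a : Fin i) : Fin.castLE hi a = (finSumFinEquiv.trans (finCongr h)) (Sum.inl a) := rfl
  rw [hk, hk]
  change (finSumFinEquiv.trans (finCongr h)) (Equiv.Perm.sumCongr g.1 g.2
    ((finSumFinEquiv.trans (finCongr h)).symm _)) = _
  rw [Equiv.symm_apply_apply]
  rfl

lemma exists_youngSubgroupHom_eq (hi : i ≤ n) (p : Equiv.Perm (Fin n))
    (hp : ∀ a, ∃ b, p (Fin.castLE hi a) = Fin.castLE hi b) : ∃ g, youngSubgroupHom h g = p := by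
  set e := finSumFinEquiv.trans (finCongr h) with he
  have hk (a : Fin i) : Fin.castLE hi a = e (Sum.inl a) := rfl
  have : e.symm.permCongr p ∈ (Equiv.Perm.sumCongrHom (Fin i) (Fin j)).range := by
    refine Equiv.Perm.mem_sumCongrHom_range_of_perm_mapsTo_inl ?_
    rintro _ ⟨a, rfl⟩
    obtain ⟨b, hb⟩ := hp a
    refine ⟨b, ?_⟩
    rw [Equiv.permCongr_apply, Equiv.symm_symm, ← hk, hb, hk, Equiv.symm_apply_apply]
  obtain ⟨g, hg⟩ := this
  refine ⟨g, ?_⟩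
  change e.permCongr (Equiv.Perm.sumCongrHom (Fin i) (Fin j) g) = p
  rw [hg]
  ext x
  simp [Equiv.permCongr_apply]

lemma exists_perm_comp_castLE (hi : i ≤ n) (k : Fin i → Fin n) (hk : Function.Injective k) :
    ∃ g : Equiv.Perm (Fin n), g ∘ Fin.castLE hi = k := by
  obtain ⟨g, hg⟩ := (Equiv.Perm.isMultiplyPretransitive (Fin n) i).exists_smul_eq
    (Fin.castLEEmb hi) ⟨k, hk⟩
  exact ⟨g, funext fun a => DFunLike.congr_fun hg a⟩

end Frobenius

/-! ### The induced Specht representation. -/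

section InducedSpecht

open scoped MonoidAlgebra TensorProduct

variable {m n i j : ℕ} (h : i + j = n) {μ : YoungDiagram} (T : μ.cells ≃ Fin i)

/-- The space of the `S_n`-module `M_n^μ`. -/
abbrev InducedSpecht : Type :=
  Representation.IndV (youngSubgroupHom h) (boxTrivialRep (spechtRep T) (Equiv.Perm (Fin j)))

variable (j) in
/-- The representation `S^μ ⊠ 1`. -/
noncomputable abbrev spechtBoxTrivial :
    Representation ℂ (Equiv.Perm (Fin i) × Equiv.Perm (Fin j))
      (TensorProduct ℂ (SpechtModule T) ℂ) :=
  boxTrivialRep (spechtRep T) (Equiv.Perm (Fin j))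

/-- The element `[p ⊗ x]` of the induced representation. -/
noncomputable def indClass (p : Equiv.Perm (Fin n)) : SpechtModule T →ₗ[ℂ] InducedSpecht h T :=
  Representation.IndV.mk (youngSubgroupHom h) (spechtBoxTrivial j T) p ∘ₗ
    (TensorProduct.rid ℂ (SpechtModule T)).symm.toLinearMap

/-- This is the relation defining coinvariants. The subgroup acts on `p` from the left and `S_n`
from the right through inverses, so the cosets are recorded by the images of the first block under
`p⁻¹`. -/
lemma indClass_mul (g : Equiv.Perm (Fin i) × Equiv.Perm (Fin j)) (p : Equiv.Perm (Fin n))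
    (x : SpechtModule T) :
    indClass h T (youngSubgroupHom h g * p) (spechtRep T g.1 x) = indClass h T p x := by
  have := Representation.Coinvariants.mk_self_apply
    (Representation.tprod ((Representation.leftRegular ℂ (Equiv.Perm (Fin n))).comp
      (youngSubgroupHom h)) (spechtBoxTrivial j T)) g
    (MonoidAlgebra.single p 1 ⊗ₜ[ℂ] (x ⊗ₜ[ℂ] (1 : ℂ)))
  refine Eq.trans (congrArg (Representation.Coinvariants.mk _) ?_) this
  change MonoidAlgebra.single (youngSubgroupHom h g * p) 1 ⊗ₜ[ℂ]
    ((spechtRep T g.1 x) ⊗ₜ[ℂ] (1 : ℂ)) =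
    Representation.leftRegular ℂ (Equiv.Perm (Fin n)) (youngSubgroupHom h g)
      (MonoidAlgebra.single p 1) ⊗ₜ[ℂ] ((spechtRep T g.1 x) ⊗ₜ[ℂ] (1 : ℂ))
  rw [leftRegular_eq, MonoidAlgebra.single_mul_single, one_mul]

lemma inducedSpechtRep_indClass (s p : Equiv.Perm (Fin n)) (x : SpechtModule T) :
    inducedSpechtRep h T s (indClass h T p x) = indClass h T (p * s⁻¹) x :=
  Representation.ind_mk _ _ s p _

lemma inducedSpecht_induction {P : InducedSpecht h T → Prop}
    (hadd : ∀ x y, P x → P y → P (x + y)) (hmk : ∀ p x, P (indClass h T p x)) (y) : P y := by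
  have h0 : P 0 := by simpa using hmk 1 0
  induction y using Representation.Coinvariants.induction_on with | h v => ?_
  induction v using TensorProduct.induction_on with
  | zero => rwa [map_zero]
  | add x y hx hy => rw [map_add]; exact hadd _ _ hx hy
  | tmul z a =>
    induction z using MonoidAlgebra.induction_linear with
    | zero => rwa [TensorProduct.zero_tmul, map_zero]
    | add x y hx hy => rw [TensorProduct.add_tmul, map_add]; exact hadd _ _ hx hy
    | single p r =>
      have := hmk p (TensorProduct.rid ℂ (SpechtModule T) (r • a))
      have h1 : MonoidAlgebra.single p r ⊗ₜ[ℂ] a = MonoidAlgebra.single p (1 : ℂ) ⊗ₜ[ℂ] (r • a) := by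
        rw [← TensorProduct.smul_tmul, MonoidAlgebra.smul_single, smul_eq_mul, mul_one]
      rw [h1]
      rw [indClass, LinearMap.comp_apply, LinearEquiv.coe_coe, LinearEquiv.symm_apply_apply] at this
      exact this

/-- A family of maps on the Specht module which is compatible with the Young subgroup defines a map
on the induced representation. -/
lemma exists_inducedSpecht_lift {M : Type} [AddCommGroup M] [Module ℂ M]
    (f : Equiv.Perm (Fin n) → SpechtModule T →ₗ[ℂ] M)
    (hf : ∀ (g : Equiv.Perm (Fin i) × Equiv.Perm (Fin j)) p x,
      f (youngSubgroupHom h g * p) (spechtRep T g.1 x) = f p x) :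
    ∃ F : InducedSpecht h T →ₗ[ℂ] M, ∀ p x, F (indClass h T p x) = f p x := by
  let f' (p : Equiv.Perm (Fin n)) : TensorProduct ℂ (SpechtModule T) ℂ →ₗ[ℂ] M :=
    f p ∘ₗ (TensorProduct.rid ℂ (SpechtModule T)).toLinearMap
  let F0 : TensorProduct ℂ ℂ[Equiv.Perm (Fin n)] (TensorProduct ℂ (SpechtModule T) ℂ) →ₗ[ℂ] M :=
    TensorProduct.lift ((MonoidAlgebra.basis (Equiv.Perm (Fin n)) ℂ).constr ℂ f')
  have hF0 (p : Equiv.Perm (Fin n)) (x : SpechtModule T) (r : ℂ) :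
      F0 (MonoidAlgebra.single p 1 ⊗ₜ[ℂ] (x ⊗ₜ[ℂ] r)) = r • f p x := by
    rw [TensorProduct.lift.tmul, ← MonoidAlgebra.basis_apply, Module.Basis.constr_basis,
      LinearMap.comp_apply, LinearEquiv.coe_coe, TensorProduct.rid_tmul, map_smul]
  refine ⟨Representation.Coinvariants.lift _ F0 fun g => ?_, fun p x => ?_⟩
  · refine TensorProduct.ext ((MonoidAlgebra.basis (Equiv.Perm (Fin n)) ℂ).ext fun p =>
      TensorProduct.ext' fun x r => ?_)
    rw [MonoidAlgebra.basis_apply]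
    change F0 (Representation.leftRegular ℂ (Equiv.Perm (Fin n)) (youngSubgroupHom h g)
      (MonoidAlgebra.single p 1) ⊗ₜ[ℂ] ((spechtRep T g.1 x) ⊗ₜ[ℂ] r)) =
      F0 (MonoidAlgebra.single p 1 ⊗ₜ[ℂ] (x ⊗ₜ[ℂ] r))
    rw [leftRegular_eq, MonoidAlgebra.single_mul_single, one_mul, hF0, hF0, hf]
  · exact (hF0 p x 1).trans (one_smul _ _)

lemma exists_transversal (hi : i ≤ n) : ∃ t : {s : Finset (Fin n) // s.card = i} →
    Equiv.Perm (Fin n), ∀ s, t s ∘ Fin.castLE hi = s.1.orderEmbOfFin s.2 := by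
  choose t ht using fun s : {s : Finset (Fin n) // s.card = i} =>
    exists_perm_comp_castLE hi (s.1.orderEmbOfFin s.2) (s.1.orderEmbOfFin s.2).injective
  exact ⟨t, ht⟩

/-- The permutations `(t s)⁻¹` represent the cosets of the Young subgroup: `p` belongs to the set
`s` of images of the first block under `p⁻¹`. -/
lemma exists_eq_sum_indClass (hi : i ≤ n)
    (t : {s : Finset (Fin n) // s.card = i} → Equiv.Perm (Fin n))
    (ht : ∀ s, t s ∘ Fin.castLE hi = s.1.orderEmbOfFin s.2) (y : InducedSpecht h T) :
    ∃ x : {s : Finset (Fin n) // s.card = i} → SpechtModule T,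
      y = ∑ s, indClass h T (t s)⁻¹ (x s) := by
  induction y using inducedSpecht_induction h T with
  | hadd y z hy hz =>
    obtain ⟨x, rfl⟩ := hy
    obtain ⟨x', rfl⟩ := hz
    refine ⟨x + x', ?_⟩
    simp only [Pi.add_apply, map_add, Finset.sum_add_distrib]
  | hmk p x =>
    let s : {s : Finset (Fin n) // s.card = i} :=
      ⟨Finset.univ.image ((p⁻¹ : Equiv.Perm (Fin n)) ∘ Fin.castLE hi), by
        rw [Finset.card_image_of_injective _ (p⁻¹.injective.comp (Fin.castLE_injective hi)),
          Finset.card_univ, Fintype.card_fin]⟩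
    obtain ⟨g, hg⟩ := exists_youngSubgroupHom_eq h hi ((t s)⁻¹ * p⁻¹) fun a => by
      have h1 : p⁻¹ (Fin.castLE hi a) ∈ s.1 := Finset.mem_image.2 ⟨a, Finset.mem_univ _, rfl⟩
      have h2 : p⁻¹ (Fin.castLE hi a) ∈ Set.range (s.1.orderEmbOfFin s.2) := by
        rwa [Finset.range_orderEmbOfFin]
      obtain ⟨b, hb⟩ := h2
      refine ⟨b, ?_⟩
      rw [Equiv.Perm.mul_apply, ← hb, ← ht, Equiv.Perm.inv_eq_iff_eq]
      rfl
    refine ⟨Pi.single s (spechtRep T g.1 x), ?_⟩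
    rw [Finset.sum_eq_single s]
    · rw [Pi.single_eq_same, ← indClass_mul h T g p x, hg, inv_mul_cancel_right]
    · intro s' _ hs'
      rw [Pi.single_eq_of_ne hs', map_zero]
    · simp

end InducedSpecht

/-! ### Comparison of the multiplicity space with the induced representation. -/

theorem proposition3p1 (m n i : ℕ) (hi : i ≤ n) (μ : YoungDiagram)
    (T : μ.cells ≃ Fin i) (T' : μ.transpose.cells ≃ Fin i)
    (hm : μ.transpose.colLen 0 ≤ m) :
    (schurRep T' (standardRep m).dual).IsIrreducible ∧
    Nonempty (Representation.Equiv
      (multiplicityRep (schurRep T' (standardRep m).dual) (cohomologyRep m n i))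
      (inducedSpechtRep (Nat.add_sub_of_le hi) T)) := by
  refine ⟨schurRep_isIrreducible T' (exists_dual_eq m)
    (asAlgebraHom_youngSymmetrizer_ne_zero T' (Pi.basisFun ℂ (Fin m)).dualBasis hm), ?_⟩
  set h := Nat.add_sub_of_le hi
  obtain ⟨ψ, hψ⟩ := exists_spechtTwist T T'
  -- Send `[p ⊗ x]` to the map that uses the summands `p⁻¹(0), …, p⁻¹(i - 1)` and the sign twist of
  -- `x`.
  let f (p : Equiv.Perm (Fin n)) : SpechtModule T →ₗ[ℂ] MultiplicitySpace m n T' :=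
    classMap T' ((p⁻¹ : Equiv.Perm (Fin n)) ∘ Fin.castLE hi) ∘ₗ (spechtSub T').toSubmodule.subtype ∘ₗ ψ.toLinearMap
  have hf (p) (x) : f p x = classMap T' ((p⁻¹ : Equiv.Perm (Fin n)) ∘ Fin.castLE hi) (ψ x).1 := rfl
  -- Well-definedness: the sign from the Specht twist cancels the sign from anticommuting the degree
  -- one classes.
  obtain ⟨F, hF⟩ := exists_inducedSpecht_lift h T f fun g p x => by
    rw [hf, hf, hψ, map_smul, classMap_single_mul, smul_smul, ← Int.cast_mul, ← Units.val_mul,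
      Int.units_mul_self, Units.val_one, Int.cast_one, one_smul]
    refine congrArg (fun k => classMap T' k (ψ x).1) (funext fun a => ?_)
    simp only [Function.comp_apply, mul_inv_rev, Equiv.Perm.mul_apply]
    rw [← youngSubgroupHom_castLE h hi g a, ← Equiv.Perm.mul_apply (youngSubgroupHom h g)⁻¹,
      inv_mul_cancel, Equiv.Perm.one_apply]
  obtain ⟨t, ht⟩ := exists_transversal hi
  have hFt (x : {s : Finset (Fin n) // s.card = i} → SpechtModule T) :
      F (∑ s, indClass h T (t s)⁻¹ (x s)) =
        ∑ s, classMap T' (s.1.orderEmbOfFin s.2) (ψ (x s)).1 := by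
    rw [map_sum]
    refine Finset.sum_congr rfl fun s _ => ?_
    rw [hF, hf, inv_inv, ht]
  -- On the chosen coset representatives `F` is, subset by subset, the Specht twist followed by
  -- `classMap`, so bijectivity reduces to the two lemmas on sums of `classMap`.
  have hinj : Function.Injective F := by
    refine (injective_iff_map_eq_zero F).2 fun y hy => ?_
    obtain ⟨x, rfl⟩ := exists_eq_sum_indClass h T hi t ht y
    rw [hFt] at hy
    refine Finset.sum_eq_zero fun s _ => ?_
    have := eq_zero_of_sum_classMap_eq_zero T' hm (fun s => ψ (x s)) hy s
    rw [(map_eq_zero_iff ψ ψ.injective).1 this, map_zero]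
  have hsurj : Function.Surjective F := fun φ => by
    obtain ⟨z, rfl⟩ := exists_sum_classMap T' φ
    refine ⟨∑ s, indClass h T (t s)⁻¹ (ψ.symm (z s)), ?_⟩
    rw [hFt]
    simp only [LinearEquiv.apply_symm_apply]
  refine ⟨(Representation.Equiv.mk (LinearEquiv.ofBijective F ⟨hinj, hsurj⟩) fun s =>
    LinearMap.ext fun y => ?_).symm⟩
  change F (inducedSpechtRep h T s y) = multiplicityRep _ _ s (F y)
  induction y using inducedSpecht_induction h T with
  | hadd y z hy hz => rw [map_add, map_add, hy, hz, map_add, map_add]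
  | hmk p x =>
    rw [inducedSpechtRep_indClass, hF, hF, hf, hf, multiplicityRep_classMap, mul_inv_rev, inv_inv]
    rfl
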